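/- Let $A$ be a finite set and let $M\in M_A(\mathbb Z)$ be an irreducible Pisot unimodular matrix: its characteristic polynomial is irreducible over $\mathbb Q$, $\det M=\pm1$, and its eigenvalue $\beta$ of maximal modulus is a Pisot number (a real algebraic integer $>1$ all of whose other conjugates have modulus $<1$). Let $\mathcal P\subset\mathbb R^A$ be a hyperplane complementary to the eigenspace $E_\beta$ of $M$ for $\beta$, and let $\pi:\mathbb R^A\to\mathcal P$ be the projection onto $\mathcal P$ along $E_\beta$. For $U\subseteq\mathcal P$ put $Q_U=\{x\in\mathbb N^A : \pi(x)\in U\}$, and define the interior of $S\subseteq\mathbb Z^A$ by $$\overset{\circ}{S}=\bigcup\{Q_U : U\subseteq\mathcal P \text{ open},\ Q_U\subseteq S\}.$$ For a finite word $u=u_0u_1\cdots u_{n-1}$ with letters in $\mathbb Z^A$ put $Q_u=\sum_{k=0}^{n-1}M^k u_k$, and for a language $L$ put $Q_L=\{Q_u : u\in L\}$ and $\overset{\circ}{L}=\{u\in L : Q_u\in\overset{\circ}{Q}_L\}$, where $\overset{\circ}{Q}_L$ is the interior of $Q_L$. Then, for every regular language $L$ over a finite alphabet $\Sigma\subset\mathbb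 Z^A$, the language $\overset{\circ}{L}$ is regular and $Q_{\overset{\circ}{L}}=\overset{\circ}{Q}_L$. Moreover, $\overset{\circ}{L}$ is computable from $L$: there is a single algorithm (a partial recursive function) which, for every $d$ and $A=\{1,\dots,d\}$, given an irreducible Pisot unimodular matrix $M\in M_d(\mathbb Z)$ and a finite automaton recognizing a language $L$ over a finite alphabet in $\mathbb Z^d$, halts and returns a finite automaton recognizing $\overset{\circ}{L}$, whatever the choice of the hyperplane $\mathcal P$. -/

import Mathlib

open Matrix

/-- The value `Q_u = ∑_{k < |u|} M ^ k u_k` of a finite word `u` of integer vectors. -/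
def wordValue {A : Type*} [Fintype A] [DecidableEq A] (M : Matrix A A ℤ)
    (u : List (A → ℤ)) : A → ℤ :=
  ∑ k : Fin u.length, (M ^ (k : ℕ)) *ᵥ u.get k

/-- `Q_L`, the set of the values of the words of the language `L`. -/
def languageValue {A : Type*} [Fintype A] [DecidableEq A] (M : Matrix A A ℤ)
    (L : Language (A → ℤ)) : Set (A → ℤ) :=
  {x | ∃ u ∈ L, wordValue M u = x}

/-- `β` is a Pisot number: a real algebraic integer greater than one, all of whose other
(complex) conjugates have modulus less than one. -/
structure IsPisot (β : ℝ) : Prop where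
  isIntegral : IsIntegral ℤ β
  one_lt : 1 < β
  norm_conj_lt_one : ∀ z ∈ (minpoly ℚ β).aroots ℂ, z ≠ (β : ℂ) → ‖z‖ < 1

/-- `M` is an irreducible Pisot unimodular integer matrix with maximal eigenvalue `β`. -/
structure IsIrreduciblePisotUnimodular {A : Type*} [Fintype A] [DecidableEq A]
    (M : Matrix A A ℤ) (β : ℝ) : Prop where
  irreducible : Irreducible (M.map (Int.cast : ℤ → ℚ)).charpoly
  det_eq : M.det = 1 ∨ M.det = -1
  hasEigenvalue : Module.End.HasEigenvalue (Matrix.toLin' (M.map (Int.cast : ℤ → ℝ))) β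
  maximal : ∀ z ∈ (M.map (Int.cast : ℤ → ℂ)).charpoly.roots, ‖z‖ ≤ β
  isPisot : IsPisot β

/-- The eigenspace in `ℝ^A` of the integer matrix `M` for the real number `β`. -/
noncomputable def realEigenspace {A : Type*} [Fintype A] [DecidableEq A] (M : Matrix A A ℤ)
    (β : ℝ) : Submodule ℝ (A → ℝ) :=
  Module.End.eigenspace (Matrix.toLin' (M.map (Int.cast : ℤ → ℝ))) β

/-- `Q_U`, the points of `ℕ^A` (seen as the nonnegative vectors of `ℤ^A`) that the linear map
`π : ℝ^A → P` sends into `U`. -/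
def discreteLine {A : Type*} {P : Submodule ℝ (A → ℝ)} (π : (A → ℝ) →ₗ[ℝ] P) (U : Set P) :
    Set (A → ℤ) :=
  {x | (∀ a, 0 ≤ x a) ∧ π (fun a => (x a : ℝ)) ∈ U}

/-- The interior of a subset `S` of `ℤ^A`: the union of the sets `Q_U`, with `U` open in `P`,
that are contained in `S`. -/
def discreteInterior {A : Type*} {P : Submodule ℝ (A → ℝ)} (π : (A → ℝ) →ₗ[ℝ] P)
    (S : Set (A → ℤ)) : Set (A → ℤ) :=
  ⋃₀ {V | (∃ U : Set P, IsOpen U ∧ V = discreteLine π U) ∧ V ⊆ S}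

/-- The language of the words `u ∈ L` such that `Q_u` is in the interior of `Q_L`. -/
def interiorLanguage {A : Type*} [Fintype A] [DecidableEq A] (M : Matrix A A ℤ)
    {P : Submodule ℝ (A → ℝ)} (π : (A → ℝ) →ₗ[ℝ] P) (L : Language (A → ℤ)) :
    Language (A → ℤ) :=
  {u | u ∈ L ∧ wordValue M u ∈ discreteInterior π (languageValue M L)}

/-- A finite (nondeterministic) automaton as finite data: the list of the initial states, the
list of the final states, and the list of the transitions `(p, a, q)`. States are natural
numbers, and a letter `a ∈ ℤ^d` is given by the list of its `d` coordinates. -/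
abbrev AutomatonCode : Type := List ℕ × List ℕ × List (ℕ × List ℤ × ℕ)

/-- The automaton over `ℤ^d` described by the code `c`. -/
def AutomatonCode.toNFA (d : ℕ) (c : AutomatonCode) : NFA (Fin d → ℤ) ℕ where
  step p a := {q | (p, List.ofFn a, q) ∈ c.2.2}
  start := {p | p ∈ c.1}
  accept := {p | p ∈ c.2.1}

/-- The language over `ℤ^d` recognized by the automaton described by the code `c`. -/
def AutomatonCode.language (d : ℕ) (c : AutomatonCode) : Language (Fin d → ℤ) :=
  (c.toNFA d).accepts

/-- An integer matrix given as the list of its rows. -/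
def matrixCode {d : ℕ} (M : Matrix (Fin d) (Fin d) ℤ) : List (List ℤ) :=
  List.ofFn fun i => List.ofFn (M i)

/-! ### Values of words -/

section WordValue

variable {A : Type*} [Fintype A] [DecidableEq A] (M : Matrix A A ℤ)

/-! Write `χ = (X - β) h` for the characteristic polynomial. Then `R = h(M) / h(β)` is the spectral
projection onto the eigenspace of `β`, and the powers of `M` tend to zero on the image of `1 - R`,
because all the other eigenvalues have modulus less than one.

Interior points can be described by words. The value of `u 0^m w` is `Q_u + M^k Q_w` with `k = |u| +
m`, so for bounded letters its projection is as close to `π(Q_u)` as desired once `m` is large,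
uniformly in `w`. Conversely, by unimodularity every integer vector `y` equals `Q_u + M^k z` with
`z` integral. If `π(y)` is close to `π(Q_u)`, then `z` is close to the eigenline, and rounding the
points `β^(-j) R z` expands `z` with bounded digits (`exists_wordValue_eq`). Hence `u ∈ L` is in the
interior language exactly when `Q_u ≥ 0` and, for some `m`, each `u 0^m w` of nonnegative value has
its value in `Q_L` (`interiorLanguage_eq_stableInterior`). Here `P` has disappeared, and `u` enters
only through its left quotients of three languages: `L`, the words of nonnegative value and the
words with value in `Q_L`. Regularity follows once each has finitely many left quotients.

This rests on a constant `K` (`IsValueBound`): for letters in the box of radius `r`, the contracting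
part of a value is at most `K r`, and the expanding part of the value of a word of length `n` at
most `β^n K r`. If two words have the same value, cutting them at the same place leaves a carry in a
fixed box, so finitely many carries decide membership in `Q_L` (`colors_valueColor`). For signs, a
suffix whose value has all coordinates large decides them alone. The remaining values form a finite
set (`IsTrap`), because no nonzero eigenvector for `β` has a zero coordinate.

For computability `K` has to come from integer data. Root squaring yields an integer polynomial that
annihilates a power of `M` and has one coefficient exceeding the sum of the absolute values of the
others. Such a relation bounds every bounded pseudo-orbit of `M` explicitly
(`IsDominantRelation.norm_le`). A certificate consists of a relation, a trap, a row bound, a radius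
and a candidate automaton. By the pigeonhole principle on colours, all quantifiers over words become
bounded, so checking a certificate is primitive recursive. Every certificate is sound, and one
exists by the regularity part, so an unbounded search halts with a correct answer. -/

@[simp]
theorem wordValue_nil : wordValue M [] = 0 := by
  simp [wordValue]

@[simp]
theorem wordValue_cons (a : A → ℤ) (u : List (A → ℤ)) :
    wordValue M (a :: u) = a + M *ᵥ wordValue M u := by
  have h : wordValue M (a :: u) = ∑ k : Fin (u.length + 1), (M ^ (k : ℕ)) *ᵥ (a :: u).get k := rfl
  rw [h, Fin.sum_univ_succ]
  simp only [wordValue, Matrix.mulVec_sum, Matrix.mulVec_mulVec, Fin.val_zero, pow_zero,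
    Matrix.one_mulVec, Fin.val_succ, pow_succ']
  rfl

theorem wordValue_append (u v : List (A → ℤ)) :
    wordValue M (u ++ v) = wordValue M u + (M ^ u.length) *ᵥ wordValue M v := by
  induction u with
  | nil => simp
  | cons a u ih =>
    simp only [List.cons_append, wordValue_cons, ih, List.length_cons, pow_succ',
      Matrix.mulVec_add, Matrix.mulVec_mulVec]
    abel

@[simp]
theorem wordValue_replicate_zero (k : ℕ) :
    wordValue M (List.replicate k (0 : A → ℤ)) = 0 := by
  induction k with
  | zero => simp
  | succ k ih => simp [List.replicate_succ, ih]

end WordValue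

/-! ### Finite colourings of words and pigeonhole bounds -/

section Coloring

variable {α C : Type*}

/-- The colouring `f` of the words determines the left quotients of the language `L`. -/
def Colors (f : List α → C) (L : Language α) : Prop :=
  ∀ u v, f u = f v → ∀ w, u ++ w ∈ L ↔ v ++ w ∈ L

theorem Colors.of_refines {D : Type*} {f : List α → C} {g : List α → D} {L : Language α}
    (h : Colors f L) (hg : ∀ u v, g u = g v → f u = f v) : Colors g L :=
  fun u v huv => h u v (hg u v huv)

/-- Colours of the words with a given prefix. -/
theorem Colors.shift {f : List α → C} {L : Language α} (h : Colors f L) (p s : List α) :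
    Colors (fun w => f (p ++ w)) ({w | p ++ w ++ s ∈ L} : Language α) := by
  intro u v huv w
  have := h _ _ huv (w ++ s)
  change p ++ (u ++ w) ++ s ∈ L ↔ p ++ (v ++ w) ++ s ∈ L
  simpa only [List.append_assoc] using this

theorem colors_leftQuotient (L : Language α) : Colors L.leftQuotient L := by
  intro u v huv w
  rw [← Language.mem_leftQuotient, huv, Language.mem_leftQuotient]

/-- Myhill–Nerode: the left quotient by `u` factors through the finite colour of `u`. -/
theorem Colors.isRegular [Finite C] {f : List α → C} {L : Language α} (h : Colors f L) :
    L.IsRegular := by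
  classical
  refine Language.IsRegular.of_finite_range_leftQuotient ?_
  have hfac : ∀ u v, f u = f v → L.leftQuotient u = L.leftQuotient v := by
    intro u v huv
    ext w
    exact h u v huv w
  have : Function.FactorsThrough L.leftQuotient f := fun u v huv => hfac u v huv
  obtain ⟨g, hg⟩ := (Function.factorsThrough_iff _).1 this
  rw [hg, Set.range_comp]
  exact Set.toFinite _

/-- Two prefixes of `w` share a colour, and the factor between them can be deleted. The same
deletion serves all the languages coloured by `f` at once. The sublist clause keeps the letters in
their alphabet and turns a power of a letter into a power of the same letter. -/
theorem exists_shorter [Fintype C] (f : List α → C) (w : List α)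
    (hw : Fintype.card C ≤ w.length) :
    ∃ w' : List α, w'.length < w.length ∧ w'.Sublist w ∧
      ∀ L : Language α, Colors f L → (w ∈ L ↔ w' ∈ L) := by
  obtain ⟨i, j, hij, hf⟩ := Fintype.exists_ne_map_eq_of_card_lt
    (fun i : Fin (w.length + 1) => f (w.take i)) (by simpa using Nat.lt_succ_of_le hw)
  wlog hlt : i < j generalizing i j
  · exact this j i hij.symm hf.symm (lt_of_le_of_ne (not_lt.1 hlt) hij.symm)
  have hi : (i : ℕ) < j := hlt
  have hj : (j : ℕ) ≤ w.length := Nat.lt_succ_iff.1 j.2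
  refine ⟨w.take i ++ w.drop j, ?_, ?_, ?_⟩
  · simp only [List.length_append, List.length_take, List.length_drop]
    omega
  · conv_rhs => rw [← List.take_append_drop i w]
    refine (List.Sublist.refl _).append ?_
    exact List.drop_sublist_drop_left w hi.le
  · intro L hL
    have := hL _ _ hf (w.drop j)
    rw [List.take_append_drop] at this
    exact this.symm

theorem exists_short [Fintype C] (f : List α → C) (w : List α) :
    ∃ w' : List α, w'.length < Fintype.card C ∧ w'.Sublist w ∧
      ∀ L : Language α, Colors f L → (w ∈ L ↔ w' ∈ L) := by
  induction hn : w.length using Nat.strong_induction_on generalizing w with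
  | _ n ih =>
    by_cases h : w.length < Fintype.card C
    · exact ⟨w, h, List.Sublist.refl w, fun L _ => Iff.rfl⟩
    · obtain ⟨w', h1, h2, h3⟩ := exists_shorter f w (not_lt.1 h)
      obtain ⟨w'', h4, h5, h6⟩ := ih w'.length (hn ▸ h1) w' rfl
      exact ⟨w'', h4, h5.trans h2, fun L hL => (h3 L hL).trans (h6 L hL)⟩

/-- The words that belong to `L` after appending some power of the letter `z`. -/
def padClosure (z : α) (L : Language α) : Language α :=
  {t | ∃ k, t ++ List.replicate k z ∈ L}

theorem Colors.padClosure {f : List α → C} {L : Language α} (h : Colors f L) (z : α) :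
    Colors f (padClosure z L) := by
  intro u v huv w
  refine exists_congr fun k => ?_
  have := h u v huv (w ++ List.replicate k z)
  simpa only [List.append_assoc] using this

theorem mem_padClosure_iff_bounded [Fintype C] {f : List α → C} {L : Language α}
    (h : Colors f L) {S : ℕ} (hS : Fintype.card C ≤ S) (z : α) (t : List α) :
    t ∈ _root_.padClosure z L ↔ ∃ k < S, t ++ List.replicate k z ∈ L := by
  refine ⟨?_, fun ⟨k, _, hk⟩ => ⟨k, hk⟩⟩
  rintro ⟨k, hk⟩
  obtain ⟨w, h1, h2, h3⟩ := exists_short (fun w => f (t ++ w)) (List.replicate k z)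
  obtain ⟨n, hn, rfl⟩ := List.sublist_replicate_iff.1 h2
  refine ⟨n, ?_, ?_⟩
  · rw [List.length_replicate] at h1
    omega
  · have := h3 _ (h.shift t [])
    simp only [List.append_nil] at this
    exact this.1 hk

/-- The words `u` of `L` and `L₁` such that, for some `m`, each word `u z ^ m w` of `L₁`, with the
letters of `w` in `B`, is in `L₂`. -/
def stableInterior (B : Set α) (z : α) (L L₁ L₂ : Language α) : Language α :=
  {u | u ∈ L ∧ u ∈ L₁ ∧ ∃ m, ∀ w : List α, (∀ a ∈ w, a ∈ B) →
    u ++ List.replicate m z ++ w ∈ L₁ → u ++ List.replicate m z ++ w ∈ L₂}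

/-- The word `u` occurs only as a prefix of words tested against the three languages, so the
quantifiers over `m` and `w` need no new colours and no determinization. -/
theorem Colors.stableInterior {f : List α → C} {L L₁ L₂ : Language α} (h : Colors f L)
    (h₁ : Colors f L₁) (h₂ : Colors f L₂) (B : Set α) (z : α) :
    Colors f (stableInterior B z L L₁ L₂) := by
  intro u v huv w
  refine and_congr (h u v huv w) (and_congr (h₁ u v huv w) (exists_congr fun m =>
    forall_congr' fun x => forall_congr' fun _ => ?_))
  have e₁ := h₁ u v huv (w ++ List.replicate m z ++ x)
  have e₂ := h₂ u v huv (w ++ List.replicate m z ++ x)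
  simp only [List.append_assoc] at e₁ e₂ ⊢
  rw [e₁, e₂]

/-- The block of letters `z` is shortened first, by a deletion valid for all continuations `w`
simultaneously. With the block fixed, each `w` is then shortened on its own. -/
theorem mem_stableInterior_iff_bounded [Fintype C] {f : List α → C} {L L₁ L₂ : Language α}
    (h₁ : Colors f L₁) (h₂ : Colors f L₂) {S : ℕ} (hS : Fintype.card C ≤ S) (B : Set α)
    (z : α) (u : List α) :
    u ∈ stableInterior B z L L₁ L₂ ↔ u ∈ L ∧ u ∈ L₁ ∧ ∃ m < S, ∀ n < S, ∀ w : List α,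
      w.length = n → (∀ a ∈ w, a ∈ B) →
      u ++ List.replicate m z ++ w ∈ L₁ → u ++ List.replicate m z ++ w ∈ L₂ := by
  refine and_congr_right fun _ => and_congr_right fun _ => ?_
  constructor
  · rintro ⟨m, hm⟩
    obtain ⟨w, k1, k2, k3⟩ := exists_short (fun w => f (u ++ w)) (List.replicate m z)
    obtain ⟨n, hn, rfl⟩ := List.sublist_replicate_iff.1 k2
    rw [List.length_replicate] at k1
    refine ⟨n, by omega, fun _ _ x _ hx hx₁ => ?_⟩
    exact (k3 _ (h₂.shift u x)).1 (hm x hx ((k3 _ (h₁.shift u x)).2 hx₁))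
  · rintro ⟨m, _, hm⟩
    refine ⟨m, fun w hw hw₁ => ?_⟩
    obtain ⟨x, k1, k2, k3⟩ := exists_short (fun w => f ((u ++ List.replicate m z) ++ w)) w
    have e₁ := k3 _ (h₁.shift (u ++ List.replicate m z) [])
    have e₂ := k3 _ (h₂.shift (u ++ List.replicate m z) [])
    simp only [List.append_nil] at e₁ e₂
    exact e₂.2 (hm _ (by omega) x rfl (fun a ha => hw a (k2.subset ha)) (e₁.1 hw₁))

theorem eq_of_forall_short [Fintype C] {f : List α → C} {L L' : Language α} (h : Colors f L)
    (h' : Colors f L') {S : ℕ} (hS : Fintype.card C ≤ S) (B : Set α)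
    (hB : ∀ u, u ∈ L ∨ u ∈ L' → ∀ a ∈ u, a ∈ B)
    (H : ∀ n < S, ∀ u : List α, u.length = n → (∀ a ∈ u, a ∈ B) → (u ∈ L ↔ u ∈ L')) :
    L = L' := by
  ext u
  by_cases hu : ∀ a ∈ u, a ∈ B
  · obtain ⟨x, k1, k2, k3⟩ := exists_short f u
    rw [k3 L h, k3 L' h']
    exact H _ (by omega) x rfl fun a ha => hu a (k2.subset ha)
  · constructor
    · exact fun h => absurd (hB u (Or.inl h)) hu
    · exact fun h => absurd (hB u (Or.inr h)) hu

end Coloring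

/-! ### Spectral projection and contraction modulo the eigenspace -/

section Spectral

open Polynomial Filter Topology

variable {A : Type*} [Fintype A] [DecidableEq A]

theorem aeval_mulVec_of_eigen {K : Type*} [CommRing K] {N : Matrix A A K} {b : K} {w : A → K}
    (hw : N *ᵥ w = b • w) (f : K[X]) : aeval N f *ᵥ w = f.eval b • w := by
  induction f using Polynomial.induction_on' with
  | add p q hp hq => simp [Matrix.add_mulVec, hp, hq, add_smul]
  | monomial n c =>
    have : ∀ n : ℕ, (N ^ n) *ᵥ w = b ^ n • w := by
      intro n
      induction n with
      | zero => simp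
      | succ n ih => rw [pow_succ', ← Matrix.mulVec_mulVec, ih, Matrix.mulVec_smul, hw, smul_smul,
          pow_succ]
    rw [aeval_monomial, eval_monomial, ← Matrix.mulVec_mulVec, this, Matrix.mulVec_smul,
      Algebra.algebraMap_eq_smul_one, Matrix.smul_mulVec, Matrix.one_mulVec, smul_smul, mul_comm]

/-- `N` is the real matrix of `M`. -/
abbrev realMatrix (M : Matrix A A ℤ) : Matrix A A ℝ := M.map (Int.cast : ℤ → ℝ)

theorem realMatrix_pow (M : Matrix A A ℤ) (k : ℕ) : realMatrix (M ^ k) = realMatrix M ^ k :=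
  Matrix.map_pow M (Int.castRingHom ℝ) k

omit [DecidableEq A] in
theorem realMatrix_mulVec (M : Matrix A A ℤ) (x : A → ℤ) :
    realMatrix M *ᵥ (fun a => (x a : ℝ)) = fun a => ((M *ᵥ x) a : ℝ) := by
  ext i
  simp [Matrix.mulVec, dotProduct]

namespace IsIrreduciblePisotUnimodular

variable {M : Matrix A A ℤ} {β : ℝ} (hM : IsIrreduciblePisotUnimodular M β)
include hM

theorem isRoot_charpoly : (realMatrix M).charpoly.IsRoot β := by
  have := hM.hasEigenvalue
  rw [Module.End.hasEigenvalue_iff_isRoot_charpoly, Matrix.charpoly_toLin'] at this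
  exact this

theorem minpoly_eq : minpoly ℚ β = (M.map (Int.cast : ℤ → ℚ)).charpoly := by
  symm
  refine minpoly.eq_of_irreducible_of_monic hM.irreducible ?_ (Matrix.charpoly_monic _)
  have h := hM.isRoot_charpoly
  have e : (realMatrix M).charpoly = (M.map (Int.cast : ℤ → ℚ)).charpoly.map (algebraMap ℚ ℝ) := by
    rw [← Matrix.charpoly_map]
    congr 1
  rw [e, IsRoot, eval_map_algebraMap] at h
  exact h

theorem one_lt : 1 < β := hM.isPisot.one_lt

theorem norm_lt_one {z : ℂ} (hz : (M.map (Int.cast : ℤ → ℂ)).charpoly.IsRoot z)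
    (hne : z ≠ (β : ℂ)) : ‖z‖ < 1 := by
  refine hM.isPisot.norm_conj_lt_one z ?_ hne
  rw [hM.minpoly_eq, mem_aroots]
  refine ⟨(Matrix.charpoly_monic _).ne_zero, ?_⟩
  have e : (M.map (Int.cast : ℤ → ℂ)).charpoly =
      (M.map (Int.cast : ℤ → ℚ)).charpoly.map (algebraMap ℚ ℂ) := by
    rw [← Matrix.charpoly_map]
    congr 1
  rw [e, IsRoot, eval_map_algebraMap] at hz
  exact hz

/-- Irreducible polynomials over `ℚ` are separable, so `β` is a simple root; this allows the
division by `h(β)` in the spectral projection. -/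
theorem derivative_eval_ne_zero : (derivative (realMatrix M).charpoly).eval β ≠ 0 := by
  have h := hM.irreducible.separable
  have e : (realMatrix M).charpoly = (M.map (Int.cast : ℤ → ℚ)).charpoly.map (algebraMap ℚ ℝ) := by
    rw [← Matrix.charpoly_map]
    congr 1
  have hs : (realMatrix M).charpoly.Separable := by
    rw [e]
    exact h.map
  have := hs.aeval_derivative_ne_zero (x := β) (by simpa [IsRoot] using hM.isRoot_charpoly)
  simpa using this

theorem nonempty : Nonempty A := by
  by_contra h
  rw [not_nonempty_iff] at h
  have := hM.irreducible
  rw [Matrix.charpoly, Matrix.det_isEmpty] at this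
  exact this.not_isUnit isUnit_one

end IsIrreduciblePisotUnimodular

/-- `R` is the spectral projection of `M` onto the eigenspace of `β`. -/
structure IsSpectralProjection (M : Matrix A A ℤ) (β : ℝ) (R : Matrix A A ℝ) : Prop where
  comm : realMatrix M * R = R * realMatrix M
  mul_eq : realMatrix M * R = β • R
  fix : ∀ w, realMatrix M *ᵥ w = β • w → R *ᵥ w = w

/-- With `χ = (X - β) h`, the matrix `h(M) / h(β)` works: Cayley–Hamilton gives `M h(M) = β h(M)`,
and `h(M)` acts on eigenvectors for `β` as `h(β)`. -/
theorem IsIrreduciblePisotUnimodular.exists_isSpectralProjection {M : Matrix A A ℤ} {β : ℝ}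
    (hM : IsIrreduciblePisotUnimodular M β) : ∃ R, IsSpectralProjection M β R := by
  obtain ⟨h, hh⟩ := dvd_iff_isRoot.2 hM.isRoot_charpoly
  have hβ : h.eval β ≠ 0 := by
    have := hM.derivative_eval_ne_zero
    rw [hh] at this
    simpa using this
  refine ⟨(h.eval β)⁻¹ • aeval (realMatrix M) h, ?_, ?_, ?_⟩
  · rw [mul_smul_comm, smul_mul_assoc]
    congr 1
    have : Commute (aeval (realMatrix M) (X : ℝ[X])) (aeval (realMatrix M) h) :=
      (Commute.all X h).map (aeval (realMatrix M))
    simpa using this.eq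
  · have := Matrix.aeval_self_charpoly (realMatrix M)
    rw [hh, map_mul, map_sub, aeval_X, aeval_C, sub_mul, sub_eq_zero] at this
    rw [mul_smul_comm, this, smul_comm, Algebra.algebraMap_eq_smul_one, smul_mul_assoc, one_mul]
  · intro w hw
    rw [Matrix.smul_mulVec, aeval_mulVec_of_eigen hw, smul_smul, inv_mul_cancel₀ hβ, one_smul]

namespace IsSpectralProjection

variable {M : Matrix A A ℤ} {β : ℝ} {R : Matrix A A ℝ} (hP : IsSpectralProjection M β R)
include hP

omit [DecidableEq A] in
theorem mulVec_mulVec (x : A → ℝ) : realMatrix M *ᵥ (R *ᵥ x) = β • (R *ᵥ x) := by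
  rw [Matrix.mulVec_mulVec, hP.mul_eq, Matrix.smul_mulVec]

theorem pow_mulVec (k : ℕ) (x : A → ℝ) :
    (realMatrix M ^ k) *ᵥ (R *ᵥ x) = β ^ k • (R *ᵥ x) := by
  induction k with
  | zero => simp
  | succ k ih => rw [pow_succ', ← Matrix.mulVec_mulVec, ih, Matrix.mulVec_smul, hP.mulVec_mulVec,
      smul_smul, pow_succ]

theorem isIdempotent : R * R = R := by
  refine Matrix.ext_of_mulVec_single fun j => ?_
  rw [← Matrix.mulVec_mulVec]
  exact hP.fix _ (hP.mulVec_mulVec _)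

theorem mulVec_pow (k : ℕ) (x : A → ℝ) :
    R *ᵥ ((realMatrix M ^ k) *ᵥ x) = β ^ k • (R *ᵥ x) := by
  have : realMatrix M ^ k * R = R * realMatrix M ^ k :=
    (show Commute (realMatrix M) R from hP.comm).pow_left k
  rw [Matrix.mulVec_mulVec, ← this, ← Matrix.mulVec_mulVec, hP.pow_mulVec]

end IsSpectralProjection

-- Gelfand's formula: the spectral radius is below some `r < 1`, so eventually the norm of the
-- `n`-th power is at most `r ^ n`.
attribute [local instance] Matrix.linftyOpNormedRing Matrix.linftyOpNormedAlgebra in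
theorem tendsto_norm_pow_of_spectrum [Nonempty A] (N : Matrix A A ℂ)
    (h : ∀ z ∈ spectrum ℂ N, ‖z‖ < 1) : Tendsto (fun k => ‖N ^ k‖) atTop (𝓝 0) := by
  have : CompleteSpace (Matrix A A ℂ) := FiniteDimensional.complete ℂ _
  have h1 : spectralRadius ℂ N < (1 : NNReal) :=
    spectrum.spectralRadius_lt_of_forall_lt N fun z hz => by
      have := h z hz
      exact_mod_cast this
  have h2 := spectrum.pow_nnnorm_pow_one_div_tendsto_nhds_spectralRadius N
  obtain ⟨r, hr1, hr2⟩ := ENNReal.lt_iff_exists_nnreal_btwn.1 h1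
  have h3 := h2.eventually (gt_mem_nhds hr1)
  have hr : r < 1 := by exact_mod_cast hr2
  refine squeeze_zero' (Eventually.of_forall fun _ => norm_nonneg _) ?_
    (tendsto_pow_atTop_nhds_zero_of_lt_one r.2 (show (r : ℝ) < 1 by exact_mod_cast hr))
  filter_upwards [h3, eventually_gt_atTop 0] with n hn hn0
  have h4 : ((‖N ^ n‖₊ : ENNReal) ^ (1 / n : ℝ)) ^ (n : ℝ) ≤ (r : ENNReal) ^ (n : ℝ) :=
    ENNReal.rpow_le_rpow hn.le (by positivity)
  rw [← ENNReal.rpow_mul, one_div, inv_mul_cancel₀ (by positivity), ENNReal.rpow_one,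
    ENNReal.rpow_natCast] at h4
  have h5 : ‖N ^ n‖₊ ≤ r ^ n := by exact_mod_cast h4
  exact_mod_cast h5

attribute [local instance] Matrix.linftyOpNormedRing Matrix.linftyOpNormedAlgebra in
theorem tendsto_pow_of_spectrum [Nonempty A] (N : Matrix A A ℂ)
    (h : ∀ z ∈ spectrum ℂ N, ‖z‖ < 1) (i j : A) :
    Tendsto (fun k => (N ^ k) i j) atTop (𝓝 0) := by
  have h1 := tendsto_norm_pow_of_spectrum N h
  rw [tendsto_zero_iff_norm_tendsto_zero]
  refine squeeze_zero (fun _ => norm_nonneg _) (fun k => ?_) h1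
  have h2 := Matrix.linfty_opNorm_mulVec (N ^ k) (Pi.single j (1 : ℂ))
  have h3 : ‖(Pi.single j (1 : ℂ) : A → ℂ)‖ = 1 := by rw [Pi.norm_single, norm_one]
  rw [h3, mul_one] at h2
  refine le_trans ?_ h2
  have := norm_le_pi_norm ((N ^ k) *ᵥ Pi.single j (1 : ℂ)) i
  simpa using this

omit [DecidableEq A] in
theorem norm_mulVec_le {N : Matrix A A ℝ} {μ : ℝ} (hμ : 0 ≤ μ) (h : ∀ i, ∑ j, |N i j| ≤ μ)
    (x : A → ℝ) : ‖N *ᵥ x‖ ≤ μ * ‖x‖ := by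
  refine (pi_norm_le_iff_of_nonneg (by positivity)).2 fun i => ?_
  calc ‖(N *ᵥ x) i‖ ≤ ∑ j, ‖N i j * x j‖ := norm_sum_le _ _
    _ ≤ ∑ j, |N i j| * ‖x‖ := by
      refine Finset.sum_le_sum fun j _ => ?_
      rw [norm_mul, Real.norm_eq_abs]
      exact mul_le_mul_of_nonneg_left (norm_le_pi_norm x j) (abs_nonneg _)
    _ ≤ μ * ‖x‖ := by
      rw [← Finset.sum_mul]
      exact mul_le_mul_of_nonneg_right (h i) (norm_nonneg _)

omit [DecidableEq A] in
theorem map_ofReal_mulVec_re (N : Matrix A A ℝ) (w : A → ℂ) :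
    (fun i => ((N.map (algebraMap ℝ ℂ) *ᵥ w) i).re) = N *ᵥ fun i => (w i).re := by
  ext i
  simp [Matrix.mulVec, dotProduct]

omit [DecidableEq A] in
theorem map_ofReal_mulVec_im (N : Matrix A A ℝ) (w : A → ℂ) :
    (fun i => ((N.map (algebraMap ℝ ℂ) *ᵥ w) i).im) = N *ᵥ fun i => (w i).im := by
  ext i
  simp [Matrix.mulVec, dotProduct]

/-- An eigenvector of `M (1 - R)` for `z ≠ 0` is killed by `R`, hence is an eigenvector of `M` for
`z`. It cannot belong to `β`, since `R` fixes the real and imaginary parts of such a vector. So `z`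
is another conjugate. -/
theorem IsSpectralProjection.norm_lt_one_of_mem_spectrum {M : Matrix A A ℤ} {β : ℝ}
    {R : Matrix A A ℝ} (hP : IsSpectralProjection M β R)
    (hM : IsIrreduciblePisotUnimodular M β) {z : ℂ}
    (hz : z ∈ spectrum ℂ ((realMatrix M * (1 - R)).map (algebraMap ℝ ℂ))) : ‖z‖ < 1 := by
  rcases eq_or_ne z 0 with rfl | hz0
  · simp
  have hker : R * (realMatrix M * (1 - R)) = 0 := by
    rw [← mul_assoc, ← hP.comm, mul_assoc, mul_sub, mul_one, hP.isIdempotent, sub_self, mul_zero]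
  obtain ⟨w, hw0, hw⟩ : ∃ w, w ≠ 0 ∧
      (realMatrix M * (1 - R)).map (algebraMap ℝ ℂ) *ᵥ w = z • w := by
    rw [spectrum.mem_iff, Matrix.isUnit_iff_isUnit_det, isUnit_iff_ne_zero, not_not] at hz
    obtain ⟨w, hw0, hw⟩ := Matrix.exists_mulVec_eq_zero_iff.2 hz
    refine ⟨w, hw0, ?_⟩
    rw [Matrix.sub_mulVec, sub_eq_zero, Algebra.algebraMap_eq_smul_one, Matrix.smul_mulVec,
      Matrix.one_mulVec] at hw
    exact hw.symm
  have hRw : R.map (algebraMap ℝ ℂ) *ᵥ w = 0 := by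
    have h1 : R.map (algebraMap ℝ ℂ) *ᵥ
        ((realMatrix M * (1 - R)).map (algebraMap ℝ ℂ) *ᵥ w) = 0 := by
      rw [Matrix.mulVec_mulVec, ← Matrix.map_mul, hker]
      simp
    rw [hw, Matrix.mulVec_smul] at h1
    exact (smul_eq_zero.1 h1).resolve_left hz0
  have hMw : (realMatrix M).map (algebraMap ℝ ℂ) *ᵥ w = z • w := by
    rw [← hw, mul_sub, mul_one, Matrix.map_sub _ (map_sub _), Matrix.map_mul, Matrix.sub_mulVec,
      ← Matrix.mulVec_mulVec, hRw, Matrix.mulVec_zero, sub_zero]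
  have hcast : (realMatrix M).map (algebraMap ℝ ℂ) = M.map (Int.cast : ℤ → ℂ) := by
    ext i j
    simp
  refine hM.norm_lt_one ?_ ?_
  · rw [← hcast, ← Matrix.mem_spectrum_iff_isRoot_charpoly, spectrum.mem_iff,
      Matrix.isUnit_iff_isUnit_det, isUnit_iff_ne_zero, not_not]
    refine Matrix.exists_mulVec_eq_zero_iff.1 ⟨w, hw0, ?_⟩
    rw [Matrix.sub_mulVec, hMw, Algebra.algebraMap_eq_smul_one, Matrix.smul_mulVec,
      Matrix.one_mulVec, sub_self]
  · rintro rfl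
    apply hw0
    have hre := map_ofReal_mulVec_re (realMatrix M) w
    have him := map_ofReal_mulVec_im (realMatrix M) w
    have hre' := map_ofReal_mulVec_re R w
    have him' := map_ofReal_mulVec_im R w
    rw [hMw] at hre him
    rw [hRw] at hre' him'
    rw [hP.fix _ (by rw [← hre]; ext i; simp)] at hre'
    rw [hP.fix _ (by rw [← him]; ext i; simp)] at him'
    ext i
    exact Complex.ext (congrFun hre' i).symm (congrFun him' i).symm

theorem IsSpectralProjection.eventually_norm_le {M : Matrix A A ℤ} {β : ℝ} {R : Matrix A A ℝ}
    (hP : IsSpectralProjection M β R) (hM : IsIrreduciblePisotUnimodular M β) {ε : ℝ}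
    (hε : 0 < ε) : ∀ᶠ k in atTop, ∀ x, ‖(realMatrix M ^ k) *ᵥ (x - R *ᵥ x)‖ ≤ ε * ‖x‖ := by
  have := hM.nonempty
  obtain ⟨N, hN⟩ : ∃ N : Matrix A A ℝ, N = realMatrix M * (1 - R) := ⟨_, rfl⟩
  have h0 : ∀ k : ℕ, N ^ (k + 1) = realMatrix M ^ (k + 1) * (1 - R) := by
    intro k
    have hc : Commute (realMatrix M) (1 - R) :=
      (Commute.one_right _).sub_right (show Commute _ _ from hP.comm)
    have hi : IsIdempotentElem (1 - R) := IsIdempotentElem.one_sub hP.isIdempotent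
    rw [hN, hc.mul_pow, hi.pow_succ_eq]
  have h1 : ∀ i j, Tendsto (fun k : ℕ => (N ^ k) i j) atTop (𝓝 0) := by
    intro i j
    have := tendsto_pow_of_spectrum (N.map (algebraMap ℝ ℂ))
      (fun z hz => hP.norm_lt_one_of_mem_spectrum hM (by rwa [hN] at hz)) i j
    have h2 : ∀ k : ℕ, ((N.map (algebraMap ℝ ℂ)) ^ k) i j =
        (((N ^ k) i j : ℝ) : ℂ) := by
      intro k
      have := Matrix.map_pow N (algebraMap ℝ ℂ) k
      rw [← this]
      rfl
    simp only [h2] at this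
    simpa [Function.comp_def] using (Complex.continuous_re.tendsto (0 : ℂ)).comp this
  have h3 : ∀ i, Tendsto (fun k : ℕ => ∑ j, |(N ^ k) i j|) atTop (𝓝 0) := by
    intro i
    have := tendsto_finsetSum (Finset.univ : Finset A) fun j _ => (h1 i j).abs
    simpa using this
  have h4 : ∀ᶠ k : ℕ in atTop, ∀ i, ∑ j, |(N ^ k) i j| < ε :=
    eventually_all.2 fun i => (h3 i).eventually (gt_mem_nhds hε)
  filter_upwards [h4, eventually_gt_atTop 0] with k hk hk0 x
  obtain ⟨k, rfl⟩ := Nat.exists_eq_succ_of_ne_zero hk0.ne'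
  have := norm_mulVec_le hε.le (fun i => (hk i).le) x
  rw [h0, ← Matrix.mulVec_mulVec, Matrix.sub_mulVec, Matrix.one_mulVec] at this
  exact this

/-- No coordinate of a nonzero vector of the eigenspace vanishes. -/
theorem IsIrreduciblePisotUnimodular.eq_zero_of_apply_eq_zero {M : Matrix A A ℤ} {β : ℝ}
    (hM : IsIrreduciblePisotUnimodular M β) {w : A → ℝ} (hw : realMatrix M *ᵥ w = β • w) {i : A}
    (hi : w i = 0) : w = 0 := by
  set N := M.map (Int.cast : ℤ → ℚ) with hN
  have hdeg : N.charpoly.natDegree = Fintype.card A := Matrix.charpoly_natDegree_eq_dim N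
  -- The map takes `f` to the row `i` of `f(N)`. On polynomials of degree less than `|A|` it is
  -- injective, since a nonzero such `f` is coprime to the characteristic polynomial and `f(N)` is
  -- therefore invertible. By dimension it is onto, so some `f(N)` has `e_j` as its row `i`, and `w
  -- j = (f(M) w) i = f(β) w i = 0`.
  let Φ : ℚ[X] →ₗ[ℚ] (A → ℚ) :=
    { toFun := fun f => (aeval N f) i
      map_add' := fun f g => by ext j; simp
      map_smul' := fun c f => by ext j; simp }
  let Ψ := (Φ.comp (degreeLT ℚ (Fintype.card A)).subtype).comp
    (degreeLTEquiv ℚ (Fintype.card A)).symm.toLinearMap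
  have hinj : Function.Injective Ψ := by
    rw [injective_iff_map_eq_zero]
    intro c hc
    set f := (degreeLTEquiv ℚ (Fintype.card A)).symm c with hf
    have hc' : (aeval N (f : ℚ[X])) i = 0 := hc
    by_contra hne
    have hf0 : (f : ℚ[X]) ≠ 0 := by
      intro h0
      apply hne
      have : f = 0 := Subtype.ext h0
      rw [hf] at this
      simpa using this
    have hcop : IsCoprime N.charpoly (f : ℚ[X]) := by
      rw [hM.irreducible.coprime_iff_not_dvd]
      intro hd
      have h1 := natDegree_le_of_dvd hd hf0
      have h2 := mem_degreeLT.1 f.2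
      rw [degree_eq_natDegree hf0] at h2
      rw [hdeg] at h1
      exact absurd h1 (not_le.2 (by exact_mod_cast h2))
    obtain ⟨a, b, hab⟩ := hcop
    have h3 := congrArg (fun p => (aeval N p) i i) hab
    simp only [map_add, map_mul, Matrix.aeval_self_charpoly, mul_zero, zero_add, map_one,
      Matrix.one_apply_eq] at h3
    rw [← map_mul, mul_comm, map_mul, Matrix.mul_apply] at h3
    simp [hc'] at h3
  have hsurj : Function.Surjective Ψ :=
    (LinearMap.injective_iff_surjective_of_finrank_eq_finrank (by simp)).1 hinj
  ext j
  obtain ⟨c, hc⟩ := hsurj (Pi.single j 1)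
  set f := (degreeLTEquiv ℚ (Fintype.card A)).symm c
  have hc' : (aeval N (f : ℚ[X])) i = Pi.single j 1 := hc
  have h1 := congrFun (aeval_mulVec_of_eigen hw ((f : ℚ[X]).map (algebraMap ℚ ℝ))) i
  have h2 : aeval (realMatrix M) ((f : ℚ[X]).map (algebraMap ℚ ℝ)) =
      (aeval N (f : ℚ[X])).map (algebraMap ℚ ℝ) := by
    have e : realMatrix M = N.map (algebraMap ℚ ℝ) := by
      ext i j
      simp [hN]
    rw [aeval_map_algebraMap, e]
    exact aeval_algHom_apply (Algebra.ofId ℚ ℝ).mapMatrix N (f : ℚ[X])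
  rw [Pi.smul_apply, hi, smul_zero, h2] at h1
  simp only [Matrix.mulVec, dotProduct, Matrix.map_apply, hc', Pi.single_apply] at h1
  simpa using h1

end Spectral

/-! ### Dominant integer relations and explicit orbit bounds -/

section Dominant

open Polynomial Filter Topology

/-- Graeffe's root squaring: up to sign, `F(X) F(-X)` is a polynomial in `X ^ 2` whose roots in that
variable are the squares of the roots of `F`. -/
theorem exists_graeffe {s : Multiset ℂ} (F : ℤ[X])
    (hF : F.map (Int.castRingHom ℂ) = (s.map fun a => X - C a).prod) :
    ∃ G : ℤ[X], G.map (Int.castRingHom ℂ) = (s.map fun a => X - C (a ^ 2)).prod := by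
  have key : ∀ s : Multiset ℂ,
      (s.map fun a => X - C a).prod * ((s.map fun a => X - C a).prod).comp (-X) =
        expand ℂ 2 ((-1) ^ Multiset.card s * (s.map fun a => X - C (a ^ 2)).prod) := by
    intro s
    induction s using Multiset.induction_on with
    | empty => simp
    | cons a s ih =>
      simp only [Multiset.map_cons, Multiset.prod_cons, mul_comp, Multiset.card_cons,
        pow_succ _ (Multiset.card s), map_mul, expand_C, map_sub, expand_X, sub_comp, X_comp,
        C_comp, map_pow, map_neg, map_one] at ih ⊢
      linear_combination (X - C a) * (-X - C a) * ih
  refine ⟨(-1) ^ Multiset.card s * contract 2 (F * F.comp (-X)), ?_⟩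
  rw [Polynomial.map_mul, map_contract two_ne_zero, Polynomial.map_mul, Polynomial.map_comp, hF]
  simp only [Polynomial.map_neg, map_X, Polynomial.map_pow, Polynomial.map_one]
  rw [key, contract_expand _ two_ne_zero, ← mul_assoc]
  simp [← mul_pow]

theorem exists_map_eq_prod_pow {s : Multiset ℂ} (F : ℤ[X])
    (hF : F.map (Int.castRingHom ℂ) = (s.map fun a => X - C a).prod) (n : ℕ) :
    ∃ G : ℤ[X], G.map (Int.castRingHom ℂ) = (s.map fun a => X - C (a ^ 2 ^ n)).prod := by
  induction n with
  | zero => exact ⟨F, by simpa using hF⟩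
  | succ n ih =>
    obtain ⟨G, hG⟩ := ih
    have h := exists_graeffe (s := s.map fun a => a ^ 2 ^ n) G (by simpa using hG)
    simp only [Multiset.map_map, Function.comp_def, ← pow_mul, ← pow_succ] at h
    exact h

theorem tendsto_coeff_prod {s : Multiset ℂ} (hs : ∀ a ∈ s, ‖a‖ < 1) (k : ℕ) :
    Tendsto (fun n : ℕ => ((s.map fun a => X - C (a ^ 2 ^ n)).prod : ℂ[X]).coeff k) atTop
      (𝓝 (((X : ℂ[X]) ^ Multiset.card s).coeff k)) := by
  induction s using Multiset.induction_on generalizing k with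
  | empty => simp
  | cons a s ih =>
    have ih := fun k => ih (fun b hb => hs b (Multiset.mem_cons_of_mem hb)) k
    have ha : Tendsto (fun n : ℕ => a ^ 2 ^ n) atTop (𝓝 0) :=
      (tendsto_pow_atTop_nhds_zero_of_norm_lt_one (hs a (Multiset.mem_cons_self a s))).comp
        (tendsto_pow_atTop_atTop_of_one_lt one_lt_two)
    simp only [Multiset.map_cons, Multiset.prod_cons, Multiset.card_cons, sub_mul, coeff_sub,
      coeff_C_mul, pow_succ']
    have h2 := ha.mul (ih k)
    rw [zero_mul] at h2
    cases k with
    | zero => simpa [mul_coeff_zero] using h2.neg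
    | succ k =>
      simp only [coeff_X_mul]
      simpa using (ih k).sub h2

/-- The list `g` holds the coefficients of a polynomial that annihilates `M`, one of them being
larger in absolute value than the sum of the other ones. -/
structure IsDominantRelation {A : Type*} [Fintype A] [DecidableEq A] (M : Matrix A A ℤ)
    (g : List ℤ) : Prop where
  sum_eq : ∑ k ∈ Finset.range g.length, g.getD k 0 • M ^ k = 0
  dominant : ∃ k < g.length,
    ∑ i ∈ Finset.range g.length, (g.getD i 0).natAbs < 2 * (g.getD k 0).natAbs

variable {A : Type*} [Fintype A] [DecidableEq A]

theorem IsIrreduciblePisotUnimodular.exists_roots {M : Matrix A A ℤ} {β : ℝ}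
    (hM : IsIrreduciblePisotUnimodular M β) : ∃ s : Multiset ℂ, (∀ a ∈ s, ‖a‖ < 1) ∧
      M.charpoly.map (Int.castRingHom ℂ) = (((β : ℂ) ::ₘ s).map fun a => X - C a).prod := by
  set χ := M.charpoly.map (Int.castRingHom ℂ) with hχ
  have e : χ = (M.map (Int.cast : ℤ → ℂ)).charpoly := by
    rw [hχ, ← Matrix.charpoly_map]
    rfl
  have e' : χ = (M.map (Int.cast : ℤ → ℚ)).charpoly.map (algebraMap ℚ ℂ) := by
    rw [e, ← Matrix.charpoly_map]
    congr 1
  have hmonic : χ.Monic := by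
    rw [e]
    exact Matrix.charpoly_monic _
  have hroot : (β : ℂ) ∈ χ.roots := by
    rw [mem_roots hmonic.ne_zero]
    have h := hM.isRoot_charpoly
    have e2 : χ = (realMatrix M).charpoly.map (algebraMap ℝ ℂ) := by
      rw [e, ← Matrix.charpoly_map]
      congr 1
    rw [e2, IsRoot, show (β : ℂ) = algebraMap ℝ ℂ β from rfl, eval_map_algebraMap,
      aeval_algebraMap_apply]
    simpa [IsRoot] using h
  have hnodup : χ.roots.Nodup := by
    refine nodup_roots ?_
    rw [e']
    exact hM.irreducible.separable.map
  obtain ⟨s, hs⟩ := Multiset.exists_cons_of_mem hroot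
  refine ⟨s, fun a ha => ?_, ?_⟩
  · refine hM.norm_lt_one (z := a) ?_ ?_
    · rw [← e, ← mem_roots hmonic.ne_zero, hs]
      exact Multiset.mem_cons_of_mem ha
    · rintro rfl
      rw [hs] at hnodup
      exact (Multiset.nodup_cons.1 hnodup).1 ha
  · rw [← hs]
    exact (IsAlgClosed.splits χ).eq_prod_roots_of_monic hmonic

/-- The polynomial `F(X ^ N)` annihilates `M`, and its coefficients are those of `F` interspersed
with zeros, so dominance is inherited. -/
theorem isDominantRelation_of_polynomial {M : Matrix A A ℤ} {F : ℤ[X]} {N d : ℕ}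
    (hN : N ≠ 0) (hF : aeval (M ^ N) F = 0) (hd : F.natDegree ≤ d) {k : ℕ} (hk : k ≤ d)
    (hdom : ∑ i ∈ Finset.range (d + 1), (F.coeff i).natAbs < 2 * (F.coeff k).natAbs) :
    IsDominantRelation M ((List.range (d * N + 1)).map (expand ℤ N F).coeff) := by
  set g := (List.range (d * N + 1)).map (expand ℤ N F).coeff with hg
  have hlen : g.length = d * N + 1 := by simp [hg]
  have hget : ∀ i < d * N + 1, g.getD i 0 = (expand ℤ N F).coeff i := by
    intro i hi
    simp [hg, List.getD, hi]
  have hNpos : 0 < N := Nat.pos_of_ne_zero hN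
  refine ⟨?_, k * N, ?_, ?_⟩
  · rw [hlen, Finset.sum_congr rfl fun i hi => by rw [hget i (Finset.mem_range.1 hi)]]
    rw [← expand_aeval, aeval_eq_sum_range' (n := d * N + 1)] at hF
    · exact hF
    · rw [natDegree_expand]
      exact Nat.lt_succ_of_le (Nat.mul_le_mul_right N hd)
  · rw [hlen]
    exact Nat.lt_succ_of_le (Nat.mul_le_mul_right N hk)
  · rw [hlen, Finset.sum_congr rfl fun i hi => by rw [hget i (Finset.mem_range.1 hi)],
      hget _ (Nat.lt_succ_of_le (Nat.mul_le_mul_right N hk)), coeff_expand_mul hNpos]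
    refine lt_of_eq_of_lt ?_ hdom
    have hinj : Function.Injective fun i : ℕ => i * N := fun i j h => Nat.eq_of_mul_eq_mul_right hNpos h
    have := Finset.sum_image (s := Finset.range (d + 1))
      (f := fun i => ((expand ℤ N F).coeff i).natAbs) hinj.injOn
    simp only [coeff_expand_mul hNpos] at this
    rw [← this]
    symm
    refine Finset.sum_subset ?_ ?_
    · intro i hi
      obtain ⟨j, hj, rfl⟩ := Finset.mem_image.1 hi
      rw [Finset.mem_range] at hj ⊢
      exact Nat.lt_succ_of_le (Nat.mul_le_mul_right N (Nat.lt_succ_iff.1 hj))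
    · intro i hi hi'
      rw [coeff_expand hNpos, if_neg, Int.natAbs_zero]
      rintro ⟨j, rfl⟩
      apply hi'
      rw [Finset.mem_range, Nat.lt_succ_iff, mul_comm] at hi
      exact Finset.mem_image.2 ⟨j, Finset.mem_range.2 (Nat.lt_succ_of_le
        (Nat.le_of_mul_le_mul_right hi hNpos)), mul_comm _ _⟩

/-- Let `F n` have the `2 ^ n`-th powers of the roots as roots. Divided by `β ^ 2 ^ n`, it converges
coefficientwise to `-X ^ d`, where `d` is the number of the other conjugates, so the coefficient of
degree `d` eventually dominates. -/
theorem IsIrreduciblePisotUnimodular.exists_isDominantRelation {M : Matrix A A ℤ} {β : ℝ}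
    (hM : IsIrreduciblePisotUnimodular M β) : ∃ g, IsDominantRelation M g := by
  obtain ⟨s, hs1, hs⟩ := hM.exists_roots
  set d := Multiset.card s with hd
  have hβ0 : (β : ℂ) ≠ 0 := by
    have := hM.one_lt
    exact_mod_cast (zero_lt_one.trans this).ne'
  choose F hF using fun n => exists_map_eq_prod_pow M.charpoly hs n
  have hann : ∀ n, aeval (M ^ 2 ^ n) (F n) = 0 := by
    intro n
    rw [← expand_aeval]
    refine aeval_eq_zero_of_dvd_aeval_eq_zero (p := M.charpoly) ?_ (Matrix.aeval_self_charpoly M)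
    rw [← map_dvd_map (Int.castRingHom ℂ) Int.cast_injective (Matrix.charpoly_monic M), hs,
      map_expand, hF]
    rw [map_multiset_prod, Multiset.map_map]
    refine Multiset.prod_dvd_prod_of_dvd _ _ fun a _ => ?_
    -- Factor by factor, `X - a` divides `X ^ N - a ^ N`; hence the characteristic polynomial
    -- divides `F n (X ^ N)` with `N = 2 ^ n`.
    have hdvd : ∀ N : ℕ, X - C a ∣ expand ℂ N (X - C (a ^ N)) := by
      intro N
      simp only [map_sub, expand_X, expand_C, map_pow]
      exact sub_dvd_pow_sub_pow X (C a) N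
    exact hdvd (2 ^ n)
  have hcard : Multiset.card ((β : ℂ) ::ₘ s) = d + 1 := by simp [hd]
  have hdeg : ∀ n, (F n).natDegree ≤ d + 1 := by
    intro n
    rw [← natDegree_map_eq_of_injective (Int.castRingHom ℂ).injective_int, hF]
    refine (natDegree_multiset_prod_le _).trans ?_
    rw [Multiset.map_map, ← hcard]
    refine (Multiset.sum_le_card_nsmul _ 1 ?_).trans (by simp)
    intro x hx
    obtain ⟨a, _, rfl⟩ := Multiset.mem_map.1 hx
    exact natDegree_X_sub_C_le _
  have hβ : Tendsto (fun n : ℕ => ((β : ℂ) ^ 2 ^ n)⁻¹) atTop (𝓝 0) := by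
    have h1 : Tendsto (fun n : ℕ => ((β : ℂ)⁻¹) ^ 2 ^ n) atTop (𝓝 0) := by
      refine (tendsto_pow_atTop_nhds_zero_of_norm_lt_one ?_).comp
        (tendsto_pow_atTop_atTop_of_one_lt one_lt_two)
      rw [norm_inv, Complex.norm_real, Real.norm_of_nonneg (zero_lt_one.trans hM.one_lt).le]
      exact inv_lt_one_of_one_lt₀ hM.one_lt
    simpa using h1
  have hcoeff : ∀ k, Tendsto (fun n => ((β : ℂ) ^ 2 ^ n)⁻¹ * ((F n).coeff k : ℂ)) atTop
      (𝓝 (-((X : ℂ[X]) ^ d).coeff k)) := by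
    intro k
    have h1 : ∀ n, ((F n).coeff k : ℂ) =
        (((β : ℂ) ::ₘ s).map fun a => X - C (a ^ 2 ^ n)).prod.coeff k := by
      intro n
      rw [← hF, coeff_map]
      rfl
    simp only [h1, Multiset.map_cons, Multiset.prod_cons, sub_mul, coeff_sub, coeff_C_mul, mul_sub]
    have h2 := tendsto_coeff_prod hs1 k
    have h3 : ∀ n : ℕ, ((β : ℂ) ^ 2 ^ n)⁻¹ * ((β : ℂ) ^ 2 ^ n *
        (s.map fun a => X - C (a ^ 2 ^ n)).prod.coeff k) =
        (s.map fun a => X - C (a ^ 2 ^ n)).prod.coeff k := fun n =>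
      inv_mul_cancel_left₀ (pow_ne_zero _ hβ0) _
    simp only [h3]
    rw [← zero_sub]
    refine Tendsto.sub ?_ h2
    cases k with
    | zero => simp [mul_coeff_zero]
    | succ k =>
      simp only [coeff_X_mul]
      simpa using hβ.mul (tendsto_coeff_prod hs1 k)
  have hev : ∀ᶠ n in atTop, ∑ i ∈ Finset.range (d + 1 + 1),
      ‖((β : ℂ) ^ 2 ^ n)⁻¹ * ((F n).coeff i : ℂ)‖ <
      2 * ‖((β : ℂ) ^ 2 ^ n)⁻¹ * ((F n).coeff d : ℂ)‖ := by
    -- The two sides tend to 1 and 2.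
    refine (tendsto_finsetSum _ fun i _ => (hcoeff i).norm).eventually_lt
      ((hcoeff d).norm.const_mul 2) ?_
    rw [Finset.sum_eq_single d]
    · simp
    · intro i _ hi
      simp [coeff_X_pow, hi]
    · intro h
      exact absurd (Finset.mem_range.2 (by omega)) h
  obtain ⟨n, hn⟩ := hev.exists
  refine ⟨_, isDominantRelation_of_polynomial (N := 2 ^ n) (d := d + 1) (k := d) (by positivity)
    (hann n) (hdeg n) (Nat.le_succ d) ?_⟩
  have hpos : 0 < ‖((β : ℂ) ^ 2 ^ n)⁻¹‖ := norm_pos_iff.2 (inv_ne_zero (pow_ne_zero _ hβ0))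
  simp only [norm_mul, ← Finset.mul_sum] at hn
  rw [mul_left_comm, mul_lt_mul_iff_right₀ hpos] at hn
  have h4 : ∀ z : ℤ, ‖(z : ℂ)‖ = ((z.natAbs : ℕ) : ℝ) := by
    intro z
    rw [Complex.norm_intCast, Nat.cast_natAbs, Int.cast_abs]
  simp only [h4] at hn
  exact_mod_cast hn

/-- The real number bounding the bounded orbits of `M` with errors of size at most one. -/
def orbitBound (g : List ℤ) (μ : ℕ) : ℕ :=
  (∑ i ∈ Finset.range g.length, (g.getD i 0).natAbs) * (g.length * μ ^ g.length)

/-- Let `X` be the supremum of `‖x j‖`, `G` the dominant coefficient and `T` the sum of all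
coefficients, in absolute value. Since `x (j + i)` is `M ^ i x j` up to an error `n μ ^ n a`, the
relation gives `G X ≤ (T - G) X + T n μ ^ n a`. As `2 G - T ≥ 1`, this bounds `X`. The a priori
bound `B` makes `X` finite and leaves no trace in the conclusion. -/
theorem IsDominantRelation.norm_le {M : Matrix A A ℤ} {g : List ℤ} (hg : IsDominantRelation M g)
    {μ : ℕ} (hμ1 : 1 ≤ μ) (hμ : ∀ i, ∑ j, |realMatrix M i j| ≤ μ) {x e : ℤ → A → ℝ} {a B : ℝ}
    (hx : ∀ j, x (j + 1) = realMatrix M *ᵥ x j + e j) (he : ∀ j, ‖e j‖ ≤ a)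
    (hB : ∀ j, ‖x j‖ ≤ B) (j : ℤ) : ‖x j‖ ≤ orbitBound g μ * a := by
  have hμ1' : (1 : ℝ) ≤ μ := by exact_mod_cast hμ1
  have ha : 0 ≤ a := (norm_nonneg _).trans (he 0)
  have hstep : ∀ (k : ℕ) (j : ℤ),
      ‖x (j + k) - (realMatrix M ^ k) *ᵥ x j‖ ≤ k * (μ : ℝ) ^ k * a := by
    intro k j
    induction k with
    | zero => simp
    | succ k ih =>
      have e1 : x (j + (k + 1 : ℕ)) - (realMatrix M ^ (k + 1)) *ᵥ x j =
          realMatrix M *ᵥ (x (j + k) - (realMatrix M ^ k) *ᵥ x j) + e (j + k) := by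
        rw [Nat.cast_succ, ← add_assoc, hx, pow_succ', Matrix.mulVec_sub, Matrix.mulVec_mulVec]
        abel
      rw [e1]
      have h1 := norm_mulVec_le (by positivity) hμ (x (j + k) - (realMatrix M ^ k) *ᵥ x j)
      have h2 : (μ : ℝ) * ‖x (j + k) - (realMatrix M ^ k) *ᵥ x j‖ ≤ μ * (k * (μ : ℝ) ^ k * a) := by
        gcongr
      have h3 : a ≤ (μ : ℝ) ^ (k + 1) * a := le_mul_of_one_le_left ha (one_le_pow₀ hμ1')
      have h4 := (norm_add_le _ _).trans (add_le_add (h1.trans h2) (he (j + k)))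
      push_cast
      calc _ ≤ _ := h4
        _ ≤ μ * (k * (μ : ℝ) ^ k * a) + (μ : ℝ) ^ (k + 1) * a := by gcongr
        _ = _ := by ring
  set n := g.length with hn
  set T := ∑ i ∈ Finset.range n, (g.getD i 0).natAbs with hT
  obtain ⟨k, hk, hdom⟩ := hg.dominant
  set G := (g.getD k 0).natAbs with hG
  set X := ⨆ j, ‖x j‖ with hX
  have hbdd : BddAbove (Set.range fun j => ‖x j‖) := ⟨B, by rintro _ ⟨j, rfl⟩; exact hB j⟩
  have hxX : ∀ j, ‖x j‖ ≤ X := fun j => le_ciSup hbdd j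
  have hX0 : 0 ≤ X := (norm_nonneg _).trans (hxX 0)
  have habs : ∀ (z : ℤ) (v : A → ℝ), ‖(z : ℝ) • v‖ = (z.natAbs : ℝ) * ‖v‖ := by
    intro z v
    rw [norm_smul, Real.norm_eq_abs, Nat.cast_natAbs, Int.cast_abs]
  have hsum : ∀ j : ℤ, ∑ i ∈ Finset.range n, ((g.getD i 0 : ℤ) : ℝ) • ((realMatrix M ^ i) *ᵥ x j) = 0 := by
    intro j
    have h1 := congrArg (fun N : Matrix A A ℤ => realMatrix N *ᵥ x j) hg.sum_eq
    have h2 : realMatrix (∑ i ∈ Finset.range n, g.getD i 0 • M ^ i) =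
        ∑ i ∈ Finset.range n, ((g.getD i 0 : ℤ) : ℝ) • realMatrix M ^ i := by
      have := map_sum (Int.castRingHom ℝ).mapMatrix (fun i => g.getD i 0 • M ^ i) (Finset.range n)
      refine this.trans (Finset.sum_congr rfl fun i _ => ?_)
      rw [map_zsmul, map_pow, Int.cast_smul_eq_zsmul]
      rfl
    simp only [← hn, h2, Matrix.sum_mulVec, Matrix.smul_mulVec] at h1
    rw [h1]
    ext i
    simp [Matrix.mulVec, dotProduct]
  have hmain : ∀ j, (G : ℝ) * ‖x j‖ ≤ ((T : ℝ) - G) * X + T * (n * (μ : ℝ) ^ n) * a := by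
    intro j
    -- The orbit is two-sided, so the relation can start `k` steps earlier and place the dominant
    -- coefficient on `x j`.
    set j' := j - k with hj'
    have h1 : ∑ i ∈ Finset.range n, ((g.getD i 0 : ℤ) : ℝ) • x (j' + i) =
        ∑ i ∈ Finset.range n,
          ((g.getD i 0 : ℤ) : ℝ) • (x (j' + i) - (realMatrix M ^ i) *ᵥ x j') := by
      simp only [smul_sub, Finset.sum_sub_distrib, hsum, sub_zero]
    rw [← Finset.add_sum_erase _ _ (Finset.mem_range.2 hk), ← eq_sub_iff_add_eq] at h1
    have hj : j' + (k : ℤ) = j := by rw [hj']; ring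
    have h2 := congrArg norm h1
    rw [habs, hj] at h2
    rw [h2, add_comm]
    refine (norm_sub_le _ _).trans (add_le_add ?_ ?_)
    · refine (norm_sum_le _ _).trans ?_
      simp only [habs]
      calc _ ≤ ∑ i ∈ Finset.range n, ((g.getD i 0).natAbs : ℝ) * (n * (μ : ℝ) ^ n * a) := by
            refine Finset.sum_le_sum fun i hi => ?_
            have hi' : i ≤ n := (Finset.mem_range.1 hi).le
            refine mul_le_mul_of_nonneg_left ((hstep i j').trans ?_) (Nat.cast_nonneg _)
            gcongr
        _ = _ := by
            rw [← Finset.sum_mul, hT]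
            push_cast
            ring
    · refine (norm_sum_le _ _).trans ?_
      simp only [habs]
      calc _ ≤ ∑ i ∈ (Finset.range n).erase k, ((g.getD i 0).natAbs : ℝ) * X :=
            Finset.sum_le_sum fun i hi => mul_le_mul_of_nonneg_left (hxX _) (Nat.cast_nonneg _)
        _ = _ := by
            rw [← Finset.sum_mul]
            congr 1
            rw [eq_sub_iff_add_eq', hT, ← Finset.add_sum_erase _ _ (Finset.mem_range.2 hk)]
            push_cast
            rfl
  have hGX : (G : ℝ) * X ≤ ((T : ℝ) - G) * X + T * (n * (μ : ℝ) ^ n) * a := by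
    rcases (Nat.cast_nonneg (α := ℝ) G).eq_or_lt with h0 | h0
    · rw [← h0, zero_mul]
      have : 0 ≤ (T : ℝ) := Nat.cast_nonneg _
      rw [sub_zero]
      positivity
    · rw [← le_div_iff₀' h0]
      exact ciSup_le fun j => (le_div_iff₀' h0).2 (hmain j)
  have hint : (T : ℝ) + 1 ≤ 2 * G := by exact_mod_cast hdom
  refine (hxX j).trans ?_
  have : orbitBound g μ * a = T * (n * (μ : ℝ) ^ n) * a := by
    simp [orbitBound, hT, hn]
  rw [this]
  nlinarith

end Dominant

/-! ### Bounds for values of words, and expansions with bounded digits -/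

section Bounds

open Filter Topology

variable {A : Type*}

/-- The integer vectors with coordinates of absolute value at most `r`. -/
def box (A : Type*) (r : ℕ) : Set (A → ℤ) :=
  {x | ∀ i, (x i).natAbs ≤ r}

theorem zero_mem_box (r : ℕ) : (0 : A → ℤ) ∈ box A r := fun i => by simp

/-- An integer vector, seen as a real vector. -/
def toReal (x : A → ℤ) : A → ℝ := fun a => (x a : ℝ)

@[simp] theorem toReal_apply (x : A → ℤ) (a : A) : toReal x a = x a := rfl

@[simp] theorem toReal_zero : toReal (0 : A → ℤ) = 0 := by ext; simp

theorem toReal_add (x y : A → ℤ) : toReal (x + y) = toReal x + toReal y := by ext; simp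

theorem toReal_sub (x y : A → ℤ) : toReal (x - y) = toReal x - toReal y := by ext; simp

variable [Fintype A]

theorem toReal_mulVec (M : Matrix A A ℤ) (x : A → ℤ) :
    toReal (M *ᵥ x) = realMatrix M *ᵥ toReal x :=
  (realMatrix_mulVec M x).symm

theorem norm_toReal_le {x : A → ℤ} {r : ℕ} (hx : x ∈ box A r) : ‖toReal x‖ ≤ r := by
  refine (pi_norm_le_iff_of_nonneg (Nat.cast_nonneg r)).2 fun i => ?_
  rw [toReal_apply, Real.norm_eq_abs, ← Int.cast_abs, Int.abs_eq_natAbs]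
  exact_mod_cast hx i

theorem mem_box_of_norm_le {x : A → ℤ} {r : ℕ} (hx : ‖toReal x‖ ≤ r) : x ∈ box A r := by
  intro i
  have := (norm_le_pi_norm (toReal x) i).trans hx
  rw [toReal_apply, Real.norm_eq_abs, ← Int.cast_abs, Int.abs_eq_natAbs] at this
  exact_mod_cast this

theorem finite_box (r : ℕ) : (box A r).Finite := by
  refine (Set.Finite.pi' (ι := A) (t := fun _ => Set.Icc (-(r : ℤ)) r)
    fun _ => Set.finite_Icc _ _).subset fun x hx i => ?_
  have := hx i
  exact Set.mem_Icc.2 ⟨by omega, by omega⟩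

variable [DecidableEq A]

theorem toReal_pow_mulVec (M : Matrix A A ℤ) (k : ℕ) (x : A → ℤ) :
    toReal ((M ^ k) *ᵥ x) = (realMatrix M ^ k) *ᵥ toReal x := by
  rw [toReal_mulVec, realMatrix_pow]

/-- The number `K` bounds the contracting part of the value of the words, and, up to scaling, its
expanding part. -/
structure IsValueBound (M : Matrix A A ℤ) (β : ℝ) (R : Matrix A A ℝ) (K : ℕ) : Prop where
  contracting : ∀ (r : ℕ) (t : List (A → ℤ)), (∀ a ∈ t, a ∈ box A r) →
    ‖toReal (wordValue M t) - R *ᵥ toReal (wordValue M t)‖ ≤ K * r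
  expanding : ∀ (r : ℕ) (t : List (A → ℤ)), (∀ a ∈ t, a ∈ box A r) →
    ‖R *ᵥ toReal (wordValue M t)‖ ≤ β ^ t.length * (K * r)

/-- Reading the word from its last letter is a pseudo-orbit starting at zero (Horner). Subtracting
the right multiples of `R Q` makes it a bounded two-sided pseudo-orbit, to which the dominant
relation applies. One term of this orbit is the contracting part, another the rescaled expanding
part. -/
theorem IsDominantRelation.isValueBound {M : Matrix A A ℤ} {β : ℝ} {R : Matrix A A ℝ}
    (hM : IsIrreduciblePisotUnimodular M β) (hP : IsSpectralProjection M β R) {g : List ℤ}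
    (hg : IsDominantRelation M g) {μ : ℕ} (hμ1 : 1 ≤ μ) (hμ : ∀ i, ∑ j, (M i j).natAbs ≤ μ) :
    IsValueBound M β R (orbitBound g μ) := by
  have hμ' : ∀ i, ∑ j, |realMatrix M i j| ≤ μ := by
    intro i
    have h1 : ∑ j, |realMatrix M i j| = ((∑ j, (M i j).natAbs : ℕ) : ℝ) := by
      push_cast
      simp
    rw [h1]
    exact_mod_cast hμ i
  have hβ := hM.one_lt
  have hβ0 : (0 : ℝ) < β := zero_lt_one.trans hβ
  suffices h : ∀ (r : ℕ) (t : List (A → ℤ)), (∀ a ∈ t, a ∈ box A r) →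
      ‖toReal (wordValue M t) - R *ᵥ toReal (wordValue M t)‖ ≤ orbitBound g μ * r ∧
      ‖R *ᵥ toReal (wordValue M t)‖ ≤ β ^ t.length * (orbitBound g μ * r) from
    ⟨fun r t ht => (h r t ht).1, fun r t ht => (h r t ht).2⟩
  intro r t ht
  set n := t.length with hn
  set f : ℕ → A → ℤ := fun k => t.reverse.getD k 0 with hf
  have hfbox : ∀ k, f k ∈ box A r := by
    intro k
    simp only [hf]
    by_cases hk : k < t.reverse.length
    · rw [List.getD_eq_getElem _ _ hk]
      exact ht _ (List.mem_reverse.1 (List.getElem_mem hk))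
    · rw [List.getD_eq_default _ _ (not_lt.1 hk)]
      exact zero_mem_box r
  set Y : ℕ → A → ℤ := fun k => wordValue M ((List.range k).map f).reverse with hY
  have hY0 : Y 0 = 0 := by simp [hY]
  have hYs : ∀ k, Y (k + 1) = M *ᵥ Y k + f k := by
    intro k
    simp only [hY, List.range_succ, List.map_append, List.reverse_append, List.map_cons,
      List.map_nil, List.reverse_singleton, List.singleton_append, wordValue_cons]
    exact add_comm _ _
  have hYn : Y n = wordValue M t := by
    simp only [hY]
    congr 1
    rw [List.reverse_eq_iff]
    refine List.ext_getElem (by simp [hn]) fun i h1 h2 => ?_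
    rw [List.getElem_map, List.getElem_range]
    exact List.getD_eq_getElem _ _ h2
  have hYi : ∀ i, Y (n + i) = (M ^ i) *ᵥ wordValue M t := by
    intro i
    induction i with
    | zero => simp [hYn]
    | succ i ih =>
      have : f (n + i) = 0 := List.getD_eq_default _ _ (by simp [hn])
      rw [← add_assoc, hYs, ih, this, add_zero, Matrix.mulVec_mulVec, pow_succ']
  set Q := wordValue M t with hQ
  set w := R *ᵥ toReal Q with hw
  have hMw : realMatrix M *ᵥ w = β • w := hP.mulVec_mulVec _
  -- For `j ≤ 0` the integer orbit is zero and the term is `-β ^ (j - n) w`, which is bounded. For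
  -- `j ≥ n` the term is `M ^ (j - n)` applied to the contracting part of `Q`. Thus `x n` is that
  -- contracting part, and `x 0 = -β ^ (-n) R Q`.
  set x : ℤ → A → ℝ := fun j => toReal (Y j.toNat) - β ^ (j - n) • w with hx
  set e : ℤ → A → ℝ := fun j => if j < 0 then 0 else toReal (f j.toNat) with he
  have hrec : ∀ j, x (j + 1) = realMatrix M *ᵥ x j + e j := by
    intro j
    have hz : β ^ (j + 1 - n) = β ^ (j - n) * β := by
      rw [← zpow_add_one₀ hβ0.ne']
      congr 1
      ring
    simp only [hx, he, Matrix.mulVec_sub, Matrix.mulVec_smul, hMw, hz, smul_smul]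
    rcases lt_or_ge j 0 with hj | hj
    · rw [if_pos hj, Int.toNat_of_nonpos hj.le, Int.toNat_of_nonpos (by omega), hY0]
      simp
    · lift j to ℕ using hj
      rw [if_neg (by omega), show ((j : ℤ) + 1).toNat = j + 1 by omega, Int.toNat_natCast, hYs,
        toReal_add, toReal_mulVec]
      abel
  have hebound : ∀ j, ‖e j‖ ≤ r := by
    intro j
    simp only [he]
    split_ifs
    · simp
    · exact norm_toReal_le (hfbox _)
  have hxn : ∀ i : ℕ, x (n + i) = (realMatrix M ^ i) *ᵥ (toReal Q - R *ᵥ toReal Q) := by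
    intro i
    simp only [hx]
    rw [show ((n : ℤ) + i).toNat = n + i by omega, hYi, Matrix.mulVec_sub, toReal_pow_mulVec,
      hP.pow_mulVec, add_sub_cancel_left, zpow_natCast]
  have hxbound : ∃ B, ∀ j, ‖x j‖ ≤ B := by
    obtain ⟨i₀, hi₀⟩ := eventually_atTop.1 (hP.eventually_norm_le hM zero_lt_one)
    refine ⟨∑ k ∈ Finset.range (n + 1), ‖toReal (Y k)‖ + ‖w‖ + ‖toReal Q‖ +
      ∑ i ∈ Finset.range i₀, ‖x (n + i)‖, fun j => ?_⟩
    have p1 : 0 ≤ ∑ k ∈ Finset.range (n + 1), ‖toReal (Y k)‖ :=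
      Finset.sum_nonneg fun _ _ => norm_nonneg _
    have p2 : 0 ≤ ∑ i ∈ Finset.range i₀, ‖x (n + i)‖ := Finset.sum_nonneg fun _ _ => norm_nonneg _
    have p3 := norm_nonneg w
    have p4 := norm_nonneg (toReal Q)
    rcases le_or_gt j n with hj | hj
    · have h1 : ‖toReal (Y j.toNat)‖ ≤ ∑ k ∈ Finset.range (n + 1), ‖toReal (Y k)‖ :=
        Finset.single_le_sum (f := fun k => ‖toReal (Y k)‖) (fun _ _ => norm_nonneg _)
          (Finset.mem_range.2 (by omega))
      have h2 : ‖β ^ (j - n) • w‖ ≤ ‖w‖ := by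
        rw [norm_smul, Real.norm_of_nonneg (by positivity)]
        exact mul_le_of_le_one_left (norm_nonneg _)
          (zpow_le_one_of_nonpos₀ hβ.le (by omega))
      have := norm_sub_le (toReal (Y j.toNat)) (β ^ (j - n) • w)
      simp only [hx]
      simp only [hx] at p2
      linarith
    · obtain ⟨i, rfl⟩ : ∃ i : ℕ, j = n + i := ⟨(j - n).toNat, by omega⟩
      rcases lt_or_ge i i₀ with hi | hi
      · have : ‖x (n + i)‖ ≤ ∑ i ∈ Finset.range i₀, ‖x (n + i)‖ :=
          Finset.single_le_sum (f := fun i : ℕ => ‖x (n + i)‖) (fun _ _ => norm_nonneg _)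
            (Finset.mem_range.2 hi)
        linarith
      · have h1 := hi₀ i hi (toReal Q)
        rw [← hxn, one_mul] at h1
        linarith
  obtain ⟨B, hB⟩ := hxbound
  have hmain := hg.norm_le hμ1 hμ' hrec hebound hB
  constructor
  · have := hmain (n + (0 : ℕ))
    rw [hxn, pow_zero, Matrix.one_mulVec] at this
    exact this
  · have := hmain 0
    simp only [hx, Int.toNat_zero, hY0, toReal_zero, zero_sub, norm_neg, norm_smul, _root_.zpow_neg,
      zpow_natCast, norm_inv, norm_pow, Real.norm_of_nonneg hβ0.le] at this
    rwa [inv_mul_le_iff₀ (by positivity)] at this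

/-- Vectors with small contracting part are values of words with small letters. -/
theorem exists_wordValue_eq {M : Matrix A A ℤ} {β : ℝ} {R : Matrix A A ℝ}
    (hM : IsIrreduciblePisotUnimodular M β) (hP : IsSpectralProjection M β R)
    {μ : ℕ} (hμ1 : 1 ≤ μ) (hμ : ∀ i, ∑ j, (M i j).natAbs ≤ μ) {z : A → ℤ}
    (hz : ‖toReal z - R *ᵥ toReal z‖ < 1 / 2) :
    ∃ w : List (A → ℤ), (∀ a ∈ w, a ∈ box A μ) ∧ wordValue M w = z := by
  have hμ' : ∀ i, ∑ j, |realMatrix M i j| ≤ μ := by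
    intro i
    have h1 : ∑ j, |realMatrix M i j| = ((∑ j, (M i j).natAbs : ℕ) : ℝ) := by
      push_cast
      simp
    rw [h1]
    exact_mod_cast hμ i
  have hβ := hM.one_lt
  have hβ0 : (0 : ℝ) < β := zero_lt_one.trans hβ
  set w := R *ᵥ toReal z with hw
  have hMw : realMatrix M *ᵥ w = β • w := hP.mulVec_mulVec _
  set y : ℕ → A → ℝ := fun j => (β⁻¹) ^ j • w with hy
  have hMy : ∀ j, realMatrix M *ᵥ y (j + 1) = y j := by
    intro j
    simp only [hy, Matrix.mulVec_smul, hMw, smul_smul, pow_succ]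
    rw [mul_assoc, inv_mul_cancel₀ hβ0.ne', mul_one]
  -- The orbit `β ^ (-j) w` on the eigenline is rounded to integer vectors. The digits `Z j - M Z (j
  -- + 1)` have norm at most `(1 + μ) / 2 ≤ μ`, and `Z j` vanishes for large `j`, so the expansion
  -- is finite.
  set Z : ℕ → A → ℤ := fun j i => round (y j i) with hZ
  have hZy : ∀ j, ‖toReal (Z j) - y j‖ ≤ 1 / 2 := by
    intro j
    refine (pi_norm_le_iff_of_nonneg (by norm_num)).2 fun i => ?_
    rw [Pi.sub_apply, toReal_apply, Real.norm_eq_abs, abs_sub_comm]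
    exact abs_sub_round _
  -- This is where the strict bound `1 / 2` is needed: rounding `R z` recovers `z`.
  have hZ0 : Z 0 = z := by
    ext i
    simp only [hZ, hy, pow_zero, one_smul]
    have h1 := (norm_le_pi_norm (toReal z - w) i).trans_lt hz
    rw [Pi.sub_apply, toReal_apply, Real.norm_eq_abs, abs_lt] at h1
    rw [round_eq, Int.floor_eq_iff]
    constructor <;> linarith
  have hbox : ∀ j, Z j - M *ᵥ Z (j + 1) ∈ box A μ := by
    intro j
    apply mem_box_of_norm_le
    have e1 : toReal (Z j - M *ᵥ Z (j + 1)) =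
        (toReal (Z j) - y j) - realMatrix M *ᵥ (toReal (Z (j + 1)) - y (j + 1)) := by
      rw [Matrix.mulVec_sub, hMy, toReal_sub, toReal_mulVec]
      abel
    rw [e1]
    have h1 := norm_mulVec_le (Nat.cast_nonneg μ) hμ' (toReal (Z (j + 1)) - y (j + 1))
    have h2 : (μ : ℝ) * ‖toReal (Z (j + 1)) - y (j + 1)‖ ≤ μ * (1 / 2) :=
      mul_le_mul_of_nonneg_left (hZy _) (Nat.cast_nonneg μ)
    have h3 : (1 : ℝ) ≤ μ := by exact_mod_cast hμ1
    have h4 := norm_sub_le (toReal (Z j) - y j)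
      (realMatrix M *ᵥ (toReal (Z (j + 1)) - y (j + 1)))
    have h5 := hZy j
    linarith
  have hlim : ∃ n, Z n = 0 := by
    have h1 : Tendsto (fun n : ℕ => (β⁻¹) ^ n * ‖w‖) atTop (𝓝 (0 * ‖w‖)) :=
      (tendsto_pow_atTop_nhds_zero_of_lt_one (by positivity)
        (inv_lt_one_of_one_lt₀ hβ)).mul_const _
    rw [zero_mul] at h1
    obtain ⟨n, hn⟩ := (h1.eventually (gt_mem_nhds (show (0 : ℝ) < 1 / 2 by norm_num))).exists
    refine ⟨n, ?_⟩
    ext i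
    have h2 := norm_le_pi_norm (y n) i
    rw [hy] at h2
    simp only at h2
    rw [norm_smul, norm_pow, norm_inv, Real.norm_of_nonneg hβ0.le] at h2
    have h3 := h2.trans_lt hn
    rw [Real.norm_eq_abs, abs_lt] at h3
    simp only [hZ, hy, Pi.zero_apply]
    rw [round_eq, Int.floor_eq_iff]
    push_cast
    constructor <;> linarith
  obtain ⟨n, hn⟩ := hlim
  have hword : ∀ n j, Z (j + n) = 0 → ∃ w : List (A → ℤ), (∀ a ∈ w, a ∈ box A μ) ∧
      wordValue M w = Z j := by
    intro n
    induction n with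
    | zero => exact fun j hj => ⟨[], by simp, by simpa using hj.symm⟩
    | succ n ih =>
      intro j hj
      obtain ⟨w, h1, h2⟩ := ih (j + 1) (by rw [← hj]; congr 1; ring)
      refine ⟨(Z j - M *ᵥ Z (j + 1)) :: w, ?_, by simp [h2]⟩
      intro a ha
      rcases List.mem_cons.1 ha with rfl | ha
      · exact hbox j
      · exact h1 a ha
  obtain ⟨u, h1, h2⟩ := hword n 0 (by simpa using hn)
  exact ⟨u, h1, h2.trans hZ0⟩

end Bounds

/-! ### Finite colourings for nonnegative values and for equality of values -/

section Languages

open Filter Topology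

variable {A : Type*} [Fintype A] [DecidableEq A]

/-- The words with letters in a box whose value has nonnegative coordinates. -/
def nonnegWords (M : Matrix A A ℤ) (r : ℕ) : Language (A → ℤ) :=
  {t | (∀ a ∈ t, a ∈ box A r) ∧ ∀ i, 0 ≤ wordValue M t i}

/-- The words with letters in a box whose value is the value of a word of `L` that is not
longer. -/
def valueWords (M : Matrix A A ℤ) (r : ℕ) (L : Language (A → ℤ)) : Language (A → ℤ) :=
  {t | (∀ a ∈ t, a ∈ box A r) ∧ ∃ v ∈ L, v.length ≤ t.length ∧ wordValue M v = wordValue M t}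

/-- Padding `t` with zeros does not change its value and lifts the length restriction, which is
there to make the search for `v` finite. -/
theorem mem_padClosure_valueWords {M : Matrix A A ℤ} {r : ℕ} {L : Language (A → ℤ)}
    {t : List (A → ℤ)} :
    t ∈ padClosure 0 (valueWords M r L) ↔
      (∀ a ∈ t, a ∈ box A r) ∧ wordValue M t ∈ languageValue M L := by
  constructor
  · rintro ⟨k, h1, v, hv, _, h2⟩
    refine ⟨fun a ha => h1 a (List.mem_append_left _ ha), v, hv, ?_⟩
    rw [h2, wordValue_append, wordValue_replicate_zero, Matrix.mulVec_zero, add_zero]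
  · rintro ⟨h1, v, hv, h2⟩
    refine ⟨v.length, fun a ha => ?_, v, hv, by simp, ?_⟩
    · rcases List.mem_append.1 ha with ha | ha
      · exact h1 a ha
      · rw [List.eq_of_mem_replicate ha]
        exact zero_mem_box r
    · rw [h2, wordValue_append, wordValue_replicate_zero, Matrix.mulVec_zero, add_zero]

/-- The finite set `T` contains the value of each word, up to the words that have a suffix whose
value has all its coordinates larger than `b`. -/
structure IsTrap (M : Matrix A A ℤ) (r b : ℕ) (T : Finset (A → ℤ)) : Prop where
  zero_mem : 0 ∈ T
  step : ∀ h ∈ T, ∀ x ∈ box A r, x + M *ᵥ h ∈ T ∨ ∀ i, b < ((x + M *ᵥ h) i).natAbs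

theorem IsTrap.mem_or_exists_suffix {M : Matrix A A ℤ} {r b : ℕ} {T : Finset (A → ℤ)}
    (hT : IsTrap M r b T) {w : List (A → ℤ)} (hw : ∀ a ∈ w, a ∈ box A r) :
    wordValue M w ∈ T ∨
      ∃ w₁ w₂, w = w₁ ++ w₂ ∧ ∀ i, b < (wordValue M w₂ i).natAbs := by
  induction w with
  | nil => exact Or.inl (by simpa using hT.zero_mem)
  | cons x w ih =>
    rcases ih fun a ha => hw a (List.mem_cons_of_mem x ha) with h | ⟨w₁, w₂, rfl, h⟩
    · rcases hT.step _ h x (hw x List.mem_cons_self) with h' | h'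
      · exact Or.inl (by simpa using h')
      · exact Or.inr ⟨[], x :: w, rfl, by simpa using h'⟩
    · exact Or.inr ⟨x :: w₁, w₂, rfl, h⟩

/-- With `k = K r` and `b = β ^ |s|`, the coordinate of the long value is within `k` of `η + b y`,
where `|η| ≤ b k`. The hypothesis gives `|y| > 3 k - k = 2 k`, with the sign of the value of `t`,
and `2 b k - b k - k ≥ 0`. -/
theorem IsValueBound.nonneg_append_iff {M : Matrix A A ℤ} {β : ℝ} {R : Matrix A A ℝ} {K : ℕ}
    (hK : IsValueBound M β R K) (hβ : 1 < β) (hP : IsSpectralProjection M β R) {r : ℕ}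
    {s t : List (A → ℤ)} (hs : ∀ a ∈ s, a ∈ box A r) (ht : ∀ a ∈ t, a ∈ box A r) {i : A}
    (hi : 3 * K * r < (wordValue M t i).natAbs) :
    0 ≤ wordValue M (s ++ t) i ↔ 0 ≤ wordValue M t i := by
  have hst : ∀ a ∈ s ++ t, a ∈ box A r := fun a ha =>
    (List.mem_append.1 ha).elim (hs a) (ht a)
  have c1 := (norm_le_pi_norm _ i).trans (hK.contracting r _ hst)
  have c2 := (norm_le_pi_norm _ i).trans (hK.contracting r _ ht)
  have c3 := (norm_le_pi_norm _ i).trans (hK.expanding r _ hs)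
  set k : ℝ := K * r with hk
  set b := β ^ s.length with hb
  have hb1 : 1 ≤ b := one_le_pow₀ hβ.le
  have hk0 : 0 ≤ k := by positivity
  have e1 : (R *ᵥ toReal (wordValue M (s ++ t))) i =
      (R *ᵥ toReal (wordValue M s)) i + b * (R *ᵥ toReal (wordValue M t)) i := by
    rw [wordValue_append, toReal_add, Matrix.mulVec_add, toReal_pow_mulVec, hP.mulVec_pow]
    rfl
  rw [Pi.sub_apply, toReal_apply, Real.norm_eq_abs, abs_le] at c1 c2
  rw [Real.norm_eq_abs, abs_le] at c3
  rw [e1] at c1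
  have hi' : 3 * k < |(wordValue M t i : ℝ)| := by
    rw [← Int.cast_abs, Int.abs_eq_natAbs, hk, ← mul_assoc]
    exact_mod_cast hi
  set y := (R *ᵥ toReal (wordValue M t)) i
  set η := (R *ᵥ toReal (wordValue M s)) i
  constructor
  · intro h
    by_contra hneg
    have hneg' : (wordValue M t i : ℝ) < 0 := by exact_mod_cast not_le.1 hneg
    rw [abs_of_neg hneg'] at hi'
    have h0 : (0 : ℝ) ≤ wordValue M (s ++ t) i := by exact_mod_cast h
    have : b * y < b * (-(2 * k)) := by
      apply mul_lt_mul_of_pos_left _ (by linarith)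
      linarith
    nlinarith
  · intro h
    have h0 : (0 : ℝ) ≤ wordValue M t i := by exact_mod_cast h
    rw [abs_of_nonneg h0] at hi'
    have : b * (2 * k) < b * y := by
      apply mul_lt_mul_of_pos_left _ (by linarith)
      linarith
    have : (0 : ℝ) ≤ wordValue M (s ++ t) i := by nlinarith
    exact_mod_cast this

open Classical in
/-- The colour of the word `s` for the language of the words with nonnegative value. -/
noncomputable def nonnegColor (M : Matrix A A ℤ) (r : ℕ) (T : Finset (A → ℤ))
    (s : List (A → ℤ)) : Option (Set T) :=
  if ∀ a ∈ s, a ∈ box A r then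
    some {h | ∀ i, 0 ≤ (wordValue M s + (M ^ s.length) *ᵥ (h : A → ℤ)) i}
  else none

/-- If the value of the continuation `w` lies in `T`, the colour records the answer. Otherwise a
suffix of `w` has all coordinates so large that it fixes the signs whatever precedes it. -/
theorem colors_nonnegColor {M : Matrix A A ℤ} {β : ℝ} {R : Matrix A A ℝ} {K : ℕ}
    (hK : IsValueBound M β R K) (hβ : 1 < β) (hP : IsSpectralProjection M β R) {r : ℕ}
    {T : Finset (A → ℤ)} (hT : IsTrap M r (3 * K * r) T) :
    Colors (nonnegColor M r T) (nonnegWords M r) := by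
  intro u v huv w
  by_cases hw : ∀ a ∈ w, a ∈ box A r
  swap
  · refine iff_of_false (fun h => hw ?_) (fun h => hw ?_)
    · exact fun a ha => h.1 a (List.mem_append_right _ ha)
    · exact fun a ha => h.1 a (List.mem_append_right _ ha)
  have happ : ∀ s : List (A → ℤ), s ++ w ∈ nonnegWords M r ↔
      (∀ a ∈ s, a ∈ box A r) ∧ ∀ i, 0 ≤ wordValue M (s ++ w) i := by
    intro s
    refine and_congr_left fun _ => ⟨fun h a ha => h a (List.mem_append_left _ ha), fun h a ha => ?_⟩
    exact (List.mem_append.1 ha).elim (h a) (hw a)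
  rw [happ, happ]
  unfold nonnegColor at huv
  split_ifs at huv with hu hv hv
  · refine and_congr (iff_of_true hu hv) ?_
    rcases hT.mem_or_exists_suffix hw with h | ⟨w₁, w₂, rfl, h⟩
    · have := Set.ext_iff.1 (Option.some_injective _ huv) ⟨_, h⟩
      rw [wordValue_append, wordValue_append]
      exact this
    · refine forall_congr' fun i => ?_
      have hw₁ : ∀ a ∈ w₁, a ∈ box A r := fun a ha => hw a (List.mem_append_left _ ha)
      have hw₂ : ∀ a ∈ w₂, a ∈ box A r := fun a ha => hw a (List.mem_append_right _ ha)
      rw [← List.append_assoc, ← List.append_assoc,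
        hK.nonneg_append_iff hβ hP (fun a ha => (List.mem_append.1 ha).elim (hu a) (hw₁ a)) hw₂
          (h i),
        hK.nonneg_append_iff hβ hP (fun a ha => (List.mem_append.1 ha).elim (hv a) (hw₁ a)) hw₂
          (h i)]
  · exact iff_of_false (fun h => hu h.1) (fun h => hv h.1)

/-- The trap is the set of values having at least one coordinate of absolute value at most `b`. It
is finite: that coordinate of `R Q` is bounded as well, and any one coordinate controls the norm of
an eigenvector for `β`, as it vanishes only at zero. -/
theorem IsValueBound.exists_isTrap {M : Matrix A A ℤ} {β : ℝ} {R : Matrix A A ℝ} {K : ℕ}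
    (hK : IsValueBound M β R K) (hM : IsIrreduciblePisotUnimodular M β)
    (hP : IsSpectralProjection M β R) (r b : ℕ) : ∃ T, IsTrap M r b T := by
  obtain ⟨i₀⟩ := hM.nonempty
  have hanti : ∀ i : A, ∃ c : NNReal, ∀ w : A → ℝ, realMatrix M *ᵥ w = β • w → ‖w‖ ≤ c * |w i| := by
    intro i
    let f : realEigenspace M β →ₗ[ℝ] ℝ := (LinearMap.proj i).comp (realEigenspace M β).subtype
    have hf : LinearMap.ker f = ⊥ := by
      rw [LinearMap.ker_eq_bot']
      rintro ⟨w, hw⟩ h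
      have hw' : realMatrix M *ᵥ w = β • w := by
        simpa [realEigenspace, Module.End.mem_eigenspace_iff] using hw
      exact Subtype.ext (hM.eq_zero_of_apply_eq_zero hw' h)
    obtain ⟨c, _, hc⟩ := f.exists_antilipschitzWith hf
    refine ⟨c, fun w hw => ?_⟩
    have hw' : w ∈ realEigenspace M β := by
      simpa [realEigenspace, Module.End.mem_eigenspace_iff] using hw
    have := hc.le_mul_norm_sub (⟨w, hw'⟩ : realEigenspace M β) 0
    simpa [f] using this
  choose c hc using hanti
  set S : Set (A → ℤ) := {h | ∃ t : List (A → ℤ), (∀ a ∈ t, a ∈ box A r) ∧ wordValue M t = h ∧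
    ∃ i, (h i).natAbs ≤ b} with hS
  have hfin : S.Finite := by
    obtain ⟨C, hC⟩ : ∃ C : ℕ, ∀ i, (K * r : ℝ) + c i * (b + K * r) ≤ C := by
      obtain ⟨C, hC⟩ := exists_nat_ge (∑ i, ((K * r : ℝ) + c i * (b + K * r)))
      refine ⟨C, fun i => le_trans ?_ hC⟩
      exact Finset.single_le_sum (f := fun i => ((K * r : ℝ) + c i * (b + K * r)))
        (fun _ _ => by positivity) (Finset.mem_univ i)
    refine (finite_box (A := A) C).subset ?_
    rintro _ ⟨t, ht, rfl, i, hi⟩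
    apply mem_box_of_norm_le
    refine le_trans ?_ (hC i)
    have h1 := hK.contracting r t ht
    have h2 := (norm_le_pi_norm _ i).trans h1
    have h3 := hc i _ (hP.mulVec_mulVec (toReal (wordValue M t)))
    have h4 : |(wordValue M t i : ℝ)| ≤ b := by
      rw [← Int.cast_abs, Int.abs_eq_natAbs]
      exact_mod_cast hi
    rw [Pi.sub_apply, toReal_apply, Real.norm_eq_abs] at h2
    have h5 : |(R *ᵥ toReal (wordValue M t)) i| ≤ b + K * r := by
      rw [abs_le] at h2 h4 ⊢
      constructor <;> linarith
    have h6 : (c i : ℝ) * |(R *ᵥ toReal (wordValue M t)) i| ≤ c i * (b + K * r) :=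
      mul_le_mul_of_nonneg_left h5 (c i).2
    have h7 := norm_add_le (toReal (wordValue M t) - R *ᵥ toReal (wordValue M t))
      (R *ᵥ toReal (wordValue M t))
    rw [sub_add_cancel] at h7
    linarith
  refine ⟨hfin.toFinset, ?_, ?_⟩
  · rw [Set.Finite.mem_toFinset]
    exact ⟨[], by simp, by simp, i₀, by simp⟩
  · intro h hh x hx
    rw [Set.Finite.mem_toFinset] at hh ⊢
    obtain ⟨t, ht, rfl, _⟩ := hh
    by_cases hbig : ∃ i, ((x + M *ᵥ wordValue M t) i).natAbs ≤ b
    · refine Or.inl ⟨x :: t, ?_, by simp, hbig⟩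
      intro a ha
      rcases List.mem_cons.1 ha with rfl | ha
      · exact hx
      · exact ht a ha
    · push Not at hbig
      exact Or.inr hbig

/-- The integer vectors with coordinates of absolute value at most `r`, as a finite set. -/
noncomputable def boxFinset (A : Type*) [Fintype A] [DecidableEq A] (r : ℕ) : Finset (A → ℤ) :=
  Fintype.piFinset fun _ => Finset.Icc (-(r : ℤ)) r

theorem mem_boxFinset {r : ℕ} {x : A → ℤ} : x ∈ boxFinset A r ↔ x ∈ box A r := by
  simp only [boxFinset, Fintype.mem_piFinset, Finset.mem_Icc]
  exact forall_congr' fun i => by omega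

theorem card_boxFinset (r : ℕ) : (boxFinset A r).card = (2 * r + 1) ^ Fintype.card A := by
  simp only [boxFinset, Fintype.card_piFinset, Int.card_Icc, Finset.prod_const, Finset.card_univ]
  congr 1
  omega

open Classical in
/-- The colour of the word `s` for the language of the words whose value is the value of a word of
`L` that is not longer. -/
noncomputable def valueColor {C : Type*} (κ : List (A → ℤ) → C) (M : Matrix A A ℤ) (r b : ℕ)
    (L : Language (A → ℤ)) (s : List (A → ℤ)) :
    Option (Set (C × boxFinset A b) × Set (boxFinset A b)) :=
  if ∀ a ∈ s, a ∈ box A r then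
    some ⟨{q | ∃ v : List (A → ℤ), v.length = s.length ∧ (∀ a ∈ v, a ∈ box A r) ∧ κ v = q.1 ∧
        wordValue M v = wordValue M s + (M ^ s.length) *ᵥ (q.2 : A → ℤ)},
      {e | ∃ v ∈ L, v.length ≤ s.length ∧
        wordValue M v = wordValue M s + (M ^ s.length) *ᵥ (e : A → ℤ)}⟩
  else none

/-- The contracting part of the carry is at most `2 K r`. Its expanding part, multiplied by `β ^
|s|`, is the difference of those of `v` and `s`, which are at most `β ^ |s| K r` each because `v` is
not longer than `s`. -/
theorem IsValueBound.mem_box {M : Matrix A A ℤ} {β : ℝ} {R : Matrix A A ℝ} {K : ℕ}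
    (hK : IsValueBound M β R K) (hβ : 1 < β) (hP : IsSpectralProjection M β R) {r : ℕ}
    {s v t x : List (A → ℤ)} (hs : ∀ a ∈ s, a ∈ box A r) (hv : ∀ a ∈ v, a ∈ box A r)
    (ht : ∀ a ∈ t, a ∈ box A r) (hx : ∀ a ∈ x, a ∈ box A r) (hlen : v.length ≤ s.length)
    (h : wordValue M v = wordValue M s + (M ^ s.length) *ᵥ (wordValue M t - wordValue M x)) :
    wordValue M t - wordValue M x ∈ box A (4 * K * r) := by
  apply mem_box_of_norm_le
  set e := wordValue M t - wordValue M x with he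
  set k : ℝ := K * r with hk
  have hk0 : 0 ≤ k := by positivity
  have h1 : ‖toReal e - R *ᵥ toReal e‖ ≤ 2 * k := by
    have : toReal e - R *ᵥ toReal e =
        (toReal (wordValue M t) - R *ᵥ toReal (wordValue M t)) -
        (toReal (wordValue M x) - R *ᵥ toReal (wordValue M x)) := by
      rw [he, toReal_sub, Matrix.mulVec_sub]
      abel
    rw [this, two_mul]
    exact (norm_sub_le _ _).trans (add_le_add (hK.contracting r t ht) (hK.contracting r x hx))
  have hb : 0 < β ^ s.length := pow_pos (by linarith) _
  have h2 : ‖R *ᵥ toReal e‖ ≤ 2 * k := by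
    have e1 : β ^ s.length • (R *ᵥ toReal e) =
        R *ᵥ toReal (wordValue M v) - R *ᵥ toReal (wordValue M s) := by
      rw [h, toReal_add, Matrix.mulVec_add, toReal_pow_mulVec, hP.mulVec_pow, add_sub_cancel_left]
    have e2 := (norm_sub_le _ _).trans (add_le_add (hK.expanding r v hv) (hK.expanding r s hs))
    rw [← e1, norm_smul, Real.norm_of_nonneg hb.le] at e2
    have e3 : β ^ v.length * k ≤ β ^ s.length * k :=
      mul_le_mul_of_nonneg_right (pow_le_pow_right₀ hβ.le hlen) hk0
    refine le_of_mul_le_mul_left ?_ hb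
    linarith
  have h3 := norm_add_le (toReal e - R *ᵥ toReal e) (R *ᵥ toReal e)
  rw [sub_add_cancel] at h3
  push_cast
  rw [mul_assoc, ← hk]
  linarith

/-- Let `x ∈ L` have the value of `u ++ w`. If `x` is longer than `u`, it is cut at length `|u|`;
the tails then differ by a carry in the box, and the first component of the colour allows the head
of `x` to be replaced by one for `v` with the same `κ`. If `x` is not longer than `u`, the value of
`w` is itself the carry, and the second component supplies the replacement. -/
theorem colors_valueColor {C : Type*} {κ : List (A → ℤ) → C} {M : Matrix A A ℤ} {β : ℝ}
    {R : Matrix A A ℝ} {K : ℕ} (hK : IsValueBound M β R K) (hβ : 1 < β)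
    (hP : IsSpectralProjection M β R) {r : ℕ} {L : Language (A → ℤ)} (hκ : Colors κ L)
    (hL : ∀ u ∈ L, ∀ a ∈ u, a ∈ box A r) :
    Colors (valueColor κ M r (4 * K * r) L) (valueWords M r L) := by
  suffices H : ∀ u v, valueColor κ M r (4 * K * r) L u = valueColor κ M r (4 * K * r) L v →
      ∀ w, u ++ w ∈ valueWords M r L → v ++ w ∈ valueWords M r L from
    fun u v huv w => ⟨H u v huv w, H v u huv.symm w⟩
  rintro u v huv w ⟨huw, x, hx, hlen, hxw⟩
  have hu : ∀ a ∈ u, a ∈ box A r := fun a ha => huw a (List.mem_append_left _ ha)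
  have hw : ∀ a ∈ w, a ∈ box A r := fun a ha => huw a (List.mem_append_right _ ha)
  unfold valueColor at huv
  rw [if_pos hu] at huv
  split_ifs at huv with hv
  obtain ⟨h1, h2⟩ := Prod.ext_iff.1 (Option.some_injective _ huv)
  refine ⟨fun a ha => (List.mem_append.1 ha).elim (hv a) (hw a), ?_⟩
  rw [wordValue_append] at hxw
  rcases le_total x.length u.length with hxu | hxu
  · have hmem : wordValue M w ∈ boxFinset A (4 * K * r) := by
      have := hK.mem_box hβ hP hu (hL x hx) hw (x := []) (by simp) hxu (by simpa using hxw)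
      rw [mem_boxFinset]
      simpa using this
    obtain ⟨y, hy, hyl, hyw⟩ := (Set.ext_iff.1 h2 ⟨_, hmem⟩).1 ⟨x, hx, hxu, hxw⟩
    refine ⟨y, hy, by rw [List.length_append]; omega, ?_⟩
    rw [hyw, wordValue_append]
  · obtain ⟨x₁, x₂, rfl, hx₁⟩ : ∃ x₁ x₂, x = x₁ ++ x₂ ∧ x₁.length = u.length :=
      ⟨x.take u.length, x.drop u.length, (List.take_append_drop _ _).symm, by simpa using hxu⟩
    have hxb₁ : ∀ a ∈ x₁, a ∈ box A r := fun a ha => hL _ hx a (List.mem_append_left _ ha)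
    have hxb₂ : ∀ a ∈ x₂, a ∈ box A r := fun a ha => hL _ hx a (List.mem_append_right _ ha)
    have heq : wordValue M x₁ =
        wordValue M u + (M ^ u.length) *ᵥ (wordValue M w - wordValue M x₂) := by
      rw [wordValue_append, hx₁] at hxw
      rw [Matrix.mulVec_sub, add_sub, ← hxw, add_sub_cancel_right]
    have hmem : wordValue M w - wordValue M x₂ ∈ boxFinset A (4 * K * r) :=
      mem_boxFinset.2 (hK.mem_box hβ hP hu hxb₁ hw hxb₂ hx₁.le heq)
    obtain ⟨y, hyl, _, hκy, hy⟩ :=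
      (Set.ext_iff.1 h1 (κ x₁, ⟨_, hmem⟩)).1 ⟨x₁, hx₁, hxb₁, rfl, heq⟩
    refine ⟨y ++ x₂, (hκ _ _ hκy x₂).2 hx, ?_, ?_⟩
    · rw [List.length_append] at hlen ⊢
      rw [List.length_append] at hlen ⊢
      omega
    · rw [wordValue_append, hyl, hy, wordValue_append, Matrix.mulVec_sub]
      abel

end Languages

/-! ### The interior language through words, and its regularity -/

section Interior

open Filter Topology

variable {A : Type*} [Fintype A] [DecidableEq A]

theorem mem_realEigenspace {M : Matrix A A ℤ} {β : ℝ} {w : A → ℝ} :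
    w ∈ realEigenspace M β ↔ realMatrix M *ᵥ w = β • w := by
  simp [realEigenspace]

omit [Fintype A] [DecidableEq A] in
theorem mem_discreteInterior_iff {P : Submodule ℝ (A → ℝ)} {π : (A → ℝ) →ₗ[ℝ] P}
    {S : Set (A → ℤ)} {x : A → ℤ} :
    x ∈ discreteInterior π S ↔ (∀ i, 0 ≤ x i) ∧ ∃ U : Set P, IsOpen U ∧ π (toReal x) ∈ U ∧
      ∀ y : A → ℤ, (∀ i, 0 ≤ y i) → π (toReal y) ∈ U → y ∈ S := by
  constructor
  · rintro ⟨V, ⟨⟨U, hU, rfl⟩, hV⟩, hx⟩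
    exact ⟨hx.1, U, hU, hx.2, fun y hy hyU => hV ⟨hy, hyU⟩⟩
  · rintro ⟨hx, U, hU, hxU, h⟩
    exact ⟨_, ⟨⟨U, hU, rfl⟩, fun y hy => h y hy.1 hy.2⟩, hx, hxU⟩

omit [Fintype A] [DecidableEq A] in
theorem discreteInterior_subset {P : Submodule ℝ (A → ℝ)} (π : (A → ℝ) →ₗ[ℝ] P)
    (S : Set (A → ℤ)) : discreteInterior π S ⊆ S :=
  Set.sUnion_subset fun _ hV => hV.2

theorem languageValue_interiorLanguage (M : Matrix A A ℤ) {P : Submodule ℝ (A → ℝ)}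
    (π : (A → ℝ) →ₗ[ℝ] P) (L : Language (A → ℤ)) :
    languageValue M (interiorLanguage M π L) = discreteInterior π (languageValue M L) := by
  ext x
  constructor
  · rintro ⟨u, hu, rfl⟩
    exact hu.2
  · intro hx
    obtain ⟨u, hu, rfl⟩ := discreteInterior_subset _ _ hx
    exact ⟨u, ⟨hu, hx⟩, rfl⟩

/-- One direction uses that `M ^ k` contracts modulo the eigenspace. The other uses that `M ^ k` is
invertible over `ℤ`, so that every nearby integer point is reached by some `u 0^m w`. -/
theorem interiorLanguage_eq_stableInterior {M : Matrix A A ℤ} {β : ℝ} {R : Matrix A A ℝ} {K : ℕ}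
    (hM : IsIrreduciblePisotUnimodular M β) (hP : IsSpectralProjection M β R)
    (hK : IsValueBound M β R K) {P : Submodule ℝ (A → ℝ)}
    (hPE : IsCompl P (realEigenspace M β)) {μ r : ℕ} (hμ1 : 1 ≤ μ)
    (hμ : ∀ i, ∑ j, (M i j).natAbs ≤ μ) (hr : μ ≤ r) {L : Language (A → ℤ)}
    (hL : ∀ u ∈ L, ∀ a ∈ u, a ∈ box A r) :
    interiorLanguage M (P.projectionOnto (realEigenspace M β) hPE) L =
      stableInterior (box A r) 0 L (nonnegWords M r) (padClosure 0 (valueWords M r L)) := by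
  set π := P.projectionOnto (realEigenspace M β) hPE with hπ
  have hπeq : ∀ x y : A → ℝ, x - y ∈ realEigenspace M β → π x = π y := by
    intro x y h
    rw [← sub_eq_zero, ← map_sub]
    exact (Submodule.projectionOnto_apply_eq_zero_iff hPE).2 h
  have hRR : ∀ x, R *ᵥ (R *ᵥ x) = R *ᵥ x := by
    intro x
    rw [Matrix.mulVec_mulVec, hP.isIdempotent]
  have hvalue : ∀ (u : List (A → ℤ)) (m : ℕ) (w : List (A → ℤ)),
      wordValue M (u ++ List.replicate m 0 ++ w) =
        wordValue M u + (M ^ (u.length + m)) *ᵥ wordValue M w := by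
    intro u m w
    simp [wordValue_append, pow_add]
  have hletters : ∀ (u : List (A → ℤ)) (m : ℕ) (w : List (A → ℤ)), (∀ a ∈ u, a ∈ box A r) →
      (∀ a ∈ w, a ∈ box A r) → ∀ a ∈ u ++ List.replicate m 0 ++ w, a ∈ box A r := by
    intro u m w hu hw a ha
    rcases List.mem_append.1 ha with ha | ha
    · rcases List.mem_append.1 ha with ha | ha
      · exact hu a ha
      · rw [List.eq_of_mem_replicate ha]
        exact zero_mem_box r
    · exact hw a ha
  ext u
  refine and_congr_right fun huL => ?_
  have hu := hL u huL
  rw [mem_discreteInterior_iff]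
  refine and_congr ⟨fun h => ⟨hu, h⟩, fun h => h.2⟩ ?_
  constructor
  · rintro ⟨U, hU, hxU, hUS⟩
    have hcont : Continuous π := π.continuous_of_finiteDimensional
    obtain ⟨ε, hε, hball⟩ := Metric.isOpen_iff.1 (hU.preimage hcont) _ hxU
    set c : ℝ := K * r + 1 with hc
    have hc0 : 0 < c := by positivity
    -- The contracting part of every `Q_w` has norm less than `c`, so the contraction factor `ε / c`
    -- brings it within `ε`, uniformly in `w`. The `+ 1` in `c` keeps it positive.
    obtain ⟨k₀, hk₀⟩ := eventually_atTop.1 (hP.eventually_norm_le hM (div_pos hε hc0))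
    refine ⟨k₀, fun w hw hw₁ => mem_padClosure_valueWords.2 ⟨hw₁.1, ?_⟩⟩
    refine hUS _ hw₁.2 ?_
    rw [hvalue]
    set y := toReal (wordValue M w) with hy
    set k := u.length + k₀ with hk
    have e1 : π (toReal (wordValue M u + (M ^ k) *ᵥ wordValue M w)) =
        π (toReal (wordValue M u) + (realMatrix M ^ k) *ᵥ (y - R *ᵥ y)) := by
      apply hπeq
      rw [toReal_add, toReal_pow_mulVec, add_sub_add_left_eq_sub, Matrix.mulVec_sub,
        sub_sub_cancel, hP.pow_mulVec, mem_realEigenspace, Matrix.mulVec_smul, hP.mulVec_mulVec,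
        smul_comm]
    rw [e1]
    apply hball
    rw [mem_ball_iff_norm, add_sub_cancel_left]
    have h1 := hk₀ k (Nat.le_add_left _ _) (y - R *ᵥ y)
    rw [Matrix.mulVec_sub R, hRR, sub_self, sub_zero] at h1
    refine h1.trans_lt ?_
    have h2 : ‖y - R *ᵥ y‖ < c := (hK.contracting r w hw).trans_lt (lt_add_one _)
    calc ε / c * ‖y - R *ᵥ y‖ < ε / c * c := mul_lt_mul_of_pos_left h2 (div_pos hε hc0)
      _ = ε := div_mul_cancel₀ _ hc0.ne'
  · rintro ⟨m, hm⟩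
    set k := u.length + m with hk
    have hdet : IsUnit M.det := by
      rw [Int.isUnit_iff]
      exact hM.det_eq
    have hdetk : IsUnit (M ^ k).det := by
      rw [Matrix.det_pow]
      exact hdet.pow k
    set I := (M ^ k)⁻¹ with hI
    have hIM : I * M ^ k = 1 := Matrix.nonsing_inv_mul _ hdetk
    have hMI : M ^ k * I = 1 := Matrix.mul_nonsing_inv _ hdetk
    have hIMr : ∀ x, realMatrix I *ᵥ ((realMatrix M ^ k) *ᵥ x) = x := by
      intro x
      rw [Matrix.mulVec_mulVec, ← realMatrix_pow]
      have : realMatrix I * realMatrix (M ^ k) = realMatrix (I * M ^ k) :=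
        (Matrix.map_mul (f := Int.castRingHom ℝ)).symm
      rw [this, hIM, realMatrix, Matrix.map_one _ Int.cast_zero Int.cast_one, Matrix.one_mulVec]
    -- The map `M ^ (-k) (1 - R)` vanishes on the eigenspace, hence factors through `π`; its
    -- smallness is an open condition on `P`. It sends `y - Q_u` to the contracting part of `z = M ^
    -- (-k) (y - Q_u)`.
    set N : (A → ℝ) →ₗ[ℝ] (A → ℝ) := (realMatrix I * (1 - R)).mulVecLin with hN
    have hNapply : ∀ x, N x = realMatrix I *ᵥ (x - R *ᵥ x) := by
      intro x
      rw [hN, Matrix.mulVecLin_apply, ← Matrix.mulVec_mulVec, Matrix.sub_mulVec,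
        Matrix.one_mulVec]
    have hNE : ∀ x ∈ realEigenspace M β, N x = 0 := by
      intro x hx
      rw [hNapply, hP.fix x (mem_realEigenspace.1 hx), sub_self, Matrix.mulVec_zero]
    have hNπ : ∀ x, N (π x) = N x := by
      intro x
      rw [← sub_eq_zero, ← map_sub]
      apply hNE
      rw [← Submodule.projectionOnto_apply_eq_zero_iff hPE, map_sub]
      change π (π x) - π x = 0
      rw [hπ, Submodule.projectionOnto_apply_left, sub_self]
    refine ⟨{p | ‖N (p : A → ℝ) - N (toReal (wordValue M u))‖ < 1 / 2}, ?_, ?_, ?_⟩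
    · have : Continuous N := N.continuous_of_finiteDimensional
      exact isOpen_lt (by fun_prop) continuous_const
    · change ‖_‖ < _
      rw [hNπ, sub_self, norm_zero]
      norm_num
    · intro y hy hyU
      change ‖_‖ < _ at hyU
      rw [hNπ, ← map_sub, ← toReal_sub] at hyU
      set z := I *ᵥ (y - wordValue M u) with hz
      have hMz : (M ^ k) *ᵥ z = y - wordValue M u := by
        rw [hz, Matrix.mulVec_mulVec, hMI, Matrix.one_mulVec]
      have hNz : N (toReal (y - wordValue M u)) = toReal z - R *ᵥ toReal z := by
        rw [← hMz, hNapply, toReal_pow_mulVec, hP.mulVec_pow, ← hP.pow_mulVec,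
          ← Matrix.mulVec_sub, hIMr]
      rw [hNz] at hyU
      obtain ⟨w, hw, hwz⟩ := exists_wordValue_eq hM hP hμ1 hμ hyU
      have hw' : ∀ a ∈ w, a ∈ box A r := fun a ha i => (hw a ha i).trans hr
      have hyw : wordValue M (u ++ List.replicate m 0 ++ w) = y := by
        rw [hvalue, hwz, hMz, add_sub_cancel]
      have := hm w hw' ⟨hletters u m w hu hw', by rw [hyw]; exact hy⟩
      rw [mem_padClosure_valueWords, hyw] at this
      exact this.2

omit [DecidableEq A] in
theorem exists_rowBound (M : Matrix A A ℤ) :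
    ∃ μ : ℕ, 1 ≤ μ ∧ ∀ i, ∑ j, (M i j).natAbs ≤ μ :=
  ⟨1 + ∑ i, ∑ j, (M i j).natAbs, Nat.le_add_right _ _, fun i =>
    (Finset.single_le_sum (f := fun i => ∑ j, (M i j).natAbs) (fun _ _ => Nat.zero_le _)
      (Finset.mem_univ i)).trans (Nat.le_add_left _ _)⟩

theorem isRegular_interiorLanguage {M : Matrix A A ℤ} {β : ℝ}
    (hM : IsIrreduciblePisotUnimodular M β) {P : Submodule ℝ (A → ℝ)}
    (hPE : IsCompl P (realEigenspace M β)) {alphabet : Finset (A → ℤ)} {L : Language (A → ℤ)}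
    (hL : ∀ u ∈ L, ∀ a ∈ u, a ∈ alphabet) (hreg : L.IsRegular) :
    (interiorLanguage M (P.projectionOnto (realEigenspace M β) hPE) L).IsRegular := by
  obtain ⟨μ, hμ1, hμ⟩ := exists_rowBound M
  obtain ⟨R, hP⟩ := hM.exists_isSpectralProjection
  obtain ⟨g, hg⟩ := hM.exists_isDominantRelation
  have hK := hg.isValueBound hM hP hμ1 hμ
  -- The radius must cover the alphabet of `L` and also the digits of size `μ` produced by rounding.
  set r := μ + ∑ x ∈ alphabet, ∑ i, (x i).natAbs with hr
  have hLr : ∀ u ∈ L, ∀ a ∈ u, a ∈ box A r := by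
    intro u hu a ha i
    have h1 := Finset.single_le_sum (f := fun i => (a i).natAbs) (fun _ _ => Nat.zero_le _)
      (Finset.mem_univ i)
    have h2 := Finset.single_le_sum (f := fun x : A → ℤ => ∑ i, (x i).natAbs)
      (fun _ _ => Nat.zero_le _) (hL u hu a ha)
    exact (h1.trans h2).trans (Nat.le_add_left _ _)
  obtain ⟨T, hT⟩ := hK.exists_isTrap hM hP r (3 * orbitBound g μ * r)
  rw [interiorLanguage_eq_stableInterior hM hP hK hPE hμ1 hμ (Nat.le_add_right _ _) hLr]
  let κ : List (A → ℤ) → Set.range L.leftQuotient := fun u => ⟨L.leftQuotient u, u, rfl⟩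
  have : Finite (Set.range L.leftQuotient) := hreg.finite_range_leftQuotient
  have hκ : Colors κ L := (colors_leftQuotient L).of_refines fun u v h => congrArg Subtype.val h
  have h₁ := colors_nonnegColor hK hM.one_lt hP hT
  have h₂ := (colors_valueColor hK hM.one_lt hP hκ hLr).padClosure 0
  let f := fun u => (κ u, nonnegColor M r T u, valueColor κ M r (4 * orbitBound g μ * r) L u)
  have hf : Colors f (stableInterior (box A r) 0 L (nonnegWords M r)
      (padClosure 0 (valueWords M r L))) :=
    Colors.stableInterior
      (hκ.of_refines fun u v h => congrArg Prod.fst h)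
      (h₁.of_refines fun u v h => congrArg (fun x => x.2.1) h)
      (h₂.of_refines fun u v h => congrArg (fun x => x.2.2) h) _ _
  exact hf.isRegular

end Interior

/-! ### Primitive recursion for bounded quantifiers, integers and words -/

section PrimrecTools

open Primrec

variable {α β σ : Type*} [Primcodable α] [Primcodable β] [Primcodable σ]

theorem PrimrecPred.imp {p q : α → Prop} (hp : PrimrecPred p) (hq : PrimrecPred q) :
    PrimrecPred fun a => p a → q a :=
  (hp.not.or hq).of_eq fun _ => imp_iff_not_or.symm

theorem PrimrecPred.iff {p q : α → Prop} (hp : PrimrecPred p) (hq : PrimrecPred q) :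
    PrimrecPred fun a => p a ↔ q a :=
  ((hp.imp hq).and (hq.imp hp)).of_eq fun _ => iff_def.symm

theorem PrimrecPred.forall_mem {l : α → List β} {p : α → β → Prop} (hl : Primrec l)
    (hp : PrimrecPred fun x : α × β => p x.1 x.2) : PrimrecPred fun a => ∀ b ∈ l a, p a b := by
  have hR : PrimrecRel fun (b : β) (a : α) => p a b := hp.comp (snd.pair fst)
  exact hR.forall_mem_list.comp hl Primrec.id

theorem PrimrecPred.exists_mem {l : α → List β} {p : α → β → Prop} (hl : Primrec l)
    (hp : PrimrecPred fun x : α × β => p x.1 x.2) : PrimrecPred fun a => ∃ b ∈ l a, p a b := by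
  have hR : PrimrecRel fun (b : β) (a : α) => p a b := hp.comp (snd.pair fst)
  exact hR.exists_mem_list.comp hl Primrec.id

theorem PrimrecPred.forall_lt' {n : α → ℕ} {p : α → ℕ → Prop} (hn : Primrec n)
    (hp : PrimrecPred fun x : α × ℕ => p x.1 x.2) : PrimrecPred fun a => ∀ k < n a, p a k :=
  (PrimrecPred.forall_mem (list_range.comp hn) hp).of_eq fun a => by simp

theorem PrimrecPred.exists_lt' {n : α → ℕ} {p : α → ℕ → Prop} (hn : Primrec n)
    (hp : PrimrecPred fun x : α × ℕ => p x.1 x.2) : PrimrecPred fun a => ∃ k < n a, p a k :=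
  (PrimrecPred.exists_mem (list_range.comp hn) hp).of_eq fun a => by simp

theorem PrimrecPred.mem_list {f : α → β} {l : α → List β} (hf : Primrec f) (hl : Primrec l) :
    PrimrecPred fun a => f a ∈ l a :=
  (PrimrecPred.exists_mem (p := fun a b => b = f a) hl
    (Primrec.eq.comp snd (hf.comp fst))).of_eq fun a => by simp

theorem primrec_nat_pow : Primrec₂ ((· ^ ·) : ℕ → ℕ → ℕ) :=
  Primrec₂.unpaired'.1 Nat.Primrec.pow

/-- The encoding of `ℤ` agrees with that of `ℕ ⊕ ℕ`, so integer arithmetic reduces to natural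
arithmetic on positive and negative parts. -/
theorem primrec_int_toSum : Primrec Equiv.intEquivNatSumNat := by
  refine Primrec.encode_iff.1 (Primrec.encode.of_eq fun z => ?_)
  cases z <;> rfl

theorem primrec_int_toNat : Primrec Int.toNat :=
  (Primrec.sumCasesOn primrec_int_toSum Primrec₂.right (Primrec₂.const 0)).of_eq fun z => by
    cases z <;> rfl

theorem primrec_int_neg_toNat : Primrec fun z : ℤ => (-z).toNat :=
  (Primrec.sumCasesOn primrec_int_toSum (Primrec₂.const 0)
    (Primrec.succ.comp₂ Primrec₂.right)).of_eq fun z => by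
    cases z with
    | ofNat n =>
      change 0 = (-(n : ℤ)).toNat
      omega
    | negSucc n => rfl

theorem primrec_int_ofNat : Primrec Int.ofNat :=
  Primrec.encode_iff.1 ((Primrec.encode.comp Primrec.sumInl).of_eq
    (g := fun n => Encodable.encode (Int.ofNat n)) (f := fun n => Encodable.encode (Sum.inl n : ℕ ⊕ ℕ))
    fun _ => rfl)

theorem primrec_int_negSucc : Primrec Int.negSucc :=
  Primrec.encode_iff.1 ((Primrec.encode.comp Primrec.sumInr).of_eq
    (g := fun n => Encodable.encode (Int.negSucc n))
    (f := fun n => Encodable.encode (Sum.inr n : ℕ ⊕ ℕ)) fun _ => rfl)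

theorem primrec_nat_sub_int : Primrec₂ fun p n : ℕ => (p : ℤ) - n := by
  refine (Primrec.ite (c := fun x : ℕ × ℕ => x.2 ≤ x.1) (Primrec.nat_le.comp snd fst)
    (primrec_int_ofNat.comp (Primrec.nat_sub.comp fst snd))
    (primrec_int_negSucc.comp (Primrec.pred.comp (Primrec.nat_sub.comp snd fst)))).of_eq ?_
  rintro ⟨p, n⟩
  dsimp only
  split_ifs with h
  · rw [Int.ofNat_eq_natCast]
    omega
  · rw [Int.negSucc_eq, Nat.pred_eq_sub_one]
    omega

theorem primrec_int_natAbs : Primrec Int.natAbs :=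
  (Primrec.nat_add.comp primrec_int_toNat primrec_int_neg_toNat).of_eq fun z => by omega

theorem primrec_int_add : Primrec₂ ((· + ·) : ℤ → ℤ → ℤ) := by
  have p₁ := primrec_int_toNat.comp (fst (α := ℤ) (β := ℤ))
  have p₂ := primrec_int_toNat.comp (snd (α := ℤ) (β := ℤ))
  have n₁ := primrec_int_neg_toNat.comp (fst (α := ℤ) (β := ℤ))
  have n₂ := primrec_int_neg_toNat.comp (snd (α := ℤ) (β := ℤ))
  refine (primrec_nat_sub_int.comp (Primrec.nat_add.comp p₁ p₂)
    (Primrec.nat_add.comp n₁ n₂)).of_eq ?_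
  rintro ⟨x, y⟩
  dsimp only
  omega

theorem primrec_int_mul : Primrec₂ ((· * ·) : ℤ → ℤ → ℤ) := by
  have p₁ := primrec_int_toNat.comp (fst (α := ℤ) (β := ℤ))
  have p₂ := primrec_int_toNat.comp (snd (α := ℤ) (β := ℤ))
  have n₁ := primrec_int_neg_toNat.comp (fst (α := ℤ) (β := ℤ))
  have n₂ := primrec_int_neg_toNat.comp (snd (α := ℤ) (β := ℤ))
  refine (primrec_nat_sub_int.comp
    (Primrec.nat_add.comp (Primrec.nat_mul.comp p₁ p₂) (Primrec.nat_mul.comp n₁ n₂))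
    (Primrec.nat_add.comp (Primrec.nat_mul.comp p₁ n₂) (Primrec.nat_mul.comp n₁ p₂))).of_eq ?_
  rintro ⟨x, y⟩
  dsimp only
  have hx : x = (x.toNat : ℤ) - (-x).toNat := by omega
  have hy : y = (y.toNat : ℤ) - (-y).toNat := by omega
  conv_rhs => rw [hx, hy]
  push_cast
  ring

theorem primrec_list_sum_int : Primrec (List.sum : List ℤ → ℤ) :=
  (Primrec.list_foldr (h := fun _ p => p.1 + p.2) Primrec.id (Primrec.const 0)
    (primrec_int_add.comp (fst.comp snd) (snd.comp snd)).to₂).of_eq fun _ => rfl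

theorem primrec_list_sum_nat : Primrec (List.sum : List ℕ → ℕ) :=
  (Primrec.list_foldr (h := fun _ p => p.1 + p.2) Primrec.id (Primrec.const 0)
    (Primrec.nat_add.comp (fst.comp snd) (snd.comp snd)).to₂).of_eq fun _ => rfl

/-- The list of the words of length `n` over the letters in `l`. -/
def wordList {α : Type*} (l : List α) (n : ℕ) : List (List α) :=
  Nat.rec [[]] (fun _ ws => ws.flatMap fun w => l.map fun a => a :: w) n

theorem mem_wordList {α : Type*} {l : List α} {n : ℕ} {w : List α} :
    w ∈ wordList l n ↔ w.length = n ∧ ∀ a ∈ w, a ∈ l := by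
  induction n generalizing w with
  | zero => simp +contextual [wordList]
  | succ n ih =>
    have : wordList l (n + 1) = (wordList l n).flatMap fun w => l.map fun a => a :: w := rfl
    rw [this]
    simp only [List.mem_flatMap, List.mem_map, ih]
    constructor
    · rintro ⟨v, ⟨rfl, h⟩, a, ha, rfl⟩
      exact ⟨rfl, by simpa using ⟨ha, h⟩⟩
    · rintro ⟨h1, h2⟩
      cases w with
      | nil => simp at h1
      | cons a v =>
        exact ⟨v, ⟨by simpa using h1, fun b hb => h2 b (List.mem_cons_of_mem a hb)⟩, a,
          h2 a List.mem_cons_self, rfl⟩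

theorem primrec_wordList : Primrec₂ (wordList : List α → ℕ → List (List α)) := by
  refine Primrec.nat_rec (f := fun _ : List α => ([[]] : List (List α)))
    (g := fun l p => p.2.flatMap fun w => l.map fun a => a :: w) (Primrec.const [[]]) ?_
  refine Primrec.list_flatMap (snd.comp snd) ?_
  refine Primrec.list_map (fst.comp fst) ?_
  exact Primrec.list_cons.comp snd (snd.comp fst)

end PrimrecTools

/-! ### Vectors, values and runs on list codes -/

section Codes

open Primrec

/-- The code of the vector `x + M h`. -/
def codeStep (m : List (List ℤ)) (x h : List ℤ) : List ℤ :=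
  (List.range m.length).map fun i => x.getD i 0 +
    ((List.range m.length).map fun j => (m.getD i []).getD j 0 * h.getD j 0).sum

/-- The code of the zero vector. -/
def codeZero (d : ℕ) : List ℤ := (List.range d).map fun _ => 0

/-- The code of the value of a word. -/
def codeValue (m : List (List ℤ)) (w : List (List ℤ)) : List ℤ :=
  w.foldr (codeStep m) (codeZero m.length)

theorem getD_ofFn {d : ℕ} {α : Type*} (f : Fin d → α) (a : α) (i : Fin d) :
    (List.ofFn f).getD i a = f i := by
  simp [List.getD]

theorem map_range_eq_ofFn {d : ℕ} {α : Type*} (f : ℕ → α) :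
    (List.range d).map f = List.ofFn fun i : Fin d => f i := by
  refine List.ext_getElem (by simp) fun i h₁ h₂ => by simp

theorem length_matrixCode {d : ℕ} (M : Matrix (Fin d) (Fin d) ℤ) : (matrixCode M).length = d := by
  simp [matrixCode]

theorem codeZero_eq (d : ℕ) : codeZero d = List.ofFn (0 : Fin d → ℤ) :=
  map_range_eq_ofFn _

theorem codeStep_matrixCode {d : ℕ} (M : Matrix (Fin d) (Fin d) ℤ) (x h : Fin d → ℤ) :
    codeStep (matrixCode M) (List.ofFn x) (List.ofFn h) = List.ofFn (x + M *ᵥ h) := by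
  rw [codeStep, length_matrixCode, map_range_eq_ofFn]
  congr 1
  ext i
  rw [map_range_eq_ofFn, List.sum_ofFn, getD_ofFn, Pi.add_apply]
  congr 1
  refine Finset.sum_congr rfl fun j _ => ?_
  rw [matrixCode, getD_ofFn, getD_ofFn, getD_ofFn]

theorem codeValue_matrixCode {d : ℕ} (M : Matrix (Fin d) (Fin d) ℤ) (w : List (Fin d → ℤ)) :
    codeValue (matrixCode M) (w.map List.ofFn) = List.ofFn (wordValue M w) := by
  induction w with
  | nil => rw [List.map_nil, codeValue, List.foldr_nil, length_matrixCode, codeZero_eq,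
      wordValue_nil]
  | cons x w ih =>
    rw [List.map_cons, wordValue_cons, ← codeStep_matrixCode, ← ih]
    rfl

theorem primrec_codeZero : Primrec codeZero :=
  Primrec.list_map Primrec.list_range (Primrec₂.const 0)

theorem primrec_codeStep :
    Primrec fun p : List (List ℤ) × List ℤ × List ℤ => codeStep p.1 p.2.1 p.2.2 := by
  have e : Primrec fun q : ((List (List ℤ) × List ℤ × List ℤ) × ℕ) × ℕ =>
      (q.1.1.1.getD q.1.2 []).getD q.2 0 :=
    (list_getD (0 : ℤ)).comp ((list_getD ([] : List ℤ)).comp (fst.comp (fst.comp fst))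
      (snd.comp fst)) snd
  have h : Primrec fun q : ((List (List ℤ) × List ℤ × List ℤ) × ℕ) × ℕ =>
      q.1.1.2.2.getD q.2 0 :=
    (list_getD (0 : ℤ)).comp (snd.comp (snd.comp (fst.comp fst))) snd
  have r : Primrec fun q : (List (List ℤ) × List ℤ × List ℤ) × ℕ => List.range q.1.1.length :=
    list_range.comp (list_length.comp (fst.comp fst))
  have s : Primrec fun q : (List (List ℤ) × List ℤ × List ℤ) × ℕ =>
      ((List.range q.1.1.length).map fun j =>
        (q.1.1.getD q.2 []).getD j 0 * q.1.2.2.getD j 0).sum :=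
    primrec_list_sum_int.comp (Primrec.list_map r (primrec_int_mul.comp e h).to₂)
  have t : Primrec fun q : (List (List ℤ) × List ℤ × List ℤ) × ℕ => q.1.2.1.getD q.2 0 :=
    (list_getD (0 : ℤ)).comp (fst.comp (snd.comp fst)) snd
  exact Primrec.list_map (list_range.comp (list_length.comp fst)) (primrec_int_add.comp t s).to₂

theorem primrec_codeValue : Primrec₂ codeValue := by
  have h : Primrec₂ fun (p : List (List ℤ) × List (List ℤ)) (q : List ℤ × List ℤ) =>
      codeStep p.1 q.1 q.2 :=
    Primrec.comp (g := fun x : (List (List ℤ) × List (List ℤ)) × List ℤ × List ℤ =>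
      (x.1.1, x.2)) primrec_codeStep ((fst.comp fst).pair snd)
  exact Primrec.list_foldr snd (primrec_codeZero.comp (list_length.comp fst)) h

/-- The list of the states reached by the automaton described by `c` after reading `w`. -/
def codeRun (c : AutomatonCode) (w : List (List ℤ)) : List ℕ :=
  w.foldl (fun S a => c.2.2.filterMap fun t =>
    if t.1 ∈ S ∧ t.2.1 = a then some t.2.2 else none) c.1

/-- The automaton described by `c` accepts `w`. -/
def CodeAccepts (c : AutomatonCode) (w : List (List ℤ)) : Prop :=
  ∃ q ∈ codeRun c w, q ∈ c.2.1

theorem mem_codeRun {d : ℕ} (c : AutomatonCode) (w : List (Fin d → ℤ)) (q : ℕ) :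
    q ∈ codeRun c (w.map List.ofFn) ↔ q ∈ (c.toNFA d).eval w := by
  induction w using List.reverseRecOn generalizing q with
  | nil => rfl
  | append_singleton w a ih =>
    rw [List.map_append, codeRun, List.foldl_append, ← codeRun, NFA.eval_append_singleton,
      NFA.mem_stepSet]
    simp only [List.map_cons, List.map_nil, List.foldl_cons, List.foldl_nil, List.mem_filterMap,
      Option.ite_none_right_eq_some, Option.some.injEq]
    constructor
    · rintro ⟨⟨p, b, q'⟩, ht, ⟨hp, rfl⟩, rfl⟩
      exact ⟨p, (ih p).1 hp, ht⟩
    · rintro ⟨p, hp, ht⟩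
      exact ⟨(p, List.ofFn a, q), ht, ⟨(ih p).2 hp, rfl⟩, rfl⟩

theorem codeAccepts_iff {d : ℕ} (c : AutomatonCode) (w : List (Fin d → ℤ)) :
    CodeAccepts c (w.map List.ofFn) ↔ w ∈ c.language d := by
  have : w ∈ c.language d ↔ ∃ q ∈ (c.toNFA d).accept, q ∈ (c.toNFA d).eval w := Iff.rfl
  rw [this, CodeAccepts]
  exact exists_congr fun q => by rw [mem_codeRun, and_comm]; rfl

theorem primrec_codeRun : Primrec₂ codeRun := by
  have hp : PrimrecPred fun x : ((AutomatonCode × List (List ℤ)) × List ℕ × List ℤ) ×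
      ℕ × List ℤ × ℕ => x.2.1 ∈ x.1.2.1 ∧ x.2.2.1 = x.1.2.2 :=
    PrimrecPred.and (PrimrecPred.mem_list (fst.comp snd) (fst.comp (snd.comp fst)))
      (Primrec.eq.comp (fst.comp (snd.comp snd)) (snd.comp (snd.comp fst)))
  have hf : Primrec₂ fun (p : (AutomatonCode × List (List ℤ)) × List ℕ × List ℤ)
      (t : ℕ × List ℤ × ℕ) => if t.1 ∈ p.2.1 ∧ t.2.1 = p.2.2 then some t.2.2 else none :=
    (Primrec.ite hp (Primrec.option_some.comp (snd.comp (snd.comp snd))) (Primrec.const none)).to₂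
  have hg : Primrec₂ fun (p : AutomatonCode × List (List ℤ)) (q : List ℕ × List ℤ) =>
      p.1.2.2.filterMap fun t => if t.1 ∈ q.1 ∧ t.2.1 = q.2 then some t.2.2 else none :=
    Primrec.listFilterMap (snd.comp (snd.comp (fst.comp fst))) hf
  exact Primrec.list_foldl snd (fst.comp fst) hg

theorem primrecRel_codeAccepts : PrimrecRel CodeAccepts :=
  PrimrecPred.exists_mem (α := AutomatonCode × List (List ℤ)) primrec_codeRun
    (PrimrecPred.mem_list snd (fst.comp (snd.comp (fst.comp fst))))

/-- The list of the integers of absolute value at most `r`. -/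
def codeInterval (r : ℕ) : List ℤ :=
  (List.range (r + 1)).map Int.ofNat ++ (List.range r).map Int.negSucc

theorem mem_codeInterval {r : ℕ} {z : ℤ} : z ∈ codeInterval r ↔ z.natAbs ≤ r := by
  simp only [codeInterval, List.mem_append, List.mem_map, List.mem_range]
  cases z with
  | ofNat n => simp
  | negSucc n => simp

/-- The list of the codes of the vectors of the box of dimension `d` and radius `r`. -/
def codeBox (d r : ℕ) : List (List ℤ) := wordList (codeInterval r) d

theorem mem_codeBox {d r : ℕ} {l : List ℤ} :
    l ∈ codeBox d r ↔ ∃ x ∈ box (Fin d) r, List.ofFn x = l := by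
  rw [codeBox, mem_wordList]
  simp only [mem_codeInterval]
  constructor
  · rintro ⟨rfl, h⟩
    exact ⟨l.get, fun i => h _ (List.get_mem l i), List.ofFn_get l⟩
  · rintro ⟨x, hx, rfl⟩
    refine ⟨List.length_ofFn, fun a ha => ?_⟩
    obtain ⟨i, rfl⟩ := (List.mem_ofFn' _ _).1 ha
    exact hx i

theorem mem_wordList_codeBox {d r n : ℕ} {l : List (List ℤ)} :
    l ∈ wordList (codeBox d r) n ↔
      ∃ w : List (Fin d → ℤ), w.length = n ∧ (∀ a ∈ w, a ∈ box (Fin d) r) ∧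
        w.map List.ofFn = l := by
  rw [mem_wordList]
  constructor
  · rintro ⟨rfl, h⟩
    induction l with
    | nil => exact ⟨[], by simp⟩
    | cons a l ih =>
      obtain ⟨w, h1, h2, rfl⟩ := ih fun b hb => h b (List.mem_cons_of_mem a hb)
      obtain ⟨x, hx, rfl⟩ := mem_codeBox.1 (h a List.mem_cons_self)
      exact ⟨x :: w, by rw [List.length_cons, h1, List.length_cons], by simpa using ⟨hx, h2⟩, rfl⟩
  · rintro ⟨w, rfl, h, rfl⟩
    refine ⟨List.length_map _, fun a ha => ?_⟩
    obtain ⟨x, hx, rfl⟩ := List.mem_map.1 ha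
    exact mem_codeBox.2 ⟨x, h x hx, rfl⟩

theorem primrec_codeBox : Primrec₂ codeBox := by
  refine primrec_wordList.comp (Primrec.list_append.comp ?_ ?_) fst
  · exact Primrec.list_map (list_range.comp (Primrec.succ.comp snd))
      (primrec_int_ofNat.comp₂ Primrec₂.right)
  · exact Primrec.list_map (list_range.comp snd) (primrec_int_negSucc.comp₂ Primrec₂.right)

end Codes

/-! ### Coded automata, their colours and their alphabets -/

section AutomatonCodes

variable {d : ℕ}

/-- The states that the automaton described by `c` can reach. -/
def codeStates (c : AutomatonCode) : Finset ℕ := (c.1 ++ c.2.2.map fun t => t.2.2).toFinset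

/-- A bound for the number of the reachable states. -/
def codeSize (c : AutomatonCode) : ℕ := c.1.length + c.2.2.length

theorem card_codeStates_le (c : AutomatonCode) : (codeStates c).card ≤ codeSize c := by
  refine (List.toFinset_card_le _).trans ?_
  rw [List.length_append, List.length_map, codeSize]

/-- The set of the states reached by the automaton described by `c` after reading `u`. -/
def stateColor (c : AutomatonCode) (u : List (Fin d → ℤ)) : Set (codeStates c) :=
  {q | (q : ℕ) ∈ (c.toNFA d).eval u}

theorem mem_codeStates {c : AutomatonCode} {u : List (Fin d → ℤ)} {q : ℕ}
    (h : q ∈ (c.toNFA d).eval u) : q ∈ codeStates c := by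
  rw [codeStates, List.mem_toFinset, List.mem_append]
  induction u using List.reverseRecOn with
  | nil => exact Or.inl h
  | append_singleton w a ih =>
    rw [NFA.eval_append_singleton, NFA.mem_stepSet] at h
    obtain ⟨p, _, ht⟩ := h
    exact Or.inr (List.mem_map.2 ⟨_, ht, rfl⟩)

/-- The subset construction. The state type is `ℕ`, but only the initial states and the targets of
transitions are reachable, so the colours are finite in number. -/
theorem colors_stateColor (c : AutomatonCode) :
    Colors (stateColor (d := d) c) (c.language d) := by
  intro u v huv w
  have h : (c.toNFA d).eval u = (c.toNFA d).eval v := by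
    ext q
    by_cases hq : q ∈ codeStates c
    · exact Set.ext_iff.1 huv ⟨q, hq⟩
    · exact iff_of_false (fun h => hq (mem_codeStates h)) (fun h => hq (mem_codeStates h))
  have key : ∀ s, s ++ w ∈ c.language d ↔
      w ∈ (c.toNFA d).acceptsFrom ((c.toNFA d).eval s) := fun s =>
    (c.toNFA d).append_mem_acceptsFrom
  rw [key, key, h]

theorem AutomatonCode.isRegular_language (d : ℕ) (c : AutomatonCode) :
    (c.language d).IsRegular :=
  (colors_stateColor c).isRegular

/-- Transitions whose label does not have length `d` can never be taken, so only the others need to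
be controlled. -/
theorem mem_box_of_mem_language {c : AutomatonCode} {r : ℕ}
    (hc : ∀ t ∈ c.2.2, t.2.1.length = d → ∀ y ∈ t.2.1, y.natAbs ≤ r)
    {u : List (Fin d → ℤ)} (hu : u ∈ c.language d) : ∀ a ∈ u, a ∈ box (Fin d) r := by
  obtain ⟨q, hq⟩ : ∃ q, q ∈ (c.toNFA d).eval u := hu.imp fun _ h => h.2
  clear hu
  induction u using List.reverseRecOn generalizing q with
  | nil => simp
  | append_singleton w a ih =>
    rw [NFA.eval_append_singleton, NFA.mem_stepSet] at hq
    obtain ⟨p, hp, ht⟩ := hq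
    intro b hb
    rcases List.mem_append.1 hb with hb | hb
    · exact ih p hp b hb
    · rw [List.mem_singleton.1 hb]
      exact fun i => hc _ ht List.length_ofFn _ ((List.mem_ofFn' _ _).2 ⟨i, rfl⟩)

/-- The states of a finite automaton are numbered, and only transitions with letters in the box are
listed; words with other letters are lost, but they are not in `L`. -/
theorem exists_automatonCode {L : Language (Fin d → ℤ)} {r : ℕ} (hL : L.IsRegular)
    (hr : ∀ u ∈ L, ∀ a ∈ u, a ∈ box (Fin d) r) :
    ∃ c : AutomatonCode, c.language d = L ∧
      ∀ t ∈ c.2.2, t.2.1.length = d → ∀ y ∈ t.2.1, y.natAbs ≤ r := by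
  classical
  obtain ⟨σ, _, D, rfl⟩ := hL
  let e : σ ≃ Fin (Fintype.card σ) := Fintype.equivFin σ
  let c : AutomatonCode := ([(e D.start : ℕ)],
    (Finset.univ.filter fun s => s ∈ D.accept).toList.map fun s => (e s : ℕ),
    (Finset.univ ×ˢ boxFinset (Fin d) r).toList.map fun x =>
      ((e x.1 : ℕ), List.ofFn x.2, (e (D.step x.1 x.2) : ℕ)))
  have hlet : ∀ t ∈ c.2.2, t.2.1.length = d → ∀ y ∈ t.2.1, y.natAbs ≤ r := by
    intro t ht _ y hy
    obtain ⟨x, hx, rfl⟩ := List.mem_map.1 ht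
    obtain ⟨i, rfl⟩ := (List.mem_ofFn' _ _).1 hy
    exact mem_boxFinset.1 (Finset.mem_product.1 (Finset.mem_toList.1 hx)).2 i
  have hstep : ∀ (s : σ) (a : Fin d → ℤ) (q : ℕ), q ∈ (c.toNFA d).step (e s) a ↔
      a ∈ box (Fin d) r ∧ q = e (D.step s a) := by
    intro s a q
    change ((e s : ℕ), List.ofFn a, q) ∈ c.2.2 ↔ _
    simp only [c, List.mem_map, Finset.mem_toList, Finset.mem_product, Finset.mem_univ, true_and,
      Prod.mk.injEq, mem_boxFinset]
    constructor
    · rintro ⟨⟨s', a'⟩, h1, h2, h3, rfl⟩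
      obtain rfl := e.injective (Fin.ext h2)
      obtain rfl := List.ofFn_injective h3
      exact ⟨h1, rfl⟩
    · rintro ⟨h1, rfl⟩
      exact ⟨(s, a), h1, rfl, rfl, rfl⟩
  have heval : ∀ u : List (Fin d → ℤ), (∀ a ∈ u, a ∈ box (Fin d) r) →
      (c.toNFA d).eval u = {(e (D.eval u) : ℕ)} := by
    intro u
    induction u using List.reverseRecOn with
    | nil =>
      intro _
      ext q
      exact List.mem_singleton
    | append_singleton w a ih =>
      intro h
      ext q
      rw [NFA.eval_append_singleton, ih fun b hb => h b (List.mem_append_left _ hb),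
        NFA.stepSet_singleton, hstep, DFA.eval_append_singleton, Set.mem_singleton_iff]
      exact and_iff_right (h a (by simp))
  refine ⟨c, ?_, hlet⟩
  have hacc : ∀ s : σ, (e s : ℕ) ∈ (c.toNFA d).accept ↔ s ∈ D.accept := by
    intro s
    change (e s : ℕ) ∈ c.2.1 ↔ _
    simp only [c, List.mem_map, Finset.mem_toList, Finset.mem_filter, Finset.mem_univ, true_and]
    constructor
    · rintro ⟨s', h1, h2⟩
      obtain rfl := e.injective (Fin.ext h2)
      exact h1
    · exact fun h => ⟨s, h, rfl⟩
  ext u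
  by_cases hu : ∀ a ∈ u, a ∈ box (Fin d) r
  · have : u ∈ c.language d ↔ ∃ q ∈ (c.toNFA d).accept, q ∈ (c.toNFA d).eval u := Iff.rfl
    rw [this, heval u hu]
    simp only [Set.mem_singleton_iff, exists_eq_right, hacc]
    rfl
  · exact iff_of_false (fun h => hu (mem_box_of_mem_language hlet h)) (fun h => hu (hr u h))

theorem exists_radius (d : ℕ) (c : AutomatonCode) :
    ∃ r, ∀ t ∈ c.2.2, t.2.1.length = d → ∀ y ∈ t.2.1, y.natAbs ≤ r := by
  refine ⟨(c.2.2.map fun t => (t.2.1.map Int.natAbs).sum).sum, fun t ht _ y hy => ?_⟩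
  exact (List.le_sum_of_mem (List.mem_map.2 ⟨y, hy, rfl⟩)).trans
    (List.le_sum_of_mem (List.mem_map.2 ⟨t, ht, rfl⟩))

end AutomatonCodes

/-! ### Matrix relations as values of words -/

section Relation

variable {A : Type*} [Fintype A] [DecidableEq A]

theorem sum_map_natAbs (g : List ℤ) :
    (g.map Int.natAbs).sum = ∑ i ∈ Finset.range g.length, (g.getD i 0).natAbs := by
  induction g with
  | nil => rfl
  | cons z g ih =>
    rw [List.map_cons, List.sum_cons, ih, List.length_cons, Finset.sum_range_succ', add_comm]
    simp only [List.getD_cons_succ, List.getD_cons_zero]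

/-- A polynomial in `M` applied to a basis vector is the value of a word, so checking a relation
reuses the evaluation of words. -/
theorem wordValue_map_single (M : Matrix A A ℤ) (g : List ℤ) (i : A) :
    wordValue M (g.map fun z => Pi.single i z) =
      (∑ k ∈ Finset.range g.length, g.getD k 0 • M ^ k) *ᵥ Pi.single i 1 := by
  induction g with
  | nil => simp [Matrix.zero_mulVec, -Matrix.mulVec_single]
  | cons z g ih =>
    rw [List.map_cons, wordValue_cons, ih, List.length_cons, Finset.sum_range_succ']
    simp only [List.getD_cons_succ, List.getD_cons_zero, pow_succ', pow_zero]
    rw [Matrix.add_mulVec, Matrix.smul_mulVec, Matrix.one_mulVec, add_comm,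
      Matrix.mulVec_mulVec, Finset.mul_sum]
    congr 2
    · exact Finset.sum_congr rfl fun k _ => Matrix.mul_smul _ _ _
    · rw [← Pi.single_smul', smul_eq_mul, mul_one]

theorem sum_smul_pow_eq_zero_iff (M : Matrix A A ℤ) (g : List ℤ) :
    ∑ k ∈ Finset.range g.length, g.getD k 0 • M ^ k = 0 ↔
      ∀ i, wordValue M (g.map fun z => Pi.single i z) = 0 := by
  simp only [wordValue_map_single]
  refine ⟨fun h i => by rw [h, Matrix.zero_mulVec], fun h => ?_⟩
  ext i j
  have := congrFun (h j) i
  rwa [Matrix.mulVec_single_one] at this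

end Relation

/-! ### Certificates and the primitive recursiveness of their verification -/

section Check

open Primrec

/-- The word `t` has a value with nonnegative coordinates. -/
def CodeNonneg (m : List (List ℤ)) (t : List (List ℤ)) : Prop :=
  ∀ y ∈ codeValue m t, (-y).toNat = 0

/-- The data of a matrix, of an automaton, of a radius and of a bound for the searches. -/
abbrev SearchCode : Type := List (List ℤ) × AutomatonCode × ℕ × ℕ

/-- The words of length `n` over the alphabet of the search. -/
def searchWords (p : SearchCode) (n : ℕ) : List (List (List ℤ)) :=
  wordList (codeBox p.1.length p.2.2.1) n

/-- The word `t`, after appending less than `p.2.2.2` zeros, has the value of an accepted word that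
is not longer. -/
def CodeHasValue (p : SearchCode) (t : List (List ℤ)) : Prop :=
  ∃ k < p.2.2.2, ∃ l < t.length + k + 1, ∃ v ∈ searchWords p l,
    CodeAccepts p.2.1 v ∧ codeValue p.1 v = codeValue p.1 t

/-- The word `u` padded with `k` zeros. -/
def codePad (d : ℕ) (u : List (List ℤ)) (k : ℕ) : List (List ℤ) :=
  u ++ (List.range k).map fun _ => codeZero d

/-- The word `u` passes the bounded test for the interior of the language of the automaton. -/
def CodeInterior (p : SearchCode) (u : List (List ℤ)) : Prop :=
  CodeAccepts p.2.1 u ∧ CodeNonneg p.1 u ∧ ∃ k < p.2.2.2, ∀ n < p.2.2.2, ∀ w ∈ searchWords p n,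
    CodeNonneg p.1 (codePad p.1.length u k ++ w) → CodeHasValue p (codePad p.1.length u k ++ w)

/-- The automaton described by `c` accepts the short words that pass the bounded test. -/
def CodeRecognizes (p : SearchCode) (c : AutomatonCode) : Prop :=
  ∀ n < p.2.2.2, ∀ u ∈ searchWords p n, CodeAccepts c u ↔ CodeInterior p u

/-- The transitions of the automaton described by `c` with a letter of length `d` have a letter
in the box of radius `r`. -/
def CodeLetters (d r : ℕ) (c : AutomatonCode) : Prop :=
  ∀ t ∈ c.2.2, t.2.1.length = d → ∀ y ∈ t.2.1, y.natAbs ≤ r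

/-- The list `g` is a dominant relation for the matrix. -/
def CodeRelation (m : List (List ℤ)) (g : List ℤ) : Prop :=
  (∃ k < g.length, (g.map Int.natAbs).sum < 2 * (g.getD k 0).natAbs) ∧
    ∀ i < m.length, codeValue m (g.map fun z => (List.range m.length).map fun j =>
      if j = i then z else 0) = codeZero m.length

/-- The row sums of the matrix are at most `μ`. -/
def CodeRows (m : List (List ℤ)) (μ : ℕ) : Prop :=
  ∀ row ∈ m, (row.map Int.natAbs).sum ≤ μ

/-- The list `T` is a trap for the matrix `m`. -/
def CodeTrap (m : List (List ℤ)) (r b : ℕ) (T : List (List ℤ)) : Prop :=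
  codeZero m.length ∈ T ∧ ∀ h ∈ T, ∀ x ∈ codeBox m.length r,
    codeStep m x h ∈ T ∨ ∀ y ∈ codeStep m x h, b < y.natAbs

/-- The bound `orbitBound` in terms of lists. -/
def codeBound (g : List ℤ) (μ : ℕ) : ℕ := (g.map Int.natAbs).sum * (g.length * μ ^ g.length)

/-- A bound for the number of colours. -/
def colorBound (d s s' τ b : ℕ) : ℕ :=
  2 ^ s * ((2 ^ τ + 1) * ((2 ^ (2 ^ s * (2 * b + 1) ^ d) * 2 ^ ((2 * b + 1) ^ d) + 1) * 2 ^ s'))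

/-- A dominant relation, a trap, a bound for the rows, a radius and an automaton. -/
abbrev Certificate : Type := List ℤ × List (List ℤ) × ℕ × ℕ × AutomatonCode

/-- The data of the search for a certificate. -/
def certificateSearch (x : List (List ℤ) × AutomatonCode) (w : Certificate) : SearchCode :=
  (x.1, x.2, w.2.2.2.1, colorBound x.1.length (codeSize x.2) (codeSize w.2.2.2.2) w.2.1.length
    (4 * codeBound w.1 w.2.2.1 * w.2.2.2.1))

/-- The certificate `w` shows that its automaton recognizes the interior language. -/
def IsCertificate (x : List (List ℤ) × AutomatonCode) (w : Certificate) : Prop :=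
  (CodeRelation x.1 w.1 ∧ CodeTrap x.1 w.2.2.2.1 (3 * codeBound w.1 w.2.2.1 * w.2.2.2.1) w.2.1) ∧
    (CodeRows x.1 w.2.2.1 ∧ 1 ≤ w.2.2.1 ∧ w.2.2.1 ≤ w.2.2.2.1) ∧
    (CodeLetters x.1.length w.2.2.2.1 x.2 ∧ CodeLetters x.1.length w.2.2.2.1 w.2.2.2.2) ∧
    CodeRecognizes (certificateSearch x w) w.2.2.2.2

theorem primrecRel_codeNonneg : PrimrecRel CodeNonneg :=
  PrimrecPred.forall_mem (α := List (List ℤ) × List (List ℤ)) primrec_codeValue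
    (Primrec.eq.comp (primrec_int_neg_toNat.comp snd) (Primrec.const 0))

theorem primrec_searchWords : Primrec₂ searchWords :=
  primrec_wordList.comp (primrec_codeBox.comp (list_length.comp (fst.comp fst))
    (fst.comp (snd.comp (snd.comp fst)))) snd

theorem primrecRel_codeHasValue : PrimrecRel CodeHasValue := by
  have h : PrimrecPred fun x : (((SearchCode × List (List ℤ)) × ℕ) × ℕ) × List (List ℤ) =>
      CodeAccepts x.1.1.1.1.2.1 x.2 ∧
        codeValue x.1.1.1.1.1 x.2 = codeValue x.1.1.1.1.1 x.1.1.1.2 := by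
    have hp : Primrec fun x : (((SearchCode × List (List ℤ)) × ℕ) × ℕ) × List (List ℤ) =>
      x.1.1.1.1 := fst.comp (fst.comp (fst.comp fst))
    have ht : Primrec fun x : (((SearchCode × List (List ℤ)) × ℕ) × ℕ) × List (List ℤ) =>
      x.1.1.1.2 := snd.comp (fst.comp (fst.comp fst))
    exact (primrecRel_codeAccepts.comp (fst.comp (snd.comp hp)) snd).and
      (Primrec.eq.comp (primrec_codeValue.comp (fst.comp hp) snd)
        (primrec_codeValue.comp (fst.comp hp) ht))
  have h₁ : PrimrecPred fun x : ((SearchCode × List (List ℤ)) × ℕ) × ℕ =>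
      ∃ v ∈ searchWords x.1.1.1 x.2, CodeAccepts x.1.1.1.2.1 v ∧
        codeValue x.1.1.1.1 v = codeValue x.1.1.1.1 x.1.1.2 :=
    PrimrecPred.exists_mem (primrec_searchWords.comp (fst.comp (fst.comp fst)) snd) h
  have h₂ : PrimrecPred fun x : (SearchCode × List (List ℤ)) × ℕ =>
      ∃ l < x.1.2.length + x.2 + 1, ∃ v ∈ searchWords x.1.1 l, CodeAccepts x.1.1.2.1 v ∧
        codeValue x.1.1.1 v = codeValue x.1.1.1 x.1.2 :=
    PrimrecPred.exists_lt' (Primrec.succ.comp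
      (Primrec.nat_add.comp (list_length.comp (snd.comp fst)) snd)) h₁
  exact PrimrecPred.exists_lt' (α := SearchCode × List (List ℤ))
    (snd.comp (snd.comp (snd.comp fst))) h₂

theorem primrec_codePad :
    Primrec fun x : (ℕ × List (List ℤ)) × ℕ => codePad x.1.1 x.1.2 x.2 :=
  Primrec.list_append.comp (snd.comp fst) (Primrec.list_map (list_range.comp snd)
    ((primrec_codeZero.comp (fst.comp (fst.comp fst))).to₂))

theorem primrecRel_codeInterior : PrimrecRel CodeInterior := by
  have hp' : Primrec fun x : (SearchCode × List (List ℤ)) × ℕ =>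
      codePad x.1.1.1.length x.1.2 x.2 :=
    Primrec.comp (f := fun x : (ℕ × List (List ℤ)) × ℕ => codePad x.1.1 x.1.2 x.2)
      (g := fun x : (SearchCode × List (List ℤ)) × ℕ => ((x.1.1.1.length, x.1.2), x.2))
      primrec_codePad
      (Primrec.pair (Primrec.pair (list_length.comp (fst.comp (fst.comp fst))) (snd.comp fst)) snd)
  have hp'' : Primrec fun x : (((SearchCode × List (List ℤ)) × ℕ) × ℕ) × List (List ℤ) =>
      codePad x.1.1.1.1.1.length x.1.1.1.2 x.1.1.2 := hp'.comp (fst.comp fst)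
  have hw : Primrec fun x : (((SearchCode × List (List ℤ)) × ℕ) × ℕ) × List (List ℤ) =>
      codePad x.1.1.1.1.1.length x.1.1.1.2 x.1.1.2 ++ x.2 := Primrec.list_append.comp hp'' snd
  have hp : Primrec fun x : (((SearchCode × List (List ℤ)) × ℕ) × ℕ) × List (List ℤ) =>
    x.1.1.1.1 := fst.comp (fst.comp (fst.comp fst))
  have h : PrimrecPred fun x : (((SearchCode × List (List ℤ)) × ℕ) × ℕ) × List (List ℤ) =>
      CodeNonneg x.1.1.1.1.1 (codePad x.1.1.1.1.1.length x.1.1.1.2 x.1.1.2 ++ x.2) →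
        CodeHasValue x.1.1.1.1 (codePad x.1.1.1.1.1.length x.1.1.1.2 x.1.1.2 ++ x.2) :=
    (primrecRel_codeNonneg.comp (fst.comp hp) hw).imp (primrecRel_codeHasValue.comp hp hw)
  have h₁ : PrimrecPred fun x : ((SearchCode × List (List ℤ)) × ℕ) × ℕ =>
      ∀ w ∈ searchWords x.1.1.1 x.2,
        CodeNonneg x.1.1.1.1 (codePad x.1.1.1.1.length x.1.1.2 x.1.2 ++ w) →
        CodeHasValue x.1.1.1 (codePad x.1.1.1.1.length x.1.1.2 x.1.2 ++ w) :=
    PrimrecPred.forall_mem (primrec_searchWords.comp (fst.comp (fst.comp fst)) snd) h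
  have h₂ : PrimrecPred fun x : (SearchCode × List (List ℤ)) × ℕ =>
      ∀ n < x.1.1.2.2.2, ∀ w ∈ searchWords x.1.1 n,
        CodeNonneg x.1.1.1 (codePad x.1.1.1.length x.1.2 x.2 ++ w) →
        CodeHasValue x.1.1 (codePad x.1.1.1.length x.1.2 x.2 ++ w) :=
    PrimrecPred.forall_lt' (snd.comp (snd.comp (snd.comp (fst.comp fst)))) h₁
  have h₃ : PrimrecPred fun x : SearchCode × List (List ℤ) =>
      ∃ k < x.1.2.2.2, ∀ n < x.1.2.2.2, ∀ w ∈ searchWords x.1 n,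
        CodeNonneg x.1.1 (codePad x.1.1.length x.2 k ++ w) →
        CodeHasValue x.1 (codePad x.1.1.length x.2 k ++ w) :=
    PrimrecPred.exists_lt' (snd.comp (snd.comp (snd.comp fst))) h₂
  exact PrimrecPred.and (primrecRel_codeAccepts.comp (fst.comp (snd.comp fst)) snd)
    (PrimrecPred.and (primrecRel_codeNonneg.comp (fst.comp fst) snd) h₃)

theorem primrecRel_codeRecognizes : PrimrecRel CodeRecognizes := by
  have h : PrimrecPred fun x : ((SearchCode × AutomatonCode) × ℕ) × List (List ℤ) =>
      CodeAccepts x.1.1.2 x.2 ↔ CodeInterior x.1.1.1 x.2 :=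
    (primrecRel_codeAccepts.comp (snd.comp (fst.comp fst)) snd).iff
      (primrecRel_codeInterior.comp (fst.comp (fst.comp fst)) snd)
  have h₁ : PrimrecPred fun x : (SearchCode × AutomatonCode) × ℕ =>
      ∀ u ∈ searchWords x.1.1 x.2, CodeAccepts x.1.2 u ↔ CodeInterior x.1.1 u :=
    PrimrecPred.forall_mem (primrec_searchWords.comp (fst.comp fst) snd) h
  exact PrimrecPred.forall_lt' (α := SearchCode × AutomatonCode)
    (snd.comp (snd.comp (snd.comp fst))) h₁

theorem primrecPred_codeLetters :
    PrimrecPred fun x : (ℕ × ℕ) × AutomatonCode => CodeLetters x.1.1 x.1.2 x.2 := by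
  have h : PrimrecPred fun x : (((ℕ × ℕ) × AutomatonCode) × ℕ × List ℤ × ℕ) × ℤ =>
      x.2.natAbs ≤ x.1.1.1.2 :=
    Primrec.nat_le.comp (primrec_int_natAbs.comp snd) (snd.comp (fst.comp (fst.comp fst)))
  have h₁ : PrimrecPred fun x : ((ℕ × ℕ) × AutomatonCode) × ℕ × List ℤ × ℕ =>
      ∀ y ∈ x.2.2.1, y.natAbs ≤ x.1.1.2 :=
    PrimrecPred.forall_mem (fst.comp (snd.comp snd)) h
  have h₂ : PrimrecPred fun x : ((ℕ × ℕ) × AutomatonCode) × ℕ × List ℤ × ℕ =>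
      x.2.2.1.length = x.1.1.1 → ∀ y ∈ x.2.2.1, y.natAbs ≤ x.1.1.2 :=
    PrimrecPred.imp (Primrec.eq.comp (list_length.comp (fst.comp (snd.comp snd)))
      (fst.comp (fst.comp fst))) h₁
  exact PrimrecPred.forall_mem (α := (ℕ × ℕ) × AutomatonCode) (snd.comp (snd.comp snd)) h₂

theorem primrecRel_codeRelation : PrimrecRel CodeRelation := by
  have h₁ : PrimrecPred fun x : (List (List ℤ) × List ℤ) × ℕ =>
      (x.1.2.map Int.natAbs).sum < 2 * (x.1.2.getD x.2 0).natAbs :=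
    Primrec.nat_lt.comp (primrec_list_sum_nat.comp (Primrec.list_map (snd.comp fst)
        (primrec_int_natAbs.comp₂ Primrec₂.right)))
      (Primrec.nat_mul.comp (Primrec.const 2) (primrec_int_natAbs.comp
        ((list_getD (0 : ℤ)).comp (snd.comp fst) snd)))
  have h₂ : PrimrecPred fun x : List (List ℤ) × List ℤ =>
      ∃ k < x.2.length, (x.2.map Int.natAbs).sum < 2 * (x.2.getD k 0).natAbs :=
    PrimrecPred.exists_lt' (list_length.comp snd) h₁
  have h₃ : Primrec fun y : (((List (List ℤ) × List ℤ) × ℕ) × ℤ) × ℕ =>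
      if y.2 = y.1.1.2 then y.1.2 else 0 :=
    Primrec.ite (Primrec.eq.comp snd (snd.comp (fst.comp fst))) (snd.comp fst) (Primrec.const 0)
  have h₄ : Primrec fun y : ((List (List ℤ) × List ℤ) × ℕ) × ℤ =>
      (List.range y.1.1.1.length).map fun j => if j = y.1.2 then y.2 else 0 :=
    Primrec.list_map (list_range.comp (list_length.comp (fst.comp (fst.comp fst)))) h₃.to₂
  have h₅ : PrimrecPred fun x : (List (List ℤ) × List ℤ) × ℕ =>
      codeValue x.1.1 (x.1.2.map fun z => (List.range x.1.1.length).map fun j =>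
        if j = x.2 then z else 0) = codeZero x.1.1.length :=
    Primrec.eq.comp (primrec_codeValue.comp (fst.comp fst)
      (Primrec.list_map (snd.comp fst) h₄.to₂))
      (primrec_codeZero.comp (list_length.comp (fst.comp fst)))
  exact h₂.and (PrimrecPred.forall_lt' (α := List (List ℤ) × List ℤ) (list_length.comp fst) h₅)

theorem primrecRel_codeRows : PrimrecRel CodeRows :=
  PrimrecPred.forall_mem (α := List (List ℤ) × ℕ) fst
    (Primrec.nat_le.comp (primrec_list_sum_nat.comp (Primrec.list_map snd
      (primrec_int_natAbs.comp₂ Primrec₂.right))) (snd.comp fst))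

theorem primrecPred_codeTrap : PrimrecPred fun x : (List (List ℤ) × ℕ × ℕ) × List (List ℤ) =>
    CodeTrap x.1.1 x.1.2.1 x.1.2.2 x.2 := by
  have hs : Primrec fun x : (((List (List ℤ) × ℕ × ℕ) × List (List ℤ)) × List ℤ) × List ℤ =>
      codeStep x.1.1.1.1 x.2 x.1.2 :=
    Primrec.comp (f := fun p : List (List ℤ) × List ℤ × List ℤ => codeStep p.1 p.2.1 p.2.2)
      (g := fun x : (((List (List ℤ) × ℕ × ℕ) × List (List ℤ)) × List ℤ) × List ℤ =>
        (x.1.1.1.1, x.2, x.1.2)) primrec_codeStep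
      ((fst.comp (fst.comp (fst.comp fst))).pair (snd.pair (snd.comp fst)))
  have h : PrimrecPred fun x : (((List (List ℤ) × ℕ × ℕ) × List (List ℤ)) × List ℤ) × List ℤ =>
      codeStep x.1.1.1.1 x.2 x.1.2 ∈ x.1.1.2 ∨
        ∀ y ∈ codeStep x.1.1.1.1 x.2 x.1.2, x.1.1.1.2.2 < y.natAbs := by
    refine PrimrecPred.or (PrimrecPred.mem_list hs (snd.comp (fst.comp fst)))
      (PrimrecPred.forall_mem hs ?_)
    exact Primrec.nat_lt.comp (snd.comp (snd.comp (fst.comp (fst.comp (fst.comp fst)))))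
      (primrec_int_natAbs.comp snd)
  have h₁ : PrimrecPred fun x : ((List (List ℤ) × ℕ × ℕ) × List (List ℤ)) × List ℤ =>
      ∀ z ∈ codeBox x.1.1.1.length x.1.1.2.1, codeStep x.1.1.1 z x.2 ∈ x.1.2 ∨
        ∀ y ∈ codeStep x.1.1.1 z x.2, x.1.1.2.2 < y.natAbs :=
    PrimrecPred.forall_mem (primrec_codeBox.comp (list_length.comp (fst.comp (fst.comp fst)))
      (fst.comp (snd.comp (fst.comp fst)))) h
  exact (PrimrecPred.mem_list (primrec_codeZero.comp (list_length.comp (fst.comp fst))) snd).and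
    (PrimrecPred.forall_mem snd h₁)

theorem primrec_codeBound : Primrec₂ codeBound :=
  Primrec.nat_mul.comp
    (primrec_list_sum_nat.comp (Primrec.list_map fst (primrec_int_natAbs.comp₂ Primrec₂.right)))
    (Primrec.nat_mul.comp (list_length.comp fst)
      (primrec_nat_pow.comp snd (list_length.comp fst)))

theorem primrec_codeSize : Primrec codeSize :=
  Primrec.nat_add.comp (list_length.comp fst) (list_length.comp (snd.comp snd))

theorem primrec_colorBound :
    Primrec fun x : (ℕ × ℕ) × ℕ × ℕ × ℕ => colorBound x.1.1 x.1.2 x.2.1 x.2.2.1 x.2.2.2 := by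
  have two : ∀ {f : (ℕ × ℕ) × ℕ × ℕ × ℕ → ℕ}, Primrec f → Primrec fun x => 2 ^ f x :=
    fun hf => primrec_nat_pow.comp (Primrec.const 2) hf
  have hv : Primrec fun x : (ℕ × ℕ) × ℕ × ℕ × ℕ => (2 * x.2.2.2 + 1) ^ x.1.1 :=
    primrec_nat_pow.comp (Primrec.succ.comp (Primrec.nat_mul.comp (Primrec.const 2)
      (snd.comp (snd.comp snd)))) (fst.comp fst)
  have hs : Primrec fun x : (ℕ × ℕ) × ℕ × ℕ × ℕ => 2 ^ x.1.2 := two (snd.comp fst)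
  have ht : Primrec fun x : (ℕ × ℕ) × ℕ × ℕ × ℕ => 2 ^ x.2.2.1 + 1 :=
    Primrec.succ.comp (two (fst.comp (snd.comp snd)))
  have hw : Primrec fun x : (ℕ × ℕ) × ℕ × ℕ × ℕ =>
      2 ^ (2 ^ x.1.2 * (2 * x.2.2.2 + 1) ^ x.1.1) * 2 ^ ((2 * x.2.2.2 + 1) ^ x.1.1) + 1 :=
    Primrec.succ.comp (Primrec.nat_mul.comp (two (Primrec.nat_mul.comp hs hv)) (two hv))
  have hs' : Primrec fun x : (ℕ × ℕ) × ℕ × ℕ × ℕ => 2 ^ x.2.1 := two (fst.comp snd)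
  exact Primrec.nat_mul.comp hs (Primrec.nat_mul.comp ht (Primrec.nat_mul.comp hw hs'))

theorem primrecRel_isCertificate : PrimrecRel IsCertificate := by
  have hm : Primrec fun y : (List (List ℤ) × AutomatonCode) × Certificate => y.1.1 := fst.comp fst
  have hd : Primrec fun y : (List (List ℤ) × AutomatonCode) × Certificate => y.1.1.length :=
    list_length.comp hm
  have hc : Primrec fun y : (List (List ℤ) × AutomatonCode) × Certificate => y.1.2 := snd.comp fst
  have hg : Primrec fun y : (List (List ℤ) × AutomatonCode) × Certificate => y.2.1 := fst.comp snd
  have hT : Primrec fun y : (List (List ℤ) × AutomatonCode) × Certificate => y.2.2.1 :=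
    fst.comp (snd.comp snd)
  have hμ : Primrec fun y : (List (List ℤ) × AutomatonCode) × Certificate => y.2.2.2.1 :=
    fst.comp (snd.comp (snd.comp snd))
  have hr : Primrec fun y : (List (List ℤ) × AutomatonCode) × Certificate => y.2.2.2.2.1 :=
    fst.comp (snd.comp (snd.comp (snd.comp snd)))
  have hc' : Primrec fun y : (List (List ℤ) × AutomatonCode) × Certificate => y.2.2.2.2.2 :=
    snd.comp (snd.comp (snd.comp (snd.comp snd)))
  have hK : Primrec fun y : (List (List ℤ) × AutomatonCode) × Certificate =>
      codeBound y.2.1 y.2.2.2.1 := primrec_codeBound.comp hg hμ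
  have hb : ∀ k : ℕ, Primrec fun y : (List (List ℤ) × AutomatonCode) × Certificate =>
      k * codeBound y.2.1 y.2.2.2.1 * y.2.2.2.2.1 := fun k =>
    Primrec.nat_mul.comp (Primrec.nat_mul.comp (Primrec.const k) hK) hr
  have hS : Primrec fun y : (List (List ℤ) × AutomatonCode) × Certificate =>
      colorBound y.1.1.length (codeSize y.1.2) (codeSize y.2.2.2.2.2) y.2.2.1.length
        (4 * codeBound y.2.1 y.2.2.2.1 * y.2.2.2.2.1) :=
    Primrec.comp (g := fun y : (List (List ℤ) × AutomatonCode) × Certificate =>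
      ((y.1.1.length, codeSize y.1.2), codeSize y.2.2.2.2.2, y.2.2.1.length,
        4 * codeBound y.2.1 y.2.2.2.1 * y.2.2.2.2.1)) primrec_colorBound
      ((hd.pair (primrec_codeSize.comp hc)).pair ((primrec_codeSize.comp hc').pair
        ((list_length.comp hT).pair (hb 4))))
  have hp : Primrec fun y : (List (List ℤ) × AutomatonCode) × Certificate =>
      certificateSearch y.1 y.2 := hm.pair (hc.pair (hr.pair hS))
  have h₁ : PrimrecPred fun y : (List (List ℤ) × AutomatonCode) × Certificate =>
      CodeTrap y.1.1 y.2.2.2.2.1 (3 * codeBound y.2.1 y.2.2.2.1 * y.2.2.2.2.1) y.2.2.1 :=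
    PrimrecPred.comp (f := fun y : (List (List ℤ) × AutomatonCode) × Certificate =>
      ((y.1.1, y.2.2.2.2.1, 3 * codeBound y.2.1 y.2.2.2.1 * y.2.2.2.2.1), y.2.2.1))
      primrecPred_codeTrap ((hm.pair (hr.pair (hb 3))).pair hT)
  have h₂ : ∀ {f : (List (List ℤ) × AutomatonCode) × Certificate → AutomatonCode}, Primrec f →
      PrimrecPred fun y => CodeLetters y.1.1.length y.2.2.2.2.1 (f y) := fun {f} hf =>
    PrimrecPred.comp (f := fun y : (List (List ℤ) × AutomatonCode) × Certificate =>
      ((y.1.1.length, y.2.2.2.2.1), f y)) primrecPred_codeLetters ((hd.pair hr).pair hf)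
  have h₃ : PrimrecPred fun y : (List (List ℤ) × AutomatonCode) × Certificate =>
      CodeRows y.1.1 y.2.2.2.1 ∧ 1 ≤ y.2.2.2.1 ∧ y.2.2.2.1 ≤ y.2.2.2.2.1 :=
    (primrecRel_codeRows.comp hm hμ).and
      (PrimrecPred.and (Primrec.nat_le.comp (Primrec.const 1) hμ) (Primrec.nat_le.comp hμ hr))
  exact ((primrecRel_codeRelation.comp hm hg).and h₁).and
    (h₃.and (((h₂ hc).and (h₂ hc')).and (primrecRel_codeRecognizes.comp hp hc')))

end Check

/-! ### Soundness and existence of certificates -/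

section Correctness

variable {d : ℕ} {M : Matrix (Fin d) (Fin d) ℤ}

theorem forall_mem_ofFn {x : Fin d → ℤ} {p : ℤ → Prop} :
    (∀ y ∈ List.ofFn x, p y) ↔ ∀ i, p (x i) := by
  simp only [List.mem_ofFn', Set.forall_mem_range]

theorem codeNonneg_iff {t : List (Fin d → ℤ)} :
    CodeNonneg (matrixCode M) (t.map List.ofFn) ↔ ∀ i, 0 ≤ wordValue M t i := by
  rw [CodeNonneg, codeValue_matrixCode, forall_mem_ofFn]
  exact forall_congr' fun i => by omega

theorem codePad_map_ofFn (u : List (Fin d → ℤ)) (k : ℕ) :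
    codePad d (u.map List.ofFn) k = (u ++ List.replicate k 0).map List.ofFn := by
  rw [codePad, List.map_append, List.map_replicate, codeZero_eq, List.map_const',
    List.length_range]

theorem mem_searchWords {c : AutomatonCode} {r S n : ℕ} {l : List (List ℤ)} :
    l ∈ searchWords (matrixCode M, c, r, S) n ↔ ∃ w : List (Fin d → ℤ), w.length = n ∧
      (∀ a ∈ w, a ∈ box (Fin d) r) ∧ w.map List.ofFn = l := by
  rw [searchWords, length_matrixCode]
  exact mem_wordList_codeBox

theorem forall_mem_searchWords {c : AutomatonCode} {r S n : ℕ} {p : List (List ℤ) → Prop} :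
    (∀ l ∈ searchWords (matrixCode M, c, r, S) n, p l) ↔ ∀ w : List (Fin d → ℤ), w.length = n →
      (∀ a ∈ w, a ∈ box (Fin d) r) → p (w.map List.ofFn) := by
  simp only [mem_searchWords]
  exact ⟨fun h w h₁ h₂ => h _ ⟨w, h₁, h₂, rfl⟩, fun h l ⟨w, h₁, h₂, e⟩ => e ▸ h w h₁ h₂⟩

/-- The padding is bounded by the number of colours, and the length of `v` by that of the padded
word, so the search is exhaustive. -/
theorem codeHasValue_iff {C : Type*} [Fintype C] {f : List (Fin d → ℤ) → C} {c : AutomatonCode}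
    {r S : ℕ} (hf : Colors f (valueWords M r (c.language d))) (hS : Fintype.card C ≤ S)
    (hc : ∀ u ∈ c.language d, ∀ a ∈ u, a ∈ box (Fin d) r) {t : List (Fin d → ℤ)}
    (ht : ∀ a ∈ t, a ∈ box (Fin d) r) :
    CodeHasValue (matrixCode M, c, r, S) (t.map List.ofFn) ↔
      t ∈ padClosure 0 (valueWords M r (c.language d)) := by
  rw [mem_padClosure_iff_bounded hf hS]
  refine exists_congr fun k => and_congr_right fun _ => ?_
  have hk : ∀ a ∈ t ++ List.replicate k 0, a ∈ box (Fin d) r := fun a ha =>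
    (List.mem_append.1 ha).elim (ht a) fun h => List.eq_of_mem_replicate h ▸ zero_mem_box r
  have hv : wordValue M (t ++ List.replicate k 0) = wordValue M t := by
    rw [wordValue_append, wordValue_replicate_zero, Matrix.mulVec_zero, add_zero]
  have hl : (t ++ List.replicate k 0).length = (t.map List.ofFn).length + k := by simp
  constructor
  · rintro ⟨l, hlt, v, hmem, hacc, hval⟩
    obtain ⟨v, rfl, _, rfl⟩ := mem_searchWords.1 hmem
    rw [codeValue_matrixCode, codeValue_matrixCode] at hval
    exact ⟨hk, v, (codeAccepts_iff c v).1 hacc, by omega,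
      (List.ofFn_injective hval).trans hv.symm⟩
  · rintro ⟨_, v, hvL, hlen, hval⟩
    refine ⟨v.length, by omega, _, mem_searchWords.2 ⟨v, rfl, hc v hvL, rfl⟩,
      (codeAccepts_iff c v).2 hvL, ?_⟩
    rw [codeValue_matrixCode, codeValue_matrixCode, hval, hv]

theorem codeInterior_iff {C : Type*} [Fintype C] {f : List (Fin d → ℤ) → C} {c : AutomatonCode}
    {r S : ℕ} (h₁ : Colors f (nonnegWords M r)) (h₂ : Colors f (valueWords M r (c.language d)))
    (hS : Fintype.card C ≤ S) (hc : ∀ u ∈ c.language d, ∀ a ∈ u, a ∈ box (Fin d) r)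
    {u : List (Fin d → ℤ)} (hu : ∀ a ∈ u, a ∈ box (Fin d) r) :
    CodeInterior (matrixCode M, c, r, S) (u.map List.ofFn) ↔
      u ∈ stableInterior (box (Fin d) r) 0 (c.language d) (nonnegWords M r)
        (padClosure 0 (valueWords M r (c.language d))) := by
  have hnonneg : ∀ t : List (Fin d → ℤ), (∀ a ∈ t, a ∈ box (Fin d) r) →
      (CodeNonneg (matrixCode M) (t.map List.ofFn) ↔ t ∈ nonnegWords M r) := fun t ht =>
    codeNonneg_iff.trans (and_iff_right ht).symm
  rw [mem_stableInterior_iff_bounded h₁ (h₂.padClosure 0) hS, CodeInterior]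
  refine and_congr (codeAccepts_iff c u) (and_congr (hnonneg u hu) (exists_congr fun k =>
    and_congr_right fun _ => forall_congr' fun n => forall_congr' fun _ => ?_))
  rw [forall_mem_searchWords]
  refine forall_congr' fun w => forall_congr' fun _ => forall_congr' fun hw => ?_
  have ht : ∀ a ∈ u ++ List.replicate k 0 ++ w, a ∈ box (Fin d) r := fun a ha =>
    (List.mem_append.1 ha).elim (fun ha => (List.mem_append.1 ha).elim (hu a)
      fun h => List.eq_of_mem_replicate h ▸ zero_mem_box r) (hw a)
  simp only [length_matrixCode]
  rw [codePad_map_ofFn, ← List.map_append]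
  exact imp_congr (hnonneg _ ht) (codeHasValue_iff h₂ hS hc ht)

/-- A single colouring `f` serves both automata, the nonnegative words and the value words, so one
bound `S` suffices for every nested quantifier and for the final comparison. -/
theorem codeRecognizes_iff {C : Type*} [Fintype C] {f : List (Fin d → ℤ) → C}
    {c c' : AutomatonCode} {r S : ℕ} (h : Colors f (c.language d)) (h' : Colors f (c'.language d))
    (h₁ : Colors f (nonnegWords M r)) (h₂ : Colors f (valueWords M r (c.language d)))
    (hS : Fintype.card C ≤ S) (hc : ∀ u ∈ c.language d, ∀ a ∈ u, a ∈ box (Fin d) r)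
    (hc' : ∀ u ∈ c'.language d, ∀ a ∈ u, a ∈ box (Fin d) r) :
    CodeRecognizes (matrixCode M, c, r, S) c' ↔ c'.language d =
      stableInterior (box (Fin d) r) 0 (c.language d) (nonnegWords M r)
        (padClosure 0 (valueWords M r (c.language d))) := by
  have key : CodeRecognizes (matrixCode M, c, r, S) c' ↔ ∀ n < S, ∀ u : List (Fin d → ℤ),
      u.length = n → (∀ a ∈ u, a ∈ box (Fin d) r) → (u ∈ c'.language d ↔
        u ∈ stableInterior (box (Fin d) r) 0 (c.language d) (nonnegWords M r)
          (padClosure 0 (valueWords M r (c.language d)))) := by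
    refine forall_congr' fun n => forall_congr' fun _ => ?_
    rw [forall_mem_searchWords]
    refine forall_congr' fun u => forall_congr' fun _ => forall_congr' fun hu => ?_
    rw [codeAccepts_iff, codeInterior_iff h₁ h₂ hS hc hu]
  rw [key]
  refine ⟨fun H => ?_, fun H n _ u _ _ => by rw [H]⟩
  refine eq_of_forall_short h' (h.stableInterior h₁ (h₂.padClosure 0) _ _) hS (box (Fin d) r) ?_ H
  rintro u (hu | hu)
  · exact hc' u hu
  · exact hc u hu.1

theorem codeRelation_iff {g : List ℤ} :
    CodeRelation (matrixCode M) g ↔ IsDominantRelation M g := by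
  have key : ∀ i : Fin d, codeValue (matrixCode M) (g.map fun z => (List.range d).map fun j =>
      if j = (i : ℕ) then z else 0) = List.ofFn (wordValue M (g.map fun z => Pi.single i z)) := by
    intro i
    rw [← codeValue_matrixCode, List.map_map]
    congr 2
    ext1 z
    rw [map_range_eq_ofFn, Function.comp_apply]
    congr 1
    ext j
    rw [Pi.single_apply]
    exact if_congr Fin.ext_iff.symm rfl rfl
  have h₂ : (∀ i < d, codeValue (matrixCode M) (g.map fun z => (List.range d).map fun j =>
      if j = i then z else 0) = codeZero d) ↔
        ∑ k ∈ Finset.range g.length, g.getD k 0 • M ^ k = 0 := by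
    rw [sum_smul_pow_eq_zero_iff]
    constructor
    · intro h i
      have := h i i.2
      rw [key, codeZero_eq] at this
      exact List.ofFn_injective this
    · intro h i hi
      rw [key ⟨i, hi⟩, h, codeZero_eq]
  rw [CodeRelation, length_matrixCode, h₂, sum_map_natAbs]
  exact ⟨fun h => ⟨h.2, h.1⟩, fun h => ⟨h.2, h.1⟩⟩

theorem codeRows_iff {μ : ℕ} :
    CodeRows (matrixCode M) μ ↔ ∀ i, ∑ j, (M i j).natAbs ≤ μ := by
  simp only [CodeRows, matrixCode, List.mem_ofFn', Set.forall_mem_range, List.map_ofFn,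
    List.sum_ofFn, Function.comp_apply]

theorem codeBound_eq (g : List ℤ) (μ : ℕ) : codeBound g μ = orbitBound g μ := by
  rw [codeBound, orbitBound, sum_map_natAbs]

/-- Entries of the list that are not codes of vectors of dimension `d` are dropped by taking the
preimage; this does not increase the cardinality. -/
theorem CodeTrap.exists_isTrap {r b : ℕ} {T : List (List ℤ)}
    (hT : CodeTrap (matrixCode M) r b T) :
    ∃ T' : Finset (Fin d → ℤ), IsTrap M r b T' ∧ T'.card ≤ T.length := by
  classical
  have hmem : ∀ x : Fin d → ℤ, x ∈ T.toFinset.preimage List.ofFn List.ofFn_injective.injOn ↔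
      List.ofFn x ∈ T := fun x => by rw [Finset.mem_preimage, List.mem_toFinset]
  obtain ⟨h0, hstep⟩ := hT
  rw [length_matrixCode] at h0 hstep
  refine ⟨T.toFinset.preimage List.ofFn List.ofFn_injective.injOn, ⟨?_, fun h hh x hx => ?_⟩,
    (Finset.card_le_card_of_injOn List.ofFn (fun x hx => Finset.mem_preimage.1 hx)
      List.ofFn_injective.injOn).trans (List.toFinset_card_le T)⟩
  · rwa [hmem, ← codeZero_eq]
  · have := hstep _ ((hmem h).1 hh) _ (mem_codeBox.2 ⟨x, hx, rfl⟩)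
    rwa [codeStep_matrixCode, forall_mem_ofFn, ← hmem] at this

theorem IsTrap.codeTrap {r b : ℕ} {T : Finset (Fin d → ℤ)} (hT : IsTrap M r b T) :
    CodeTrap (matrixCode M) r b (T.toList.map List.ofFn) := by
  have hmem : ∀ x, List.ofFn x ∈ T.toList.map List.ofFn ↔ x ∈ T := fun x => by
    rw [List.mem_map_of_injective List.ofFn_injective, Finset.mem_toList]
  refine ⟨?_, fun h hh x hx => ?_⟩
  · rw [length_matrixCode, codeZero_eq, hmem]
    exact hT.zero_mem
  · obtain ⟨v, hv, rfl⟩ := List.mem_map.1 hh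
    rw [length_matrixCode] at hx
    obtain ⟨y, hy, rfl⟩ := mem_codeBox.1 hx
    rw [codeStep_matrixCode, forall_mem_ofFn, hmem]
    exact hT.step v (Finset.mem_toList.1 hv) y hy

/-- The four factors count the state sets of `c`, the sign colours, the value colours and the state
sets of `c'`. -/
theorem card_colors_le (c c' : AutomatonCode) {T : Finset (Fin d → ℤ)} {τ : ℕ}
    (hT : T.card ≤ τ) (b : ℕ) :
    Fintype.card (Set (codeStates c) × Option (Set T) ×
      Option (Set (Set (codeStates c) × boxFinset (Fin d) b) × Set (boxFinset (Fin d) b)) ×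
      Set (codeStates c')) ≤ colorBound d (codeSize c) (codeSize c') τ b := by
  simp only [Fintype.card_prod, Fintype.card_option, Fintype.card_set, Fintype.card_coe,
    card_boxFinset, Fintype.card_fin, colorBound]
  have h := card_codeStates_le c
  have h' := card_codeStates_le c'
  gcongr <;> norm_num

/-- The left side mentions neither `β` nor `P`, so the test does not depend on the hyperplane. The
two directions give soundness and completeness of the search. -/
theorem certificate_recognizes_iff {β : ℝ} (hM : IsIrreduciblePisotUnimodular M β)
    {P : Submodule ℝ (Fin d → ℝ)} (hPE : IsCompl P (realEigenspace M β)) {c c' : AutomatonCode}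
    {g : List ℤ} {T : List (List ℤ)} {μ r : ℕ} (hg : IsDominantRelation M g)
    (hT : CodeTrap (matrixCode M) r (3 * orbitBound g μ * r) T)
    (hμ1 : 1 ≤ μ) (hμ : ∀ i, ∑ j, (M i j).natAbs ≤ μ) (hr : μ ≤ r)
    (hc : CodeLetters d r c) (hc' : CodeLetters d r c') :
    CodeRecognizes (certificateSearch (matrixCode M, c) (g, T, μ, r, c')) c' ↔
      c'.language d =
        interiorLanguage M (P.projectionOnto (realEigenspace M β) hPE) (c.language d) := by
  classical
  obtain ⟨R, hP⟩ := hM.exists_isSpectralProjection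
  have hK := hg.isValueBound hM hP hμ1 hμ
  obtain ⟨T', hT', hcard⟩ := hT.exists_isTrap
  have hL : ∀ u ∈ c.language d, ∀ a ∈ u, a ∈ box (Fin d) r := fun u => mem_box_of_mem_language hc
  have hL' : ∀ u ∈ c'.language d, ∀ a ∈ u, a ∈ box (Fin d) r := fun u =>
    mem_box_of_mem_language hc'
  rw [interiorLanguage_eq_stableInterior hM hP hK hPE hμ1 hμ hr hL]
  have h := colors_stateColor (d := d) c
  have h' := colors_stateColor (d := d) c'
  have h₁ := colors_nonnegColor hK hM.one_lt hP hT'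
  have h₂ := colors_valueColor hK hM.one_lt hP h hL
  have e : certificateSearch (matrixCode M, c) (g, T, μ, r, c') = (matrixCode M, c, r,
      colorBound d (codeSize c) (codeSize c') T.length (4 * orbitBound g μ * r)) := by
    rw [certificateSearch, length_matrixCode, codeBound_eq]
  rw [e]
  let f := fun u : List (Fin d → ℤ) => (stateColor c u, nonnegColor M r T' u,
    valueColor (stateColor c) M r (4 * orbitBound g μ * r) (c.language d) u, stateColor c' u)
  exact codeRecognizes_iff (f := f)
    (h.of_refines fun u v huv => congrArg Prod.fst huv)
    (h'.of_refines fun u v huv => congrArg (fun x => x.2.2.2) huv)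
    (h₁.of_refines fun u v huv => congrArg (fun x => x.2.1) huv)
    (h₂.of_refines fun u v huv => congrArg (fun x => x.2.2.1) huv)
    (card_colors_le c c' hcard _) hL hL'

theorem IsCertificate.language_eq {β : ℝ} (hM : IsIrreduciblePisotUnimodular M β)
    {P : Submodule ℝ (Fin d → ℝ)} (hPE : IsCompl P (realEigenspace M β)) {c : AutomatonCode}
    {w : Certificate} (hw : IsCertificate (matrixCode M, c) w) :
    w.2.2.2.2.language d =
      interiorLanguage M (P.projectionOnto (realEigenspace M β) hPE) (c.language d) := by
  obtain ⟨g, T, μ, r, c'⟩ := w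
  obtain ⟨⟨hg, hT⟩, ⟨hμ, hμ1, hr⟩, ⟨hc, hc'⟩, hrec⟩ := hw
  simp only [length_matrixCode, codeBound_eq] at hT hc hc'
  exact (certificate_recognizes_iff hM hPE (codeRelation_iff.1 hg) hT hμ1 (codeRows_iff.1 hμ) hr
    hc hc').1 hrec

/-- The existence of the automaton comes from regularity, with no effective construction; it passes
the bounded test because its language is the right one. -/
theorem exists_isCertificate {β : ℝ} (hM : IsIrreduciblePisotUnimodular M β)
    {P : Submodule ℝ (Fin d → ℝ)} (hPE : IsCompl P (realEigenspace M β)) (c : AutomatonCode) :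
    ∃ w, IsCertificate (matrixCode M, c) w := by
  obtain ⟨μ, hμ1, hμ⟩ := exists_rowBound M
  obtain ⟨ρ, hρ⟩ := exists_radius d c
  obtain ⟨R, hP⟩ := hM.exists_isSpectralProjection
  obtain ⟨g, hg⟩ := hM.exists_isDominantRelation
  have hK := hg.isValueBound hM hP hμ1 hμ
  have hr : μ ≤ μ + ρ := Nat.le_add_right _ _
  have hc : CodeLetters d (μ + ρ) c := fun t ht h y hy =>
    (hρ t ht h y hy).trans (Nat.le_add_left _ _)
  obtain ⟨T, hT⟩ := hK.exists_isTrap hM hP (μ + ρ) (3 * orbitBound g μ * (μ + ρ))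
  have hL : ∀ u ∈ c.language d, ∀ a ∈ u, a ∈ boxFinset (Fin d) (μ + ρ) := fun u hu a ha =>
    mem_boxFinset.2 (mem_box_of_mem_language hc hu a ha)
  obtain ⟨c', hc'L, hc'⟩ := exists_automatonCode (r := μ + ρ)
    (isRegular_interiorLanguage hM hPE hL (c.isRegular_language d))
    fun u hu a ha => mem_boxFinset.1 (hL u hu.1 a ha)
  refine ⟨(g, T.toList.map List.ofFn, μ, μ + ρ, c'), ⟨codeRelation_iff.2 hg, ?_⟩,
    ⟨codeRows_iff.2 hμ, hμ1, hr⟩, ?_,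
    (certificate_recognizes_iff hM hPE hg hT.codeTrap hμ1 hμ hr hc hc').2 hc'L⟩
  · simp only [codeBound_eq]
    exact hT.codeTrap
  · simp only [length_matrixCode]
    exact ⟨hc, hc'⟩

end Correctness

/-! ### The unbounded search and the theorem -/

open Classical in
/-- The result of the test of the `n`-th certificate. -/
noncomputable def searchStep (x : List (List ℤ) × AutomatonCode) (n : ℕ) : Option AutomatonCode :=
  (Encodable.decode (α := Certificate) n).bind fun w =>
    if IsCertificate x w then some w.2.2.2.2 else none

theorem computable_searchStep : Computable₂ searchStep := by
  classical
  refine Primrec.to_comp ?_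
  have h : Primrec₂ fun (y : (List (List ℤ) × AutomatonCode) × ℕ) (w : Certificate) =>
      if IsCertificate y.1 w then some w.2.2.2.2 else none :=
    (Primrec.ite (primrecRel_isCertificate.comp (Primrec.fst.comp Primrec.fst) Primrec.snd)
      (Primrec.option_some.comp (Primrec.snd.comp (Primrec.snd.comp (Primrec.snd.comp
        (Primrec.snd.comp Primrec.snd))))) (Primrec.const none)).to₂
  exact (Primrec.option_bind (Primrec.decode.comp Primrec.snd) h).of_eq fun y => by
    unfold searchStep
    congr

theorem mem_searchStep {x : List (List ℤ) × AutomatonCode} {n : ℕ} {c' : AutomatonCode} :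
    c' ∈ searchStep x n ↔ ∃ w : Certificate, Encodable.decode n = some w ∧ IsCertificate x w ∧
      w.2.2.2.2 = c' := by
  rw [searchStep, Option.mem_def, Option.bind_eq_some_iff]
  simp only [Option.ite_none_right_eq_some, Option.some.injEq]

theorem mainTheorem3 :
    (∀ (A : Type*) [Fintype A] [DecidableEq A] (alphabet : Finset (A → ℤ))
        (L : Language (A → ℤ)) (M : Matrix A A ℤ) (β : ℝ) (P : Submodule ℝ (A → ℝ))
        (hP : IsCompl P (realEigenspace M β)),
        (∀ u ∈ L, ∀ a ∈ u, a ∈ alphabet) → L.IsRegular →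
        IsIrreduciblePisotUnimodular M β →
        (interiorLanguage M (P.projectionOnto (realEigenspace M β) hP) L).IsRegular ∧
        languageValue M
            (interiorLanguage M (P.projectionOnto (realEigenspace M β) hP) L) =
          discreteInterior (P.projectionOnto (realEigenspace M β) hP)
            (languageValue M L)) ∧
    (∃ f : List (List ℤ) × AutomatonCode →. AutomatonCode, Partrec f ∧
      ∀ (d : ℕ) (M : Matrix (Fin d) (Fin d) ℤ) (β : ℝ) (P : Submodule ℝ (Fin d → ℝ))
        (hP : IsCompl P (realEigenspace M β)),
        IsIrreduciblePisotUnimodular M β →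
        ∀ c : AutomatonCode, ∃ c' ∈ f (matrixCode M, c),
          c'.language d =
            interiorLanguage M (P.projectionOnto (realEigenspace M β) hP)
              (c.language d)) := by
  refine ⟨fun A _ _ alphabet L M β P hP hL hreg hM =>
    ⟨isRegular_interiorLanguage hM hP hL hreg, languageValue_interiorLanguage _ _ _⟩,
    fun x => Nat.rfindOpt (searchStep x), Partrec.rfindOpt computable_searchStep, ?_⟩
  intro d M β P hP hM c
  obtain ⟨w, hw⟩ := exists_isCertificate hM hP c
  have hdom : (Nat.rfindOpt (searchStep (matrixCode M, c))).Dom :=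
    Nat.rfindOpt_dom.2 ⟨Encodable.encode w, _,
      mem_searchStep.2 ⟨w, Encodable.encodek w, hw, rfl⟩⟩
  obtain ⟨c', hc'⟩ := Part.dom_iff_mem.1 hdom
  refine ⟨c', hc', ?_⟩
  -- The certificate found need not be `w`, which only ensures halting; every certificate is sound.
  obtain ⟨n, hn⟩ := Nat.rfindOpt_spec hc'
  obtain ⟨w', _, hw', rfl⟩ := mem_searchStep.1 hn
  exact hw'.language_eq hM hP
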